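/- Let $c\in\mathbb C\setminus\mathbb R$ with $0<|c|<1$ and $0<|1-c|<1$, put $\psi_1(z)=c\bar z$ and $\psi_2(z)=(1-|c|^2)\bar z+|c|^2$, and let $K$ be Hata's tree-like set, i.e. the unique nonempty compact $K\subset\mathbb C$ with $K=\psi_1(K)\cup\psi_2(K)$. Let $\pi:\Sigma=\{1,2\}^{\mathbb N}\to K$ be the continuous surjection with $\psi_i(\pi(\omega))=\pi(i\omega)$, let $\sigma$ be the left shift on $\Sigma$, let $\mathcal P=\bigcup_{m\ge1}\sigma^m(\pi^{-1}(\psi_1(K)\cap\psi_2(K)))$ be the post-critical set, and $V_0=\pi(\mathcal P)$. Let $\mu$ be a Borel probability measure on $K$ with full support. 1. $\mathcal P$ is finite, $V_0=\{c,0,1\}$, and $c$ is a fixed point of neither $\psi_1$ nor $\psi_2$; in particular it is not true that every $q\in V_0$ is a fixed point of some $\psi_i$ with $K\setminus\{q\}$ connected. 2. Let $(D,\boldsymbol r)$ be any regular harmonic structure: $D$ is a real symmetric matrix indexed by $V_0$, nonpositive definite, with $Du=0$ if and only if $u$ is constant, with nonnegative off-diagonal entries; $\boldsymbol r=(r_1,r_2)$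 with $0<r_i<1$; and, with $$\mathcal E^{(0)}(u,v)=(-Du,v)_{l(V_0)},\qquad \mathcal E^{(m)}(u,v)=\sum_{w\in\{1,2\}^m}\frac1{r_{w_1}\cdots r_{w_m}}\,\mathcal E^{(0)}(u\circ\psi_w|_{V_0},v\circ\psi_w|_{V_0}),\quad \psi_w=\psi_{w_1}\circ\cdots\circ\psi_{w_m},$$ one has, for every $v\in l(V_0)$, $\mathcal E^{(0)}(v,v)=\inf\{\mathcal E^{(1)}(u,u): u|_{V_0}=v\}$. Let $\mathcal F=\{u\in C(K)\subset L^2(K,\mu):\lim_m\mathcal E^{(m)}(u,u)<\infty\}$ and $\mathcal E(u,v)=\lim_m\mathcal E^{(m)}(u,v)$ for $u,v\in\mathcal F$. Then $(\mathcal E,\mathcal F)$ is a regular Dirichlet form on $L^2(K,\mu)$, and its index is one, in the following sense. Every $f\in\mathcal F$ has a unique energy measure $\nu_f$, i.e. a finite Borel measure on $K$ with $\int\varphi\,d\nu_f=2\mathcal E(f\varphi,f)-\mathcal E(\varphi,f^2)$ for all $\varphi\in\mathcal F$; put $\nu_{f,g}=\frac12(\nu_{f+g}-\nu_f-\nu_g)$.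 There is a minimal energy-dominant measure, i.e. a $\sigma$-finite Borel measure $\nu$ with $\nu_f\ll\nu$ for all $f\in\mathcal F$ and with $\nu\ll\nu'$ for every $\sigma$-finite Borel measure $\nu'$ having the same property. For every minimal energy-dominant measure $\nu$, the smallest $p\in\{0,1,2,\dots\}\cup\{\infty\}$ such that for all $N$ and all $f_1,\dots,f_N\in\mathcal F$ $$\operatorname{rank}\Bigl(\frac{d\nu_{f_i,f_j}}{d\nu}(x)\Bigr)_{i,j=1}^N\le p\quad\text{for }\nu\text{-a.e. }x$$ is $p=1$. -/

import Mathlib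

open MeasureTheory Filter Topology
open scoped ComplexConjugate

/-! ### Dirichlet forms, energy measures, and the index -/

section Dirichlet

/-- The raw data of a symmetric form on `L²(X, μ)`: its domain, a set of `μ`-classes of functions,
and its values (which are meaningful on the domain only). -/
structure FormData (X : Type*) [MeasurableSpace X] (μ : Measure X) where
  domain : Set (X →ₘ[μ] ℝ)
  form : (X →ₘ[μ] ℝ) → (X →ₘ[μ] ℝ) → ℝ

variable {X : Type*} [TopologicalSpace X] [MeasurableSpace X] [BorelSpace X]
  [SecondCountableTopology X] {μ : Measure X}

namespace FormData

/-- `𝓔₁(f, g) = 𝓔(f, g) + ∫ f g dμ`. -/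
noncomputable def form₁ (E : FormData X μ) (f g : X →ₘ[μ] ℝ) : ℝ :=
  E.form f g + ∫ x, f x * g x ∂μ

/-- `(𝓔, 𝓕)` is a symmetric regular Dirichlet form on `L²(X, μ)`. -/
structure IsRegularDirichletForm (E : FormData X μ) : Prop where
  /-- the domain is a linear subspace of `L²(X, μ)` -/
  zero_mem : (0 : X →ₘ[μ] ℝ) ∈ E.domain
  add_mem : ∀ f ∈ E.domain, ∀ g ∈ E.domain, f + g ∈ E.domain
  smul_mem : ∀ (a : ℝ), ∀ f ∈ E.domain, a • f ∈ E.domain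
  memLp : ∀ f ∈ E.domain, MemLp f 2 μ
  /-- the domain is dense in `L²(X, μ)` -/
  dense : ∀ f : X →ₘ[μ] ℝ, MemLp f 2 μ → ∀ ε : ℝ, 0 < ε →
    ∃ g ∈ E.domain, ∫ x, ((f - g : X →ₘ[μ] ℝ) x) ^ 2 ∂μ < ε
  /-- the form is bilinear, symmetric and nonnegative definite -/
  form_add : ∀ f ∈ E.domain, ∀ g ∈ E.domain, ∀ h ∈ E.domain,
    E.form (f + g) h = E.form f h + E.form g h
  form_smul : ∀ (a : ℝ), ∀ f ∈ E.domain, ∀ g ∈ E.domain, E.form (a • f) g = a * E.form f g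
  form_symm : ∀ f ∈ E.domain, ∀ g ∈ E.domain, E.form f g = E.form g f
  form_nonneg : ∀ f ∈ E.domain, 0 ≤ E.form f f
  /-- closedness -/
  closed : ∀ f : ℕ → (X →ₘ[μ] ℝ), (∀ i, f i ∈ E.domain) →
    (∀ ε : ℝ, 0 < ε → ∃ n, ∀ i ≥ n, ∀ j ≥ n, E.form₁ (f i - f j) (f i - f j) < ε) →
    ∃ g ∈ E.domain, Tendsto (fun i => E.form₁ (f i - g) (f i - g)) atTop (𝓝 0)
  /-- Markov property, for the truncation `min (max 0 f) 1` -/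
  markov : ∀ f ∈ E.domain, (0 ⊔ f) ⊓ 1 ∈ E.domain ∧
    E.form ((0 ⊔ f) ⊓ 1) ((0 ⊔ f) ⊓ 1) ≤ E.form f f
  /-- regularity: the continuous functions with compact support in the domain are dense
  in the domain, and dense in `C₀(X)` for the uniform norm -/
  dense_domain : ∀ f ∈ E.domain, ∀ ε : ℝ, 0 < ε → ∃ φ : C(X, ℝ), HasCompactSupport φ ∧
    φ.toAEEqFun μ ∈ E.domain ∧ E.form₁ (f - φ.toAEEqFun μ) (f - φ.toAEEqFun μ) < ε
  dense_continuous : ∀ u : C(X, ℝ), HasCompactSupport u → ∀ ε : ℝ, 0 < ε →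
    ∃ φ : C(X, ℝ), HasCompactSupport φ ∧ φ.toAEEqFun μ ∈ E.domain ∧ ∀ x, |u x - φ x| ≤ ε

/-- The identity `∫ φ dν = 2 𝓔(f φ, f) - 𝓔(φ, f²)` for all `φ ∈ 𝓕 ∩ C₀(X)`, which determines the
energy measure `ν` of a bounded `f ∈ 𝓕`. -/
def EnergyIdentity (E : FormData X μ) (f : X →ₘ[μ] ℝ) (ν : FiniteMeasure X) : Prop :=
  ∀ φ : C(X, ℝ), HasCompactSupport φ → φ.toAEEqFun μ ∈ E.domain →
    ∫ x, φ x ∂(ν : Measure X) =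
      2 * E.form (f * φ.toAEEqFun μ) f - E.form (φ.toAEEqFun μ) (f * f)

/-- `ν` is the energy measure of `f ∈ 𝓕`: for bounded `f` this is the energy identity; in general
`ν` is the setwise limit of the energy measures of bounded functions converging to `f` in `𝓕`. -/
def IsEnergyMeasure (E : FormData X μ) (f : X →ₘ[μ] ℝ) (ν : FiniteMeasure X) : Prop :=
  (MemLp f ⊤ μ → E.EnergyIdentity f ν) ∧
  (¬ MemLp f ⊤ μ → ∃ (g : ℕ → (X →ₘ[μ] ℝ)) (κ : ℕ → FiniteMeasure X),
    (∀ n, g n ∈ E.domain ∧ MemLp (g n) ⊤ μ ∧ E.EnergyIdentity (g n) (κ n)) ∧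
    Tendsto (fun n => E.form₁ (g n - f) (g n - f)) atTop (𝓝 0) ∧
    ∀ B : Set X, MeasurableSet B → Tendsto (fun n => κ n B) atTop (𝓝 (ν B)))

open Classical in
/-- The energy measure `ν_f` of `f ∈ 𝓕` (and `0` if there is none). -/
noncomputable def energyMeasure (E : FormData X μ) (f : X →ₘ[μ] ℝ) : FiniteMeasure X :=
  if h : ∃ ν, E.IsEnergyMeasure f ν then h.choose else 0

/-- The mutual energy measure `ν_{f,g} = (ν_{f+g} - ν_f - ν_g) / 2`. -/
noncomputable def mutualEnergyMeasure (E : FormData X μ) (f g : X →ₘ[μ] ℝ) : SignedMeasure X :=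
  (1 / 2 : ℝ) • ((E.energyMeasure (f + g) : Measure X).toSignedMeasure
    - (E.energyMeasure f : Measure X).toSignedMeasure
    - (E.energyMeasure g : Measure X).toSignedMeasure)

/-- `ν` dominates all energy measures. -/
def EnergyDominant (E : FormData X μ) (ν : Measure X) : Prop :=
  ∀ f ∈ E.domain, (E.energyMeasure f : Measure X) ≪ ν

/-- `ν` is a minimal energy-dominant measure. -/
def IsMinimalEnergyDominant (E : FormData X μ) (ν : Measure X) : Prop :=
  SigmaFinite ν ∧ E.EnergyDominant ν ∧
    ∀ ν' : Measure X, SigmaFinite ν' → E.EnergyDominant ν' → ν ≪ ν'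

/-- The matrix of densities `(dν_{f_i,f_j}/dν)(x)`. -/
noncomputable def densityMatrix (E : FormData X μ) (ν : Measure X) {n : ℕ}
    (f : Fin n → (X →ₘ[μ] ℝ)) (x : X) : Matrix (Fin n) (Fin n) ℝ :=
  Matrix.of fun i j => (E.mutualEnergyMeasure (f i) (f j)).rnDeriv ν x

/-- `p` is the index computed with the measure `ν`: the smallest element of `ℤ₊ ∪ {∞}` that bounds
`ν`-a.e. the rank of every density matrix. -/
def IsIndexFor (E : FormData X μ) (ν : Measure X) (p : ℕ∞) : Prop :=
  IsLeast {q : ℕ∞ | ∀ (n : ℕ) (f : Fin n → (X →ₘ[μ] ℝ)), (∀ i, f i ∈ E.domain) →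
    ∀ᵐ x ∂ν, ((E.densityMatrix ν f x).rank : ℕ∞) ≤ q} p

/-- The form `(𝓔, 𝓕)` has index `p`. Every `f ∈ 𝓕` has exactly one energy measure, there are
minimal energy-dominant measures, and each of them yields the index `p`. -/
def HasIndex (E : FormData X μ) (p : ℕ∞) : Prop :=
  (∀ f ∈ E.domain, ∃! ν : FiniteMeasure X, E.IsEnergyMeasure f ν) ∧
  (∃ ν : Measure X, E.IsMinimalEnergyDominant ν) ∧
  ∀ ν : Measure X, E.IsMinimalEnergyDominant ν → E.IsIndexFor ν p

end FormData

end Dirichlet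

/-! ### Self-similar structures and harmonic structures -/

/-- Prepend the letter `i` to an infinite word. -/
def prependLetter {N : ℕ} (i : Fin N) (ω : ℕ → Fin N) : ℕ → Fin N
  | 0 => i
  | n + 1 => ω n

/-- A self-similar structure `(K, {1, …, N}, {ψ_i})`, with its coding map `π : Σ → K`. -/
structure SelfSimilarStructure (K : Type*) [TopologicalSpace K] (N : ℕ) where
  one_lt : 1 < N
  ψ : Fin N → K → K
  continuous_ψ : ∀ i, Continuous (ψ i)
  injective_ψ : ∀ i, Function.Injective (ψ i)
  π : (ℕ → Fin N) → K
  continuous_π : Continuous π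
  surjective_π : Function.Surjective π
  ψ_π : ∀ i ω, ψ i (π ω) = π (prependLetter i ω)

namespace SelfSimilarStructure

variable {K : Type*} [TopologicalSpace K] {N : ℕ}

/-- The critical set `⋃_{i ≠ j} K_i ∩ K_j`, with `K_i = ψ_i(K)`. -/
def overlap (L : SelfSimilarStructure K N) : Set K :=
  {x | ∃ i j : Fin N, i ≠ j ∧ x ∈ Set.range (L.ψ i) ∩ Set.range (L.ψ j)}

/-- The post-critical set `𝒫 = ⋃_{m ≥ 1} σ^m (π⁻¹ (⋃_{i ≠ j} K_i ∩ K_j))`, where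
`(σ^m ω)_n = ω_{n + m}`. -/
def postCritical (L : SelfSimilarStructure K N) : Set (ℕ → Fin N) :=
  {τ | ∃ m : ℕ, 1 ≤ m ∧ ∃ ω : ℕ → Fin N, L.π ω ∈ L.overlap ∧ τ = fun n => ω (n + m)}

/-- The self-similar structure is post-critically finite. -/
def IsPostCriticallyFinite (L : SelfSimilarStructure K N) : Prop := L.postCritical.Finite

/-- `V₀ = π(𝒫)`. -/
def V₀ (L : SelfSimilarStructure K N) : Set K := L.π '' L.postCritical

/-- `ψ_w = ψ_{w_1} ∘ ⋯ ∘ ψ_{w_m}` for a word `w` of length `m`. -/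
def ψWord (L : SelfSimilarStructure K N) : (m : ℕ) → (Fin m → Fin N) → K → K
  | 0, _ => id
  | m + 1, w => L.ψ (w 0) ∘ L.ψWord m (Fin.tail w)

/-- Each point of `V₀` is a fixed point of some `ψ_i` and its complement in `K` is connected. -/
def FixedPointConnected (L : SelfSimilarStructure K N) : Prop :=
  ∀ q ∈ L.V₀, (∃ i, L.ψ i q = q) ∧ IsConnected ({q}ᶜ : Set K)

/-- `(D u)(q) = ∑_{q'} D_{qq'} u(q')` on `l(V₀)` (`V₀` is finite in the p.c.f. case). -/
noncomputable def apply (L : SelfSimilarStructure K N) (D : Matrix L.V₀ L.V₀ ℝ)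
    (u : L.V₀ → ℝ) (q : L.V₀) : ℝ := ∑ᶠ q', D q q' * u q'

/-- `𝓔⁽⁰⁾(u, v) = (-D u, v)` on `l(V₀)`. -/
noncomputable def energy₀ (L : SelfSimilarStructure K N) (D : Matrix L.V₀ L.V₀ ℝ)
    (u v : L.V₀ → ℝ) : ℝ := ∑ᶠ q, (-L.apply D u q) * v q

/-- `𝓔⁽ᵐ⁾(u, v) = ∑_{w ∈ W_m} r_w⁻¹ 𝓔⁽⁰⁾(u ∘ ψ_w|_{V₀}, v ∘ ψ_w|_{V₀})`. It is written for functions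
on `K` and depends only on their restrictions to `V_m = ⋃_{w ∈ W_m} ψ_w(V₀)`. -/
noncomputable def energy (L : SelfSimilarStructure K N) (D : Matrix L.V₀ L.V₀ ℝ) (r : Fin N → ℝ)
    (m : ℕ) (u v : K → ℝ) : ℝ :=
  ∑ w : Fin m → Fin N, (∏ k, r (w k))⁻¹ *
    L.energy₀ D (fun q => u (L.ψWord m w q)) (fun q => v (L.ψWord m w q))

/-- `(D, r)` is a harmonic structure. -/
structure IsHarmonicStructure (L : SelfSimilarStructure K N) (D : Matrix L.V₀ L.V₀ ℝ)
    (r : Fin N → ℝ) : Prop where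
  symm : D.IsSymm
  /-- `D` is nonpositive definite -/
  nonpos : ∀ u : L.V₀ → ℝ, 0 ≤ L.energy₀ D u u
  ker : ∀ u : L.V₀ → ℝ, (∀ q, L.apply D u q = 0) ↔ ∃ a : ℝ, ∀ q, u q = a
  off_diag : ∀ q q' : L.V₀, q ≠ q' → 0 ≤ D q q'
  r_pos : ∀ i, 0 < r i
  /-- `𝓔⁽⁰⁾(v, v) = inf {𝓔⁽¹⁾(u, u) | u = v on V₀}` -/
  isGLB : ∀ v : L.V₀ → ℝ,
    IsGLB {t : ℝ | ∃ u : K → ℝ, (∀ q : L.V₀, u q = v q) ∧ t = L.energy D r 1 u u}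
      (L.energy₀ D v v)

/-- `(D, r)` is a regular harmonic structure. -/
structure IsRegularHarmonicStructure (L : SelfSimilarStructure K N) (D : Matrix L.V₀ L.V₀ ℝ)
    (r : Fin N → ℝ) : Prop extends L.IsHarmonicStructure D r where
  r_lt_one : ∀ i, r i < 1

/-- A continuous function in the class `f`, if there is one; it is unique when `μ` has full
support. -/
noncomputable def contRep [MeasurableSpace K] [BorelSpace K] [SecondCountableTopology K]
    (μ : Measure K) (f : K →ₘ[μ] ℝ) : C(K, ℝ) :=
  Function.invFun (fun u : C(K, ℝ) => u.toAEEqFun μ) f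

/-- The Dirichlet form on `L²(K, μ)` associated with `(D, r)`: the domain consists of the classes
of the `u ∈ C(K)` with `lim_m 𝓔⁽ᵐ⁾(u, u) < ∞`, and `𝓔(u, v) = lim_m 𝓔⁽ᵐ⁾(u, v)`. -/
noncomputable def dirichletForm (L : SelfSimilarStructure K N) [MeasurableSpace K] [BorelSpace K]
    [SecondCountableTopology K] (μ : Measure K) (D : Matrix L.V₀ L.V₀ ℝ) (r : Fin N → ℝ) :
    FormData K μ where
  domain := {f | ∃ u : C(K, ℝ), u.toAEEqFun μ = f ∧
    ∃ a : ℝ, Tendsto (fun m => L.energy D r m u u) atTop (𝓝 a)}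
  form f g := limUnder atTop fun m => L.energy D r m
    (contRep μ f) (contRep μ g)

end SelfSimilarStructure

/-! ### Hata's tree-like set -/

/-- `c ∈ ℂ \ ℝ`, `0 < |c| < 1` and `0 < |1 - c| < 1`. -/
structure IsHataParameter (c : ℂ) : Prop where
  not_real : c.im ≠ 0
  norm_pos : 0 < ‖c‖
  norm_lt : ‖c‖ < 1
  norm_sub_pos : 0 < ‖1 - c‖
  norm_sub_lt : ‖1 - c‖ < 1

/-- `ψ_1(z) = c z̄` and `ψ_2(z) = (1 - |c|²) z̄ + |c|²`. -/
noncomputable def hataMap (c : ℂ) : Fin 2 → ℂ → ℂ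
  | 0, z => c * conj z
  | 1, z => (1 - (‖c‖ : ℂ) ^ 2) * conj z + (‖c‖ : ℂ) ^ 2

/-- A common contraction ratio of the two maps. -/
noncomputable def hataRatio (c : ℂ) : ℝ := max ‖c‖ (1 - ‖c‖ ^ 2)

theorem hataRatio_nonneg (c : ℂ) : 0 ≤ hataRatio c := le_max_of_le_left (norm_nonneg c)

theorem IsHataParameter.ratio_lt_one {c : ℂ} (hc : IsHataParameter c) : hataRatio c < 1 := by
  have h := hc.norm_pos
  exact max_lt hc.norm_lt (by nlinarith)

theorem IsHataParameter.one_sub_norm {c : ℂ} (hc : IsHataParameter c) :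
    ‖(1 - (‖c‖ : ℂ) ^ 2)‖ = 1 - ‖c‖ ^ 2 := by
  have h := hc.norm_lt
  have h' := hc.norm_pos
  have e : (1 - (‖c‖ : ℂ) ^ 2) = ((1 - ‖c‖ ^ 2 : ℝ) : ℂ) := by push_cast; rfl
  rw [e, Complex.norm_real, Real.norm_eq_abs, abs_of_nonneg (by nlinarith)]

theorem IsHataParameter.dist_hataMap {c : ℂ} (hc : IsHataParameter c) (i : Fin 2) (z w : ℂ) :
    dist (hataMap c i z) (hataMap c i w) ≤ hataRatio c * dist z w := by
  have hconj : ‖conj z - conj w‖ = ‖z - w‖ := by rw [← map_sub]; exact Complex.norm_conj _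
  match i with
  | 0 =>
    simp only [hataMap, dist_eq_norm]
    rw [← mul_sub, norm_mul, hconj]
    exact mul_le_mul_of_nonneg_right (le_max_left _ _) (norm_nonneg _)
  | 1 =>
    simp only [hataMap, dist_eq_norm]
    rw [add_sub_add_right_eq_sub, ← mul_sub, norm_mul, hconj, hc.one_sub_norm]
    exact mul_le_mul_of_nonneg_right (le_max_right _ _) (norm_nonneg _)

theorem IsHataParameter.injective_hataMap {c : ℂ} (hc : IsHataParameter c) (i : Fin 2) :
    Function.Injective (hataMap c i) := by
  have h := hc.norm_lt
  have h' := hc.norm_pos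
  intro z w hzw
  match i with
  | 0 =>
    exact star_injective (mul_left_cancel₀ (norm_pos_iff.1 h') hzw)
  | 1 =>
    have h0 : (1 - (‖c‖ : ℂ) ^ 2) ≠ 0 := by
      rw [← norm_pos_iff, hc.one_sub_norm]; nlinarith
    exact star_injective (mul_left_cancel₀ h0 (add_right_cancel hzw))

theorem continuous_hataMap (c : ℂ) (i : Fin 2) : Continuous (hataMap c i) := by
  match i with
  | 0 => exact continuous_const.mul Complex.continuous_conj
  | 1 => exact (continuous_const.mul Complex.continuous_conj).add continuous_const

/-- The operator `(T f)(ω) = ψ_{ω_1}(f(σ ω))` on `C(Σ, ℂ)`. -/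
noncomputable def hataOperator (c : ℂ) (f : C(ℕ → Fin 2, ℂ)) : C(ℕ → Fin 2, ℂ) where
  toFun ω := hataMap c (ω 0) (f fun n => ω (n + 1))
  continuous_toFun := by
    have h : Continuous fun p : Fin 2 × ℂ => hataMap c p.1 p.2 :=
      continuous_prod_of_discrete_left.2 fun i => continuous_hataMap c i
    exact h.comp (f := fun ω : ℕ → Fin 2 => (ω 0, f fun n => ω (n + 1))) (by fun_prop)

theorem IsHataParameter.contracting {c : ℂ} (hc : IsHataParameter c) :
    ContractingWith ⟨hataRatio c, hataRatio_nonneg c⟩ (hataOperator c) := by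
  refine ⟨hc.ratio_lt_one, LipschitzWith.of_dist_le_mul fun f g => ?_⟩
  refine (ContinuousMap.dist_le (mul_nonneg (hataRatio_nonneg c) dist_nonneg)).2 fun ω => ?_
  exact (hc.dist_hataMap _ _ _).trans
    (mul_le_mul_of_nonneg_left (ContinuousMap.dist_apply_le_dist _) (hataRatio_nonneg c))

/-- The coding map `π : {1,2}^ℕ → ℂ`, the continuous map with `π(i ω) = ψ_i(π(ω))`. -/
noncomputable def hataCoding {c : ℂ} (hc : IsHataParameter c) : C(ℕ → Fin 2, ℂ) :=
  hc.contracting.fixedPoint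

theorem hataCoding_eq {c : ℂ} (hc : IsHataParameter c) (ω : ℕ → Fin 2) :
    hataCoding hc ω = hataMap c (ω 0) (hataCoding hc fun n => ω (n + 1)) :=
  (DFunLike.congr_fun hc.contracting.fixedPoint_isFixedPt ω).symm

/-- Hata's tree-like set. It is characterized below as the unique nonempty compact `K ⊆ ℂ` with
`K = ψ_1(K) ∪ ψ_2(K)`. -/
def hataSet {c : ℂ} (hc : IsHataParameter c) : Set ℂ := Set.range (hataCoding hc)

theorem hataMap_hataCoding {c : ℂ} (hc : IsHataParameter c) (i : Fin 2) (ω : ℕ → Fin 2) :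
    hataMap c i (hataCoding hc ω) = hataCoding hc (prependLetter i ω) :=
  (hataCoding_eq hc (prependLetter i ω)).symm

theorem hataMap_mem {c : ℂ} (hc : IsHataParameter c) (i : Fin 2) {z : ℂ} (hz : z ∈ hataSet hc) :
    hataMap c i z ∈ hataSet hc := by
  obtain ⟨ω, rfl⟩ := hz
  exact ⟨_, (hataMap_hataCoding hc i ω).symm⟩

theorem hataSet_eq {c : ℂ} (hc : IsHataParameter c) :
    hataSet hc = hataMap c 0 '' hataSet hc ∪ hataMap c 1 '' hataSet hc := by
  apply Set.Subset.antisymm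
  · rintro _ ⟨ω, rfl⟩
    rw [hataCoding_eq]
    have h : ∀ i : Fin 2, i = 0 ∨ i = 1 := by decide
    rcases h (ω 0) with h | h <;> rw [h]
    · exact Or.inl ⟨_, ⟨_, rfl⟩, rfl⟩
    · exact Or.inr ⟨_, ⟨_, rfl⟩, rfl⟩
  · rintro _ (⟨z, hz, rfl⟩ | ⟨z, hz, rfl⟩) <;> exact hataMap_mem hc _ hz

theorem isCompact_hataSet {c : ℂ} (hc : IsHataParameter c) : IsCompact (hataSet hc) :=
  isCompact_range (hataCoding hc).continuous

theorem hata_subset {c : ℂ} (hc : IsHataParameter c) {A B : Set ℂ} (hA : IsCompact A)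
    (hA0 : A.Nonempty) (hAs : A ⊆ hataMap c 0 '' A ∪ hataMap c 1 '' A) (hB : IsCompact B)
    (hB0 : B.Nonempty) (hBs : ∀ i, ∀ z ∈ B, hataMap c i z ∈ B) : A ⊆ B := by
  obtain ⟨x, hx, hmax⟩ := hA.exists_isMaxOn hA0 (Metric.continuous_infDist_pt B).continuousOn
  have key : ∀ i : Fin 2, ∀ y ∈ A, Metric.infDist (hataMap c i y) B ≤
      hataRatio c * Metric.infDist x B := by
    intro i y hy
    obtain ⟨b, hb, hyb⟩ := hB.exists_infDist_eq_dist hB0 y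
    calc Metric.infDist (hataMap c i y) B ≤ dist (hataMap c i y) (hataMap c i b) :=
          Metric.infDist_le_dist_of_mem (hBs i b hb)
      _ ≤ hataRatio c * dist y b := hc.dist_hataMap i y b
      _ = hataRatio c * Metric.infDist y B := by rw [hyb]
      _ ≤ _ := mul_le_mul_of_nonneg_left (hmax hy) (hataRatio_nonneg c)
  have hx' : Metric.infDist x B ≤ hataRatio c * Metric.infDist x B := by
    rcases hAs hx with ⟨y, hy, hyx⟩ | ⟨y, hy, hyx⟩
    · have h := key 0 y hy
      rwa [hyx] at h
    · have h := key 1 y hy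
      rwa [hyx] at h
  have h0 : 0 ≤ Metric.infDist x B := Metric.infDist_nonneg
  have hr := hc.ratio_lt_one
  have hzero : Metric.infDist x B ≤ 0 := by nlinarith
  intro y hy
  refine (hB.isClosed.mem_iff_infDist_zero hB0).2 (le_antisymm ?_ Metric.infDist_nonneg)
  exact (hmax hy).trans hzero

/-- Hata's tree-like set is the unique nonempty compact set `K` with `K = ψ_1(K) ∪ ψ_2(K)`. -/
theorem eq_hataSet_iff {c : ℂ} (hc : IsHataParameter c) (K : Set ℂ) :
    (K.Nonempty ∧ IsCompact K ∧ K = hataMap c 0 '' K ∪ hataMap c 1 '' K) ↔ K = hataSet hc := by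
  have hne : (hataSet hc).Nonempty := Set.range_nonempty _
  constructor
  · rintro ⟨h0, hK, he⟩
    apply Set.Subset.antisymm
    · exact hata_subset hc hK h0 he.subset (isCompact_hataSet hc) hne
        fun i z hz => hataMap_mem hc i hz
    · refine hata_subset hc (isCompact_hataSet hc) hne (hataSet_eq hc).subset hK h0 ?_
      intro i z hz
      match i with
      | 0 => rw [he]; exact Or.inl ⟨z, hz, rfl⟩
      | 1 => rw [he]; exact Or.inr ⟨z, hz, rfl⟩
  · rintro rfl
    exact ⟨hne, isCompact_hataSet hc, hataSet_eq hc⟩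

/-- The self-similar structure of Hata's tree-like set. -/
noncomputable def hataStructure {c : ℂ} (hc : IsHataParameter c) :
    SelfSimilarStructure (hataSet hc) 2 where
  one_lt := one_lt_two
  ψ i z := ⟨hataMap c i z, hataMap_mem hc i z.2⟩
  continuous_ψ i := ((continuous_hataMap c i).comp continuous_subtype_val).subtype_mk _
  injective_ψ i z w h :=
    Subtype.ext (hc.injective_hataMap i (congrArg Subtype.val h))
  π ω := ⟨hataCoding hc ω, ω, rfl⟩
  continuous_π := (hataCoding hc).continuous.subtype_mk _
  surjective_π := by
    rintro ⟨_, ω, rfl⟩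
    exact ⟨ω, rfl⟩
  ψ_π i ω := Subtype.ext (hataMap_hataCoding hc i ω)

/-! The set is a tree made of two copies of itself glued at one point, and on a tree the energy of a
function is the integral of the square of one scalar derivative with respect to length. Energy
measures are therefore squares of gradients times a fixed measure, every matrix of mutual densities
is a scalar times an outer product, and the index cannot exceed one.

Geometry enters only through the fact that the two pieces meet in the single point `ψ_1(c) = ψ_2(0)`
(`eq_of_hataMap_eq`), proved for all parameters by an explicit invariant region and a functional
vanishing there only at the right place. After that only the relations in `IsHataTree` between the
maps and the three boundary points are used; `o`, `e`, `q` stand for `0`, `1`, `c`, and the letters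
are `0` and `1`.

A star-triangle reduction (`conductances_of_isGLB`) shows that a regular harmonic structure has no
conductance between `e` and `q`, that the resistances of the edges `oe` and `oq` are in the ratio `1
: r 0`, and that `r 1 = 1 - r 0 ^ 2`. So the boundary network is a tree of two edges. Read
resistances as lengths: the arc `oe` is the union of its images under `ψ_0 ∘ ψ_0` and `ψ_1`, of
lengths `r 0 ^ 2` and `r 1` with sum `1`; the arc `oq` is the image of `oe` under `ψ_0`; and each
subdivision only attaches new branches. The union of all edges, the skeleton, carries a self-similar
length measure, constructed on codes as `Λ` (`exists_skeletonMeasure`).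

The difference quotients of `u` along the edges of level `m` form a function `grad m u` in `L²(Λ)`
whose squared norm is the energy of level `m`. By telescoping, each is the orthogonal projection of
the finer ones (`integral_grad_mul_grad`). Hence energies increase, and bounded energy means
convergence in `L²` to a gradient (`HasGrad`); up to a constant the form is the inner product of
gradients. Continuous functions satisfy the product rule (`HasGrad.mul`), which identifies the
energy measure as the image under `π` of a multiple of the squared gradient times `Λ`.

Closedness follows from the bound of oscillation by energy (`exists_resistance_bound`), density from
piecewise harmonic interpolation (`exists_finiteEnergy_approx`). Since `π` is injective off a
`Λ`-null set (`exists_section`), gradients descend to `K`. The image of `Λ` is minimal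
energy-dominant because gradients detect every set of positive length (`exists_hasGrad_ne_zero`),
and since it is nonzero the rank one is attained. -/

/-! ### The two pieces of Hata's tree-like set meet in one point -/

/-- In the coordinates `z = s + t c` the Hata maps are `(s, t) ↦ (a t, s)` and
`(s, t) ↦ ((1 - a) (s + k t) + a, -(1 - a) t)`, with `a = |c|²` and `k = 2 Re c`. This is a compact
invariant region for them, with a function `Φ` that locates the intersection of the images. -/
structure HataRegion (a k : ℝ) where
  R : Set (ℝ × ℝ)
  Φ : ℝ → ℝ → ℝ
  compact : IsCompact R
  zero_mem : ((0, 0) : ℝ × ℝ) ∈ R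
  map_zero : ∀ s t, (s, t) ∈ R → (a * t, s) ∈ R
  map_one : ∀ s t, (s, t) ∈ R → ((1 - a) * (s + k * t) + a, -(1 - a) * t) ∈ R
  Φ_smul : ∀ s t, Φ (a * s) (a * t) = a * Φ s t
  Φ_pos_one : ∀ s t, (s, t) ∈ R → 0 < Φ ((1 - a) * (s + k * t) + a) (-(1 - a) * t)
  Φ_pos_zero_one : ∀ s t, (s, t) ∈ R → 0 < Φ (a * (-(1 - a) * t)) ((1 - a) * (s + k * t) + a)
  Φ_inter : ∀ s t s' t', (s, t) ∈ R → (s', t') ∈ R → a * t = (1 - a) * (s' + k * t') + a →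
    s = -(1 - a) * t' → Φ s' t' = 0

theorem max_mul_self_of_nonneg {k t : ℝ} (hk : k ≤ 1) (ht : 0 ≤ t) : max (k * t) t = t :=
  max_eq_right (by nlinarith)

theorem max_mul_self_of_nonpos {k t : ℝ} (hk : k ≤ 1) (ht : t ≤ 0) : max (k * t) t = k * t :=
  max_eq_left (by nlinarith)

/-- The invariant region for `2 Re c ≤ 1`. -/
def hataRegionOfLE {a k : ℝ} (ha : 0 < a) (ha1 : a < 1) (hak : a < k) (hk : k ≤ 1) :
    HataRegion a k where
  R := {p | p.2 ≤ 1 ∧ -(1 - a) ≤ p.2 ∧ p.1 ≤ 1 ∧ -(a * (1 - a)) ≤ p.1 ∧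
    0 ≤ p.1 + max (k * p.2) p.2 ∧ 0 ≤ a * p.2 + max (k * p.1) p.1 ∧
    0 ≤ (1 - k) * p.1 + a * (1 - p.2) ∧ p.1 - (1 - k) * p.2 ≤ 1 ∧ p.1 + p.2 ≤ 1}
  Φ s t := s + max (k * t) t
  compact := by
    refine IsCompact.of_isClosed_subset (isCompact_Icc (a := ((-1, -1) : ℝ × ℝ)) (b := (1, 1))) ?_ ?_
    · simp only [Set.ofPred_and]
      repeat' apply IsClosed.inter
      all_goals exact isClosed_le (by fun_prop) (by fun_prop)
    · rintro ⟨s, t⟩ ⟨h1, h2, h3, h4, -⟩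
      simp only at h1 h2 h3 h4
      exact ⟨⟨by nlinarith, by simp only; linarith⟩, ⟨h3, h1⟩⟩
  zero_mem := by
    simp only [Set.mem_ofPred_eq, mul_zero, max_self]
    refine ⟨?_, ?_, ?_, ?_, ?_, ?_, ?_, ?_, ?_⟩ <;> nlinarith
  map_zero s t := by
    simp only [Set.mem_ofPred_eq]
    rintro ⟨h1, h2, h3, h4, h5, h6, h7, h8, h9⟩
    have e : k * (a * t) = a * (k * t) := by ring
    refine ⟨h3, by nlinarith, by nlinarith, by nlinarith, h6, ?_, ?_, ?_, ?_⟩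
    · rw [e, ← mul_max_of_nonneg _ _ ha.le, ← mul_add]
      exact mul_nonneg ha.le h5
    · rcases le_total 0 t with ht | ht
      · have := mul_nonneg (mul_nonneg (sub_nonneg.2 hk) ha.le) ht
        nlinarith
      · nlinarith
    · have : 0 ≤ (1 - k) * (s + a * (1 - a)) := mul_nonneg (sub_nonneg.2 hk) (by linarith)
      have : 0 ≤ k * (a * (1 - a)) := by
        have := mul_pos ha (sub_pos.2 ha1)
        nlinarith
      nlinarith
    · rcases le_total 0 t with ht | ht <;> nlinarith
  map_one s t := by
    simp only [Set.mem_ofPred_eq]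
    rintro ⟨h1, h2, h3, h4, h5, h6, h7, h8, h9⟩
    have hb : 0 < 1 - a := sub_pos.2 ha1
    have hab : 0 < a * (1 - a) := mul_pos ha hb
    have hu1 : s + k * t ≤ 1 := by rcases le_total 0 t with ht | ht <;> nlinarith
    have hu : -(a * (1 - a)) ≤ s + k * t ∧ (t ≤ 0 → 0 ≤ s + k * t) := by
      rcases le_total 0 t with ht | ht
      · refine ⟨by nlinarith, fun h => ?_⟩
        have : t = 0 := le_antisymm h ht
        subst this
        simpa using h5
      · rw [max_mul_self_of_nonpos hk ht] at h5
        exact ⟨by linarith, fun _ => h5⟩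
    have hS : 0 < (1 - a) * (s + k * t) + a := by nlinarith [hu.1]
    refine ⟨by nlinarith, by nlinarith, by nlinarith, by nlinarith, ?_, ?_, ?_, ?_, ?_⟩
    · rcases le_total 0 t with ht | ht
      · rw [max_mul_self_of_nonpos hk (by nlinarith)]
        nlinarith
      · rw [max_mul_self_of_nonneg hk (by nlinarith)]
        nlinarith [hu.2 ht]
    · rw [max_mul_self_of_nonneg hk hS.le]
      rcases le_total 0 t with ht | ht
      · have h1' : s + t ≥ 0 := by rwa [max_mul_self_of_nonneg hk ht] at h5
        have : 0 ≤ (k - a) * t := mul_nonneg (by linarith) ht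
        nlinarith
      · nlinarith [hu.2 ht, mul_nonneg hab.le (neg_nonneg.2 ht)]
    · have := mul_nonneg (sub_nonneg.2 hk) hS.le
      nlinarith [mul_nonneg hb.le (show 0 ≤ t + (1 - a) by linarith)]
    · nlinarith
    · nlinarith
  Φ_smul s t := by
    rw [show k * (a * t) = a * (k * t) by ring, ← mul_max_of_nonneg _ _ ha.le, ← mul_add]
  Φ_pos_one s t := by
    simp only [Set.mem_ofPred_eq]
    rintro ⟨h1, h2, h3, h4, h5, h6, h7, h8, h9⟩
    have hb : 0 < 1 - a := sub_pos.2 ha1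
    have hab : 0 < a * (1 - a) := mul_pos ha hb
    rcases le_total 0 t with ht | ht
    · rw [max_mul_self_of_nonpos hk (by nlinarith)]
      nlinarith
    · rw [max_mul_self_of_nonneg hk (by nlinarith)]
      rw [max_mul_self_of_nonpos hk ht] at h5
      nlinarith
  Φ_pos_zero_one s t := by
    simp only [Set.mem_ofPred_eq]
    rintro ⟨h1, h2, h3, h4, h5, h6, h7, h8, h9⟩
    have hb : 0 < 1 - a := sub_pos.2 ha1
    have hab : 0 < a * (1 - a) := mul_pos ha hb
    have hS : 0 < (1 - a) * (s + k * t) + a := by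
      rcases le_total 0 t with ht | ht
      · have := mul_nonneg (ha.trans hak).le ht
        nlinarith
      · rw [max_mul_self_of_nonpos hk ht] at h5
        nlinarith
    rw [max_mul_self_of_nonneg hk hS.le]
    rcases le_total 0 t with ht | ht
    · have : 0 ≤ (k - a) * t := mul_nonneg (by linarith) ht
      nlinarith
    · rw [max_mul_self_of_nonpos hk ht] at h5
      nlinarith [mul_nonneg hab.le (neg_nonneg.2 ht)]
  Φ_inter s t s' t' := by
    simp only [Set.mem_ofPred_eq]
    rintro ⟨h1, h2, h3, h4, h5, h6, h7, h8, h9⟩ ⟨k1, k2, k3, k4, k5, k6, k7, k8, k9⟩ e1 e2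
    have hb : 0 < 1 - a := sub_pos.2 ha1
    -- The bounds `t ≤ 1` and `0 ≤ (1 - k) * s + a * (1 - t)` on the point of the first piece become
    -- upper bounds for the two branches of the maximum in `Φ s' t'`; that `Φ` is nonnegative is one
    -- of the inequalities defining the region.
    have hu : s' + k * t' ≤ 0 := by
      have : (1 - a) * (s' + k * t') ≤ 0 := by nlinarith
      exact nonpos_of_mul_nonpos_right this hb
    have hst : s' + t' ≤ 0 := by
      have : (1 - a) * (s' + t') ≤ 0 := by
        rw [e2] at h7
        nlinarith
      exact nonpos_of_mul_nonpos_right this hb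
    refine le_antisymm ?_ k5
    rcases max_choice (k * t') t' with h | h <;> rw [h] <;> assumption

/-- The invariant region for `1 ≤ 2 Re c`. -/
def hataRegionOfGE {a k : ℝ} (ha : 0 < a) (ha1 : a < 1) (hk : 1 ≤ k) (hka : k < 1 + a) :
    HataRegion a k where
  R := {p | p.1 + (k - 1) * p.2 ≤ 1 ∧ p.1 + p.2 ≤ 1 ∧ a * p.2 + (k - 1) * p.1 ≤ a ∧
    -a ≤ p.1 ∧ -1 ≤ p.2 ∧ 0 ≤ p.1 + p.2 ∧ 0 ≤ p.1 + a * p.2}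
  Φ s t := s + t
  compact := by
    refine IsCompact.of_isClosed_subset (isCompact_Icc (a := ((-2, -2) : ℝ × ℝ)) (b := (2, 2))) ?_ ?_
    · simp only [Set.ofPred_and]
      repeat' apply IsClosed.inter
      all_goals exact isClosed_le (by fun_prop) (by fun_prop)
    · rintro ⟨s, t⟩ ⟨h1, h2, h3, h4, h5, -⟩
      simp only at h1 h2 h3 h4 h5
      exact ⟨⟨by simp only; linarith, by simp only; linarith⟩,
        ⟨by simp only; linarith, by simp only; linarith⟩⟩
  zero_mem := by
    simp only [Set.mem_ofPred_eq]
    refine ⟨?_, ?_, ?_, ?_, ?_, ?_, ?_⟩ <;> nlinarith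
  map_zero s t := by
    simp only [Set.mem_ofPred_eq]
    rintro ⟨h1, h2, h3, h4, h5, h6, h7⟩
    refine ⟨by linarith, ?_, by nlinarith, by nlinarith, by linarith, by linarith, by nlinarith⟩
    rcases le_total 0 t with ht | ht <;> nlinarith
  map_one s t := by
    simp only [Set.mem_ofPred_eq]
    rintro ⟨h1, h2, h3, h4, h5, h6, h7⟩
    have hb : 0 < 1 - a := sub_pos.2 ha1
    have hab : 0 < a * (1 - a) := mul_pos ha hb
    have ht1 : t ≤ 1 + a := by linarith
    have hkb : 0 ≤ (1 + a - k) * (1 - a) := mul_nonneg (by linarith) hb.le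
    refine ⟨by nlinarith, by nlinarith, ?_, ?_, by nlinarith, ?_, ?_⟩
    · nlinarith [mul_nonneg hkb (show 0 ≤ t + 1 by linarith),
        mul_nonneg (mul_nonneg (sub_nonneg.2 hk) hb.le) (sub_nonneg.2 h1),
        mul_nonneg (show 0 ≤ 1 + a - k by linarith) ha.le]
    · rcases le_total 0 t with ht | ht
      · nlinarith [mul_nonneg (by linarith : 0 ≤ k) ht]
      · have : -a ≤ s + k * t := by nlinarith
        nlinarith
    · rcases le_total 0 t with ht | ht
      · nlinarith [mul_nonneg (sub_nonneg.2 hk) ht]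
      · have : 0 ≤ s + (k - 1) * t := by nlinarith
        nlinarith
    · rcases le_total 0 t with ht | ht
      · have := mul_nonneg (show 0 ≤ k - a by linarith) ht
        nlinarith
      · have : 0 ≤ s + (k - a) * t := by nlinarith
        nlinarith
  Φ_smul s t := by ring
  Φ_pos_one s t := by
    simp only [Set.mem_ofPred_eq]
    rintro ⟨h1, h2, h3, h4, h5, h6, h7⟩
    have hb : 0 < 1 - a := sub_pos.2 ha1
    rcases le_total 0 t with ht | ht
    · nlinarith [mul_nonneg (sub_nonneg.2 hk) ht, mul_pos ha hb]
    · have : 0 ≤ s + (k - 1) * t := by nlinarith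
      nlinarith
  Φ_pos_zero_one s t := by
    simp only [Set.mem_ofPred_eq]
    rintro ⟨h1, h2, h3, h4, h5, h6, h7⟩
    have hb : 0 < 1 - a := sub_pos.2 ha1
    rcases le_total 0 t with ht | ht
    · have := mul_nonneg (show 0 ≤ k - a by linarith) ht
      nlinarith
    · have : 0 ≤ s + (k - a) * t := by nlinarith
      nlinarith
  Φ_inter s t s' t' := by
    simp only [Set.mem_ofPred_eq]
    rintro ⟨h1, h2, h3, h4, h5, h6, h7⟩ ⟨k1, k2, k3, k4, k5, k6, k7⟩ e1 e2
    have hb : 0 < 1 - a := sub_pos.2 ha1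
    -- The inequality `a * t + (k - 1) * s ≤ a` at the point of the first piece, rewritten in `s'`
    -- and `t'`.
    have : (1 - a) * (s' + t') ≤ 0 := by
      rw [e2] at h3
      nlinarith
    exact le_antisymm (nonpos_of_mul_nonpos_right this hb) k6

/-! ### Coordinates on Hata's set and its branching point -/

namespace IsHataParameter

variable {c : ℂ}

theorem norm_sq_pos (hc : IsHataParameter c) : 0 < ‖c‖ ^ 2 := pow_pos hc.norm_pos 2

theorem norm_sq_lt_one (hc : IsHataParameter c) : ‖c‖ ^ 2 < 1 :=
  pow_lt_one₀ hc.norm_pos.le hc.norm_lt two_ne_zero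

/-- Turns the two bounds on `‖1 - c‖` into `a < k < 1 + a` with `a = ‖c‖ ^ 2` and `k = 2 * c.re`,
which is what the invariant regions need. -/
theorem norm_one_sub_sq (c : ℂ) : ‖1 - c‖ ^ 2 = 1 - 2 * c.re + ‖c‖ ^ 2 := by
  rw [Complex.sq_norm, Complex.sq_norm, Complex.normSq_apply, Complex.normSq_apply]
  simp
  ring

theorem norm_sq_lt (hc : IsHataParameter c) : ‖c‖ ^ 2 < 2 * c.re := by
  have h := norm_one_sub_sq c
  have : ‖1 - c‖ ^ 2 < 1 := pow_lt_one₀ hc.norm_sub_pos.le hc.norm_sub_lt two_ne_zero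
  linarith

theorem two_re_lt (hc : IsHataParameter c) : 2 * c.re < 1 + ‖c‖ ^ 2 := by
  have h := norm_one_sub_sq c
  have : 0 < ‖1 - c‖ ^ 2 := pow_pos hc.norm_sub_pos 2
  linarith

theorem exists_region (hc : IsHataParameter c) : Nonempty (HataRegion (‖c‖ ^ 2) (2 * c.re)) := by
  rcases le_total (2 * c.re) 1 with h | h
  · exact ⟨hataRegionOfLE hc.norm_sq_pos hc.norm_sq_lt_one hc.norm_sq_lt h⟩
  · exact ⟨hataRegionOfGE hc.norm_sq_pos hc.norm_sq_lt_one h hc.two_re_lt⟩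

theorem normSq_eq (c : ℂ) : ‖c‖ ^ 2 = c.re * c.re + c.im * c.im := by
  rw [Complex.sq_norm, Complex.normSq_apply]

theorem hataMap_zero_coord (c : ℂ) (s t : ℝ) :
    hataMap c 0 (s + t * c) = ((‖c‖ ^ 2 * t : ℝ) : ℂ) + (s : ℝ) * c := by
  rw [normSq_eq]
  apply Complex.ext <;> simp [hataMap] <;> ring

/-- Expand with `conj c = 2 * c.re - c`. -/
theorem hataMap_one_coord (c : ℂ) (s t : ℝ) :
    hataMap c 1 (s + t * c) = (((1 - ‖c‖ ^ 2) * (s + 2 * c.re * t) + ‖c‖ ^ 2 : ℝ) : ℂ) +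
      (-(1 - ‖c‖ ^ 2) * t : ℝ) * c := by
  have e : (1 - (‖c‖ : ℂ) ^ 2) = ((1 - ‖c‖ ^ 2 : ℝ) : ℂ) := by push_cast; rfl
  have e' : (‖c‖ : ℂ) ^ 2 = ((‖c‖ ^ 2 : ℝ) : ℂ) := by push_cast; rfl
  rw [hataMap, e, e']
  apply Complex.ext <;> simp [-Complex.ofReal_pow] <;> ring

theorem coord_inj (hc : IsHataParameter c) {s t s' t' : ℝ}
    (h : (s : ℂ) + t * c = s' + t' * c) : s = s' ∧ t = t' := by
  have h1 := congrArg Complex.im h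
  have h2 := congrArg Complex.re h
  simp at h1 h2
  have ht : t = t' := h1.resolve_right hc.not_real
  subst ht
  exact ⟨by linarith, rfl⟩

/-- A nonempty compact set mapped into itself by both maps contains the attractor. -/
theorem exists_coord (hc : IsHataParameter c) (H : HataRegion (‖c‖ ^ 2) (2 * c.re)) {z : ℂ}
    (hz : z ∈ hataSet hc) : ∃ s t : ℝ, (s, t) ∈ H.R ∧ z = s + t * c := by
  have key : hataSet hc ⊆ (fun p : ℝ × ℝ => (p.1 : ℂ) + p.2 * c) '' H.R := by
    refine hata_subset hc (isCompact_hataSet hc) (Set.range_nonempty _) (hataSet_eq hc).subset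
      (H.compact.image (by fun_prop)) ⟨_, ⟨_, H.zero_mem, rfl⟩⟩ ?_
    rintro i _ ⟨⟨s, t⟩, hp, rfl⟩
    match i with
    | 0 => exact ⟨_, H.map_zero s t hp, (hataMap_zero_coord c s t).symm⟩
    | 1 => exact ⟨_, H.map_one s t hp, (hataMap_one_coord c s t).symm⟩
  obtain ⟨⟨s, t⟩, hp, rfl⟩ := key hz
  exact ⟨s, t, hp, rfl⟩

/-- `K` is the union of `ψ_1(ψ_1(K))`, `ψ_1(ψ_2(K))` and `ψ_2(K)`, and `Φ` is positive on the last
two. A zero of `Φ` thus lies in the first, where `ψ_1 ∘ ψ_1` is multiplication by `‖c‖ ^ 2`;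
homogeneity of `Φ` passes the zero on to the preimage. -/
theorem exists_coord_of_Φ_eq_zero (hc : IsHataParameter c)
    (H : HataRegion (‖c‖ ^ 2) (2 * c.re)) {s t : ℝ} (hz : (s : ℂ) + t * c ∈ hataSet hc)
    (h0 : H.Φ s t = 0) : ∃ s' t' : ℝ, (s' : ℂ) + t' * c ∈ hataSet hc ∧ H.Φ s' t' = 0 ∧
      s = ‖c‖ ^ 2 * s' ∧ t = ‖c‖ ^ 2 * t' := by
  have hz' := hz
  rw [hataSet_eq] at hz'
  rcases hz' with ⟨w, hw, hwz⟩ | ⟨w, hw, hwz⟩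
  · have hw' := hw
    rw [hataSet_eq] at hw'
    rcases hw' with ⟨v, hv, rfl⟩ | ⟨v, hv, rfl⟩
    · obtain ⟨s', t', hp, rfl⟩ := hc.exists_coord H hv
      rw [hataMap_zero_coord, hataMap_zero_coord] at hwz
      obtain ⟨h1, h2⟩ := hc.coord_inj hwz
      refine ⟨s', t', hv, ?_, h1.symm, h2.symm⟩
      rw [← h1, ← h2, H.Φ_smul] at h0
      exact (mul_eq_zero.1 h0).resolve_left hc.norm_sq_pos.ne'
    · obtain ⟨s', t', hp, rfl⟩ := hc.exists_coord H hv
      rw [hataMap_one_coord, hataMap_zero_coord] at hwz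
      obtain ⟨h1, h2⟩ := hc.coord_inj hwz
      have := H.Φ_pos_zero_one s' t' hp
      rw [h1, h2, h0] at this
      exact absurd this (lt_irrefl _)
  · obtain ⟨s', t', hp, rfl⟩ := hc.exists_coord H hw
    rw [hataMap_one_coord] at hwz
    obtain ⟨h1, h2⟩ := hc.coord_inj hwz
    have := H.Φ_pos_one s' t' hp
    rw [h1, h2, h0] at this
    exact absurd this (lt_irrefl _)

/-- Dividing by `‖c‖ ^ 2` can be repeated forever inside the bounded set `K`, which only `0` allows.
-/
theorem eq_zero_of_Φ_eq_zero (hc : IsHataParameter c)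
    (H : HataRegion (‖c‖ ^ 2) (2 * c.re)) {s t : ℝ} (hz : (s : ℂ) + t * c ∈ hataSet hc)
    (h0 : H.Φ s t = 0) : (s : ℂ) + t * c = 0 := by
  obtain ⟨R, hR⟩ := (isCompact_hataSet hc).isBounded.exists_norm_le
  have key : ∀ n : ℕ, ∀ s t : ℝ, (s : ℂ) + t * c ∈ hataSet hc → H.Φ s t = 0 →
      ‖(s : ℂ) + t * c‖ ≤ (‖c‖ ^ 2) ^ n * R := by
    intro n
    induction n with
    | zero =>
      intro s t hz _
      simpa using hR _ hz
    | succ n ih =>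
      intro s t hz h0
      obtain ⟨s', t', hz', h0', rfl, rfl⟩ := hc.exists_coord_of_Φ_eq_zero H hz h0
      have e : ((‖c‖ ^ 2 * s' : ℝ) : ℂ) + ((‖c‖ ^ 2 * t' : ℝ) : ℂ) * c =
          ((‖c‖ ^ 2 : ℝ) : ℂ) * (s' + t' * c) := by push_cast; ring
      rw [e, norm_mul, Complex.norm_real, Real.norm_of_nonneg hc.norm_sq_pos.le,
        pow_succ' (‖c‖ ^ 2) n, mul_assoc]
      exact mul_le_mul_of_nonneg_left (ih s' t' hz' h0') hc.norm_sq_pos.le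
  have lim : Tendsto (fun n : ℕ => (‖c‖ ^ 2) ^ n * R) atTop (𝓝 0) := by
    simpa using (tendsto_pow_atTop_nhds_zero_of_lt_one hc.norm_sq_pos.le
      hc.norm_sq_lt_one).mul_const R
  exact norm_le_zero_iff.1 (ge_of_tendsto' lim fun n => key n s t hz h0)

theorem hataMap_zero_self (c : ℂ) : hataMap c 0 c = (‖c‖ : ℂ) ^ 2 := by
  rw [hataMap, Complex.mul_conj, Complex.normSq_eq_norm_sq]
  push_cast
  rfl

theorem hataMap_one_zero (c : ℂ) : hataMap c 1 0 = (‖c‖ : ℂ) ^ 2 := by simp [hataMap]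

/-- The pieces `ψ_1(K)` and `ψ_2(K)` meet only in `ψ_1(c) = ψ_2(0)`. -/
theorem eq_of_hataMap_eq (hc : IsHataParameter c) {z w : ℂ} (hz : z ∈ hataSet hc)
    (hw : w ∈ hataSet hc) (h : hataMap c 0 z = hataMap c 1 w) : z = c ∧ w = 0 := by
  obtain ⟨H⟩ := hc.exists_region
  have hw0 : w = 0 := by
    obtain ⟨s, t, hp, rfl⟩ := hc.exists_coord H hz
    obtain ⟨s', t', hp', rfl⟩ := hc.exists_coord H hw
    rw [hataMap_zero_coord, hataMap_one_coord] at h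
    obtain ⟨h1, h2⟩ := hc.coord_inj h
    exact hc.eq_zero_of_Φ_eq_zero H hw (H.Φ_inter s t s' t' hp hp' h1 h2)
  refine ⟨hc.injective_hataMap 0 ?_, hw0⟩
  rw [h, hw0, hataMap_zero_self, hataMap_one_zero]

end IsHataParameter

/-! ### Tree-like self-similar structures -/

namespace SelfSimilarStructure

/-- The combinatorial properties of Hata's tree-like set that determine its harmonic structures:
`o`, `e`, `q` play the roles of `0`, `1`, `c`. -/
structure IsHataTree {K : Type*} [TopologicalSpace K] (L : SelfSimilarStructure K 2)
    (o e q : K) : Prop where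
  oe : o ≠ e
  oq : o ≠ q
  eq : e ≠ q
  zero_o : L.ψ 0 o = o
  zero_e : L.ψ 0 e = q
  zero_q : L.ψ 0 q = L.ψ 1 o
  one_e : L.ψ 1 e = e
  inter : ∀ x y, L.ψ 0 x = L.ψ 1 y → x = q ∧ y = o

/-! ### Codes of the boundary points and the post-critical set -/

namespace IsHataTree

variable {K : Type*} [TopologicalSpace K] {L : SelfSimilarStructure K 2} {o e q : K}

theorem fin_two (i : Fin 2) : i = 0 ∨ i = 1 := by revert i; decide

theorem π_cons (L : SelfSimilarStructure K 2) (ω : ℕ → Fin 2) :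
    L.π ω = L.ψ (ω 0) (L.π fun n => ω (n + 1)) := by
  rw [L.ψ_π]
  congr 1
  funext n
  cases n <;> rfl

theorem prependLetter_shift (ω : ℕ → Fin 2) : prependLetter (ω 0) (fun n => ω (n + 1)) = ω := by
  funext n
  cases n <;> rfl

theorem eq_const_of_shift {P : (ℕ → Fin 2) → Prop} {i : Fin 2}
    (h : ∀ ω, P ω → ω 0 = i ∧ P fun n => ω (n + 1)) {ω : ℕ → Fin 2} (hω : P ω) :
    ω = fun _ => i := by
  have key : ∀ n : ℕ, P fun m => ω (m + n) := by
    intro n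
    induction n with
    | zero => exact hω
    | succ n ih =>
      have := (h _ ih).2
      simpa only [add_assoc, add_comm, add_left_comm] using this
  funext n
  have := (h _ (key n)).1
  simpa using this

variable (T : L.IsHataTree o e q)
include T

/-- A code starting with `1` would place `o = ψ_0(o)` in both pieces and force `o = q`; otherwise
injectivity of `ψ_0` strips a letter `0` and the argument repeats. -/
theorem π_eq_o {ω : ℕ → Fin 2} (h : L.π ω = o) : ω = fun _ => 0 := by
  refine eq_const_of_shift (P := fun ω => L.π ω = o) ?_ h
  intro ω h
  rw [π_cons] at h
  rcases fin_two (ω 0) with h0 | h0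
  · rw [h0] at h
    exact ⟨h0, L.injective_ψ 0 (h.trans T.zero_o.symm)⟩
  · rw [h0] at h
    exact absurd (T.inter o _ (T.zero_o.trans h.symm)).1 T.oq

theorem π_eq_e {ω : ℕ → Fin 2} (h : L.π ω = e) : ω = fun _ => 1 := by
  refine eq_const_of_shift (P := fun ω => L.π ω = e) ?_ h
  intro ω h
  rw [π_cons] at h
  rcases fin_two (ω 0) with h0 | h0
  · rw [h0] at h
    exact absurd (T.inter _ e (h.trans T.one_e.symm)).2 T.oe.symm
  · rw [h0] at h
    exact ⟨h0, L.injective_ψ 1 (h.trans T.one_e.symm)⟩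

theorem π_eq_q {ω : ℕ → Fin 2} (h : L.π ω = q) : ω = prependLetter 0 fun _ => 1 := by
  rw [← prependLetter_shift ω]
  rw [π_cons] at h
  rcases fin_two (ω 0) with h0 | h0
  · rw [h0] at h ⊢
    rw [T.π_eq_e (L.injective_ψ 0 (h.trans T.zero_e.symm))]
  · rw [h0] at h
    exact absurd (T.inter e _ (T.zero_e.trans h.symm)).1 T.eq

theorem π_zero : (L.π fun _ => 0) = o := by
  obtain ⟨ω, hω⟩ := L.surjective_π o
  rwa [← T.π_eq_o hω]

theorem π_one : (L.π fun _ => 1) = e := by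
  obtain ⟨ω, hω⟩ := L.surjective_π e
  rwa [← T.π_eq_e hω]

theorem π_zero_one : L.π (prependLetter 0 fun _ => 1) = q := by
  rw [← L.ψ_π, T.π_one, T.zero_e]

theorem mem_overlap {x : K} : x ∈ L.overlap ↔ x = L.ψ 1 o := by
  constructor
  · rintro ⟨i, j, hij, ⟨y, hy⟩, ⟨z, hz⟩⟩
    rcases fin_two i with rfl | rfl <;> rcases fin_two j with rfl | rfl
    · exact absurd rfl hij
    · rw [← hz, (T.inter y z (hy.trans hz.symm)).2]
    · rw [← hy, (T.inter z y (hz.trans hy.symm)).2]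
    · exact absurd rfl hij
  · rintro rfl
    exact ⟨0, 1, by decide, ⟨q, T.zero_q⟩, ⟨o, rfl⟩⟩

theorem π_eq_one_o {ω : ℕ → Fin 2} : L.π ω = L.ψ 1 o ↔
    ω = prependLetter 0 (prependLetter 0 fun _ => 1) ∨ ω = prependLetter 1 fun _ => 0 := by
  constructor
  · intro h
    rw [← prependLetter_shift ω]
    rw [π_cons] at h
    rcases fin_two (ω 0) with h0 | h0
    · rw [h0] at h ⊢
      rw [T.π_eq_q (L.injective_ψ 0 (h.trans T.zero_q.symm))]
      exact Or.inl rfl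
    · rw [h0] at h ⊢
      rw [T.π_eq_o (L.injective_ψ 1 h)]
      exact Or.inr rfl
  · rintro (rfl | rfl)
    · rw [← L.ψ_π, T.π_zero_one, T.zero_q]
    · rw [← L.ψ_π, T.π_zero]

/-- The branching point has exactly the codes `00111…` and `1000…`; their proper shifts are `0111…`,
`111…` and `000…`. -/
theorem postCritical_eq : L.postCritical =
    {prependLetter 0 fun _ => 1, fun _ => 1, fun _ => 0} := by
  ext τ
  simp only [Set.mem_insert_iff, Set.mem_singleton_iff]
  constructor
  · rintro ⟨m, hm, ω, hω, rfl⟩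
    rw [T.mem_overlap, T.π_eq_one_o] at hω
    obtain ⟨m, rfl⟩ := Nat.exists_eq_add_of_le' hm
    rcases hω with rfl | rfl
    · rcases m with _ | m
      · left; funext n; cases n <;> rfl
      · right; left; funext n; rfl
    · right; right; funext n; rfl
  · rintro (rfl | rfl | rfl)
    · exact ⟨1, le_rfl, prependLetter 0 (prependLetter 0 fun _ => 1),
        T.mem_overlap.2 (T.π_eq_one_o.2 (Or.inl rfl)), by funext n; cases n <;> rfl⟩
    · exact ⟨2, by decide, prependLetter 0 (prependLetter 0 fun _ => 1),
        T.mem_overlap.2 (T.π_eq_one_o.2 (Or.inl rfl)), by funext n; rfl⟩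
    · exact ⟨1, le_rfl, prependLetter 1 fun _ => 0,
        T.mem_overlap.2 (T.π_eq_one_o.2 (Or.inr rfl)), by funext n; rfl⟩

theorem isPostCriticallyFinite : L.IsPostCriticallyFinite := by
  rw [IsPostCriticallyFinite, T.postCritical_eq]
  exact Set.toFinite _

theorem V₀_eq : L.V₀ = {q, e, o} := by
  rw [V₀, T.postCritical_eq]
  simp [Set.image_insert_eq, T.π_zero, T.π_one, T.π_zero_one]

end IsHataTree

end SelfSimilarStructure

/-! ### Hata's set has the tree relations -/

theorem zero_mem_hataSet {c : ℂ} (hc : IsHataParameter c) : (0 : ℂ) ∈ hataSet hc := by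
  refine ⟨fun _ => 0, ?_⟩
  have h := hataCoding_eq hc fun _ => 0
  simp only [hataMap] at h
  have h' := congrArg norm h
  rw [norm_mul, Complex.norm_conj] at h'
  have h1 := hc.norm_lt
  exact norm_le_zero_iff.1 (by nlinarith [norm_nonneg (hataCoding hc fun _ => 0)])

theorem one_mem_hataSet {c : ℂ} (hc : IsHataParameter c) : (1 : ℂ) ∈ hataSet hc := by
  refine ⟨fun _ => 1, ?_⟩
  have h := hataCoding_eq hc fun _ => 1
  have h1 : hataMap c 1 1 = 1 := by simp [hataMap]
  have h' := hc.dist_hataMap 1 (hataCoding hc fun _ => 1) 1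
  simp only at h
  rw [← h, h1] at h'
  have h2 := hc.ratio_lt_one
  exact dist_le_zero.1 (by nlinarith [dist_nonneg (x := hataCoding hc fun _ => 1) (y := (1 : ℂ))])

theorem hataMap_zero_one (c : ℂ) : hataMap c 0 1 = c := by simp [hataMap]

theorem mem_hataSet {c : ℂ} (hc : IsHataParameter c) : c ∈ hataSet hc := by
  have := hataMap_mem hc 0 (one_mem_hataSet hc)
  rwa [hataMap_zero_one] at this

theorem isHataTree_hataStructure {c : ℂ} (hc : IsHataParameter c) :
    (hataStructure hc).IsHataTree ⟨0, zero_mem_hataSet hc⟩ ⟨1, one_mem_hataSet hc⟩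
      ⟨c, mem_hataSet hc⟩ where
  oe h := zero_ne_one (congrArg Subtype.val h)
  oq h := norm_pos_iff.1 hc.norm_pos (congrArg Subtype.val h).symm
  eq h := norm_pos_iff.1 hc.norm_sub_pos (sub_eq_zero.2 (congrArg Subtype.val h))
  zero_o := Subtype.ext (by simp [hataStructure, hataMap])
  zero_e := Subtype.ext (hataMap_zero_one c)
  zero_q := Subtype.ext ((IsHataParameter.hataMap_zero_self c).trans
    (IsHataParameter.hataMap_one_zero c).symm)
  one_e := Subtype.ext (by simp [hataStructure, hataMap])
  inter x y h := by
    obtain ⟨h1, h2⟩ := hc.eq_of_hataMap_eq x.2 y.2 (congrArg Subtype.val h)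
    exact ⟨Subtype.ext h1, Subtype.ext h2⟩

/-- Compare imaginary parts: `ψ_1(c)` is real, and `ψ_2` multiplies the imaginary part by `-(1 - ‖c‖
^ 2)`. -/
theorem hataMap_self_ne {c : ℂ} (hc : IsHataParameter c) (i : Fin 2) : hataMap c i c ≠ c := by
  intro h
  have him := congrArg Complex.im h
  have h1 := hc.norm_sq_lt_one
  match i with
  | 0 =>
    rw [IsHataParameter.hataMap_zero_self, ← Complex.ofReal_pow, Complex.ofReal_im] at him
    exact hc.not_real him.symm
  | 1 =>
    have e : (1 - (‖c‖ : ℂ) ^ 2) = ((1 - ‖c‖ ^ 2 : ℝ) : ℂ) := by push_cast; rfl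
    have e' : (‖c‖ : ℂ) ^ 2 = ((‖c‖ ^ 2 : ℝ) : ℂ) := by push_cast; rfl
    rw [hataMap, e, e', Complex.add_im, Complex.ofReal_im, Complex.im_ofReal_mul,
      Complex.conj_im] at him
    exact hc.not_real (by nlinarith)

/-! ### The harmonic structures -/

/-- The star-triangle computation: if a network with conductances `a`, `b`, `g` is reproduced by
its subdivision, then `g = 0` and the resistance ratios are determined by the first one. -/
theorem conductances_of_isGLB {a b g r s : ℝ} (ha : 0 ≤ a) (hb : 0 ≤ b) (hg : 0 ≤ g)
    (hab : 0 < a + b) (hag : 0 < a + g) (hbg : 0 < b + g) (hr : 0 < r) (hr1 : r < 1) (hs : 0 < s)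
    (h : ∀ x y z : ℝ, IsGLB {t : ℝ | ∃ p w : ℝ, t =
      r⁻¹ * (a * (x - z) ^ 2 + b * (x - p) ^ 2 + g * (z - p) ^ 2) +
      s⁻¹ * (a * (p - y) ^ 2 + b * (p - w) ^ 2 + g * (y - w) ^ 2)}
      (a * (x - y) ^ 2 + b * (x - z) ^ 2 + g * (y - z) ^ 2)) :
    0 < a ∧ g = 0 ∧ b = r⁻¹ * a ∧ s = 1 - r ^ 2 := by
  -- The effective conductance between `p` and `y` in the second copy once `w` is eliminated: `b`
  -- and `g` in series, parallel to `a`. With `B` and `G` from the first copy, `p` is then the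
  -- centre of a star with conductances `B`, `G`, `α`.
  obtain ⟨α, hα⟩ : ∃ α, α = (a + b * g / (b + g)) / s := ⟨_, rfl⟩
  have hα0 : 0 < α := by
    rw [hα]
    refine div_pos ?_ hs
    have : 0 ≤ b * g / (b + g) := by positivity
    rcases ha.eq_or_lt with h0 | h0
    · subst h0
      have h1 : 0 < b := by linarith
      have h2 : 0 < g := by linarith
      positivity
    · linarith
  obtain ⟨B, hB⟩ : ∃ B, B = b / r := ⟨_, rfl⟩
  obtain ⟨G, hG⟩ : ∃ G, G = g / r := ⟨_, rfl⟩
  have hB0 : 0 ≤ B := by rw [hB]; positivity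
  have hG0 : 0 ≤ G := by rw [hG]; positivity
  have hS : 0 < B + G + α := by positivity
  have hBr : b = B * r := by rw [hB]; field_simp
  have hGr : g = G * r := by rw [hG]; field_simp
  have hαs : s⁻¹ * a = α - s⁻¹ * (b * g / (b + g)) := by rw [hα]; field_simp; ring
  have key : ∀ x y z : ℝ, a * (x - y) ^ 2 + b * (x - z) ^ 2 + g * (y - z) ^ 2 =
      a / r * (x - z) ^ 2 + (B * G * (x - z) ^ 2 + B * α * (x - y) ^ 2 + G * α * (z - y) ^ 2) /
        (B + G + α) := by
    intro x y z
    -- Completing the square, first in `w` and then in `p`; the minimizers are the weighted averages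
    -- of the neighbouring values, and what remains is the triangle equivalent to the star.
    have expand : ∀ p w : ℝ, r⁻¹ * (a * (x - z) ^ 2 + b * (x - p) ^ 2 + g * (z - p) ^ 2) +
        s⁻¹ * (a * (p - y) ^ 2 + b * (p - w) ^ 2 + g * (y - w) ^ 2) =
        a / r * (x - z) ^ 2 + (B * G * (x - z) ^ 2 + B * α * (x - y) ^ 2 + G * α * (z - y) ^ 2) /
          (B + G + α) + (B + G + α) * (p - (B * x + G * z + α * y) / (B + G + α)) ^ 2 +
          s⁻¹ * (b + g) * (w - (b * p + g * y) / (b + g)) ^ 2 := by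
      intro p w
      have e1 : s⁻¹ * (a * (p - y) ^ 2 + b * (p - w) ^ 2 + g * (y - w) ^ 2) =
          α * (p - y) ^ 2 + s⁻¹ * (b + g) * (w - (b * p + g * y) / (b + g)) ^ 2 := by
        have : s⁻¹ * (a * (p - y) ^ 2 + b * (p - w) ^ 2 + g * (y - w) ^ 2) =
          s⁻¹ * a * (p - y) ^ 2 + s⁻¹ * (b * (p - w) ^ 2 + g * (y - w) ^ 2) := by ring
        rw [this, hαs]
        field_simp
        ring
      have e2 : r⁻¹ * (a * (x - z) ^ 2 + b * (x - p) ^ 2 + g * (z - p) ^ 2) =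
          a / r * (x - z) ^ 2 + B * (x - p) ^ 2 + G * (z - p) ^ 2 := by
        rw [hBr, hGr]
        field_simp
      rw [e1, e2]
      field_simp
      ring
    refine (h x y z).unique (IsLeast.isGLB ⟨?_, ?_⟩)
    · refine ⟨(B * x + G * z + α * y) / (B + G + α), (b * ((B * x + G * z + α * y) / (B + G + α)) +
        g * y) / (b + g), ?_⟩
      rw [expand]
      ring
    · rintro _ ⟨p, w, rfl⟩
      rw [expand]
      have h1 : 0 ≤ (B + G + α) * (p - (B * x + G * z + α * y) / (B + G + α)) ^ 2 := by positivity
      have h2 : 0 ≤ s⁻¹ * (b + g) * (w - (b * p + g * y) / (b + g)) ^ 2 := by positivity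
      linarith
  -- Indicator vectors separate the three conductances of the triangle: `a = Bα/S`, `g = Gα/S` and
  -- `b = a/r + BG/S`.
  have k1 := key 1 0 0
  have k2 := key 0 1 0
  have k3 := key 0 0 1
  obtain ⟨S, hSd⟩ : ∃ S, S = B + G + α := ⟨_, rfl⟩
  rw [← hSd] at k1 k2 k3 hS
  have ea : a * S = B * α := by field_simp at k1 k2 k3; nlinarith
  have eg : g * S = G * α := by field_simp at k1 k2 k3; nlinarith
  have eb : b = a / r + B * G / S := by
    have ea' : a = B * α / S := by field_simp; linarith
    have eg' : g = G * α / S := by field_simp; linarith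
    have : (B * G * (1 - 0) ^ 2 + B * α * (1 - 0) ^ 2 + G * α * (0 - 0) ^ 2) / S =
      B * G / S + B * α / S := by ring
    rw [this] at k1
    linarith
  have hbpos : 0 < b := by
    refine hb.lt_of_ne fun h0 => ?_
    have hB' : B = 0 := by rw [hB, ← h0, zero_div]
    rw [← h0, hB'] at eb
    have : a / r = 0 := by
      have : 0 * G / S = 0 := by ring
      linarith
    have : a = 0 := by simpa [hr.ne'] using this
    linarith
  have hBpos : 0 < B := by rw [hB]; positivity
  have hapos : 0 < a := by
    have : 0 < B * α := by positivity
    rw [← ea] at this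
    exact pos_of_mul_pos_left this hS.le
  -- If `g > 0`, the equation for `g` gives `α = r * S`, the one for `a` then gives `a = b`, and the
  -- one for `b` gives `b > a / r > a`, because `r < 1`.
  have hg0 : g = 0 := by
    by_contra hne
    have hgpos : 0 < g := lt_of_le_of_ne hg (Ne.symm hne)
    have hGpos : 0 < G := by rw [hG]; positivity
    have e1 : α = r * S := by
      have : G * (r * S) = G * α := by rw [← eg, hGr]; ring
      exact (mul_left_cancel₀ hGpos.ne' this).symm
    have e2 : a = b := by
      have : a * S = b * S := by rw [ea, e1, hBr]; ring
      exact mul_right_cancel₀ hS.ne' this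
    have e3 : a < a / r := by
      rw [lt_div_iff₀ hr]
      nlinarith
    have : 0 < B * G / S := by positivity
    linarith
  have hG' : G = 0 := by rw [hG, hg0, zero_div]
  have hbr : b = r⁻¹ * a := by
    rw [eb, hG']
    ring
  refine ⟨hapos, hg0, hbr, ?_⟩
  -- With `g = 0` the remaining equation `a * S = B * α` reads `1 / r² + 1 / s = 1 / (r² s)`.
  have hαa : α = a / s := by rw [hα, hg0]; simp
  have hBa : B = a / r ^ 2 := by rw [hB, hbr]; field_simp
  rw [hSd, hG', hαa, hBa] at ea
  field_simp at ea
  have : a * s = a * (1 - r ^ 2) := by linarith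
  exact mul_left_cancel₀ hapos.ne' this

/-! ### Conductances of a regular harmonic structure -/

namespace SelfSimilarStructure

variable {K : Type*} [TopologicalSpace K]

theorem energy_zero {N : ℕ} (L : SelfSimilarStructure K N) (D : Matrix L.V₀ L.V₀ ℝ)
    (r : Fin N → ℝ) (u v : K → ℝ) :
    L.energy D r 0 u v = L.energy₀ D (fun q => u q) (fun q => v q) := by
  simp [energy, ψWord]

theorem energy_succ {N : ℕ} (L : SelfSimilarStructure K N) (D : Matrix L.V₀ L.V₀ ℝ)
    (r : Fin N → ℝ) (m : ℕ) (u v : K → ℝ) :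
    L.energy D r (m + 1) u v =
      ∑ i, (r i)⁻¹ * L.energy D r m (fun x => u (L.ψ i x)) (fun x => v (L.ψ i x)) := by
  simp only [energy]
  rw [← (Fin.consEquiv fun _ : Fin (m + 1) => Fin N).sum_comp, Fintype.sum_prod_type]
  refine Finset.sum_congr rfl fun i _ => ?_
  rw [Finset.mul_sum]
  refine Finset.sum_congr rfl fun w _ => ?_
  simp [Fin.consEquiv, Fin.prod_univ_succ, ψWord, mul_assoc, mul_comm]

namespace IsHataTree

variable {L : SelfSimilarStructure K 2} {o e q : K} (T : L.IsHataTree o e q)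
include T

theorem o_mem : o ∈ L.V₀ := by rw [T.V₀_eq]; simp

theorem e_mem : e ∈ L.V₀ := by rw [T.V₀_eq]; simp

theorem q_mem : q ∈ L.V₀ := by rw [T.V₀_eq]; simp

theorem cases_V₀ (x : L.V₀) : x = ⟨o, T.o_mem⟩ ∨ x = ⟨e, T.e_mem⟩ ∨ x = ⟨q, T.q_mem⟩ := by
  have : (x : K) ∈ ({q, e, o} : Set K) := T.V₀_eq ▸ x.2
  rcases this with h | h | h
  · exact Or.inr (Or.inr (Subtype.ext h))
  · exact Or.inr (Or.inl (Subtype.ext h))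
  · exact Or.inl (Subtype.ext h)

theorem finsum_V₀ (F : L.V₀ → ℝ) :
    ∑ᶠ x, F x = F ⟨o, T.o_mem⟩ + F ⟨e, T.e_mem⟩ + F ⟨q, T.q_mem⟩ := by
  classical
  rw [finsum_eq_sum_of_support_subset (s := {⟨o, T.o_mem⟩, ⟨e, T.e_mem⟩, ⟨q, T.q_mem⟩})]
  · rw [Finset.sum_insert, Finset.sum_insert, Finset.sum_singleton, add_assoc]
    · simpa using T.eq
    · simpa using ⟨T.oe, T.oq⟩
  · intro x _
    simpa using T.cases_V₀ x

/-- Constants lie in the kernel, so the rows of the symmetric matrix `D` sum to zero and the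
diagonal can be eliminated. -/
theorem energy₀_eq {D : Matrix L.V₀ L.V₀ ℝ} {r : Fin 2 → ℝ} (h : L.IsHarmonicStructure D r)
    (u v : L.V₀ → ℝ) :
    L.energy₀ D u v =
      D ⟨o, T.o_mem⟩ ⟨e, T.e_mem⟩ * ((u ⟨o, T.o_mem⟩ - u ⟨e, T.e_mem⟩) *
        (v ⟨o, T.o_mem⟩ - v ⟨e, T.e_mem⟩)) +
      D ⟨o, T.o_mem⟩ ⟨q, T.q_mem⟩ * ((u ⟨o, T.o_mem⟩ - u ⟨q, T.q_mem⟩) *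
        (v ⟨o, T.o_mem⟩ - v ⟨q, T.q_mem⟩)) +
      D ⟨e, T.e_mem⟩ ⟨q, T.q_mem⟩ * ((u ⟨e, T.e_mem⟩ - u ⟨q, T.q_mem⟩) *
        (v ⟨e, T.e_mem⟩ - v ⟨q, T.q_mem⟩)) := by
  have hrow := (h.ker fun _ => 1).2 ⟨1, fun _ => rfl⟩
  have h1 := hrow ⟨o, T.o_mem⟩
  have h2 := hrow ⟨e, T.e_mem⟩
  have h3 := hrow ⟨q, T.q_mem⟩
  simp only [apply, T.finsum_V₀, mul_one] at h1 h2 h3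
  have s1 := h.symm.apply ⟨o, T.o_mem⟩ ⟨e, T.e_mem⟩
  have s2 := h.symm.apply ⟨o, T.o_mem⟩ ⟨q, T.q_mem⟩
  have s3 := h.symm.apply ⟨e, T.e_mem⟩ ⟨q, T.q_mem⟩
  simp only [energy₀, apply, T.finsum_V₀]
  rw [s1] at h2 ⊢
  rw [s2, s3] at h3 ⊢
  generalize D ⟨o, T.o_mem⟩ ⟨e, T.e_mem⟩ = x1 at *
  generalize D ⟨o, T.o_mem⟩ ⟨q, T.q_mem⟩ = x2 at *
  generalize D ⟨e, T.e_mem⟩ ⟨q, T.q_mem⟩ = x3 at *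
  rw [show D ⟨o, T.o_mem⟩ ⟨o, T.o_mem⟩ = -x1 - x2 by linarith,
    show D ⟨e, T.e_mem⟩ ⟨e, T.e_mem⟩ = -x1 - x3 by linarith,
    show D ⟨q, T.q_mem⟩ ⟨q, T.q_mem⟩ = -x2 - x3 by linarith]
  ring

-- If both conductances at a vertex vanished, the indicator of that vertex would be a nonconstant
-- element of the kernel.
open Classical in
theorem conductance_pos {D : Matrix L.V₀ L.V₀ ℝ} {r : Fin 2 → ℝ} (h : L.IsHarmonicStructure D r) :
    0 < D ⟨o, T.o_mem⟩ ⟨e, T.e_mem⟩ + D ⟨o, T.o_mem⟩ ⟨q, T.q_mem⟩ ∧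
    0 < D ⟨o, T.o_mem⟩ ⟨e, T.e_mem⟩ + D ⟨e, T.e_mem⟩ ⟨q, T.q_mem⟩ ∧
    0 < D ⟨o, T.o_mem⟩ ⟨q, T.q_mem⟩ + D ⟨e, T.e_mem⟩ ⟨q, T.q_mem⟩ := by
  have hoe : (⟨o, T.o_mem⟩ : L.V₀) ≠ ⟨e, T.e_mem⟩ := fun h => T.oe (congrArg Subtype.val h)
  have hoq : (⟨o, T.o_mem⟩ : L.V₀) ≠ ⟨q, T.q_mem⟩ := fun h => T.oq (congrArg Subtype.val h)
  have heq : (⟨e, T.e_mem⟩ : L.V₀) ≠ ⟨q, T.q_mem⟩ := fun h => T.eq (congrArg Subtype.val h)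
  have h1 := h.off_diag _ _ hoe
  have h2 := h.off_diag _ _ hoq
  have h3 := h.off_diag _ _ heq
  have s1 := h.symm.apply ⟨o, T.o_mem⟩ ⟨e, T.e_mem⟩
  have s2 := h.symm.apply ⟨o, T.o_mem⟩ ⟨q, T.q_mem⟩
  have s3 := h.symm.apply ⟨e, T.e_mem⟩ ⟨q, T.q_mem⟩
  have hrow := (h.ker fun _ => 1).2 ⟨1, fun _ => rfl⟩
  have isolated : ∀ x : L.V₀, (∀ y, y ≠ x → D y x = 0) → D x x = 0 → False := by
    intro x hx hxx
    obtain ⟨t, ht⟩ := (h.ker (Pi.single x 1)).1 (by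
      intro y
      rw [apply, finsum_eq_single _ x (by intro z hz; simp [hz])]
      by_cases hyx : y = x
      · simp [hyx, hxx]
      · simp [hx y hyx])
    have e1 := ht x
    rw [Pi.single_eq_same] at e1
    have : ∀ y, y = x := by
      intro y
      by_contra hy
      have := ht y
      rw [Pi.single_eq_of_ne hy] at this
      linarith
    exact hoe ((this _).trans (this _).symm)
  simp only [apply, T.finsum_V₀, mul_one] at hrow
  have r1 := hrow ⟨o, T.o_mem⟩
  have r2 := hrow ⟨e, T.e_mem⟩
  have r3 := hrow ⟨q, T.q_mem⟩
  refine ⟨?_, ?_, ?_⟩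
  · by_contra hle
    refine isolated ⟨o, T.o_mem⟩ (fun y hy => ?_) (by linarith)
    rcases T.cases_V₀ y with rfl | rfl | rfl
    · exact absurd rfl hy
    · linarith
    · linarith
  · by_contra hle
    refine isolated ⟨e, T.e_mem⟩ (fun y hy => ?_) (by linarith)
    rcases T.cases_V₀ y with rfl | rfl | rfl
    · linarith
    · exact absurd rfl hy
    · linarith
  · by_contra hle
    refine isolated ⟨q, T.q_mem⟩ (fun y hy => ?_) (by linarith)
    rcases T.cases_V₀ y with rfl | rfl | rfl
    · linarith
    · linarith
    · exact absurd rfl hy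

-- The network of level one has the vertices `o`, `e`, `q`, `ψ_1(o)`, `ψ_1(q)`. The first three
-- carry the boundary values `x`, `y`, `z`, the other two the free values `p`, `w` of
-- `conductances_of_isGLB`.
open Classical in
theorem conductances {D : Matrix L.V₀ L.V₀ ℝ} {r : Fin 2 → ℝ}
    (h : L.IsRegularHarmonicStructure D r) :
    0 < D ⟨o, T.o_mem⟩ ⟨e, T.e_mem⟩ ∧ D ⟨e, T.e_mem⟩ ⟨q, T.q_mem⟩ = 0 ∧
    D ⟨o, T.o_mem⟩ ⟨q, T.q_mem⟩ = (r 0)⁻¹ * D ⟨o, T.o_mem⟩ ⟨e, T.e_mem⟩ ∧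
    r 1 = 1 - r 0 ^ 2 := by
  have hh := h.toIsHarmonicStructure
  obtain ⟨p1, p2, p3⟩ := T.conductance_pos hh
  have hoe : (⟨o, T.o_mem⟩ : L.V₀) ≠ ⟨e, T.e_mem⟩ := fun h => T.oe (congrArg Subtype.val h)
  have hoq : (⟨o, T.o_mem⟩ : L.V₀) ≠ ⟨q, T.q_mem⟩ := fun h => T.oq (congrArg Subtype.val h)
  have heq : (⟨e, T.e_mem⟩ : L.V₀) ≠ ⟨q, T.q_mem⟩ := fun h => T.eq (congrArg Subtype.val h)
  refine conductances_of_isGLB (hh.off_diag _ _ hoe) (hh.off_diag _ _ hoq) (hh.off_diag _ _ heq)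
    p1 p2 p3 (hh.r_pos 0) (h.r_lt_one 0) (hh.r_pos 1) ?_
  intro x y z
  have := hh.isGLB fun w => if w = ⟨o, T.o_mem⟩ then x else if w = ⟨e, T.e_mem⟩ then y else z
  rw [T.energy₀_eq hh] at this
  simp only [if_true, if_neg hoe.symm, if_neg hoq.symm, if_neg heq.symm] at this
  convert this using 1
  · ext t
    simp only [Set.mem_ofPred_eq]
    have hE : ∀ u : K → ℝ, L.energy D r 1 u u =
        (r 0)⁻¹ * (D ⟨o, T.o_mem⟩ ⟨e, T.e_mem⟩ * (u o - u q) ^ 2 +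
          D ⟨o, T.o_mem⟩ ⟨q, T.q_mem⟩ * (u o - u (L.ψ 1 o)) ^ 2 +
          D ⟨e, T.e_mem⟩ ⟨q, T.q_mem⟩ * (u q - u (L.ψ 1 o)) ^ 2) +
        (r 1)⁻¹ * (D ⟨o, T.o_mem⟩ ⟨e, T.e_mem⟩ * (u (L.ψ 1 o) - u e) ^ 2 +
          D ⟨o, T.o_mem⟩ ⟨q, T.q_mem⟩ * (u (L.ψ 1 o) - u (L.ψ 1 q)) ^ 2 +
          D ⟨e, T.e_mem⟩ ⟨q, T.q_mem⟩ * (u e - u (L.ψ 1 q)) ^ 2) := by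
      intro u
      rw [energy_succ, Fin.sum_univ_two, energy_zero, energy_zero, T.energy₀_eq hh,
        T.energy₀_eq hh]
      simp only [T.zero_o, T.zero_e, T.zero_q, T.one_e, sq]
    constructor
    · rintro ⟨p, w, rfl⟩
      -- The five vertices are distinct, so values on them can be prescribed independently.
      have n1 : L.ψ 1 o ≠ o := fun h' => T.oq (T.inter o o (T.zero_o.trans h'.symm)).1
      have n2 : L.ψ 1 o ≠ e := fun h' => T.oe (L.injective_ψ 1 (h'.trans T.one_e.symm))
      have n3 : L.ψ 1 o ≠ q := fun h' => T.eq (T.inter e o (T.zero_e.trans h'.symm)).1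
      have n4 : L.ψ 1 q ≠ o := fun h' => T.oq (T.inter o q (T.zero_o.trans h'.symm)).1
      have n5 : L.ψ 1 q ≠ e := fun h' => T.eq (L.injective_ψ 1 (h'.trans T.one_e.symm)).symm
      have n6 : L.ψ 1 q ≠ q := fun h' => T.eq (T.inter e q (T.zero_e.trans h'.symm)).1
      have n7 : L.ψ 1 q ≠ L.ψ 1 o := fun h' => T.oq (L.injective_ψ 1 h').symm
      refine ⟨fun k => if k = o then x else if k = e then y else if k = q then z else
        if k = L.ψ 1 o then p else w, ?_, ?_⟩
      · intro k
        rcases T.cases_V₀ k with rfl | rfl | rfl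
        · simp
        · simp [T.oe.symm]
        · simp [T.oq.symm, T.eq.symm]
      · rw [hE]
        simp [T.oe.symm, T.oq.symm, T.eq.symm, n1, n2, n3, n4, n5, n6, n7]
    · rintro ⟨u, hu, rfl⟩
      have u1 := hu ⟨o, T.o_mem⟩
      have u2 := hu ⟨e, T.e_mem⟩
      have u3 := hu ⟨q, T.q_mem⟩
      simp only [if_true, if_neg hoe.symm, if_neg hoq.symm, if_neg heq.symm] at u1 u2 u3
      exact ⟨u (L.ψ 1 o), u (L.ψ 1 q), by rw [hE, u1, u2, u3]⟩
  · ring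

end IsHataTree

end SelfSimilarStructure

/-! ### A self-similar measure on the space of words -/

section Words

theorem measurable_prependLetter {N : ℕ} (i : Fin N) :
    Measurable (prependLetter i : (ℕ → Fin N) → ℕ → Fin N) := by
  refine measurable_pi_iff.2 fun n => ?_
  cases n with
  | zero => exact measurable_const
  | succ n => exact measurable_pi_apply n

theorem prependLetter_injective {N : ℕ} (i : Fin N) :
    Function.Injective (prependLetter i : (ℕ → Fin N) → ℕ → Fin N) := by
  intro ω ω' h
  funext n
  exact congrFun h (n + 1)

theorem measurable_shift {N : ℕ} : Measurable fun (ω : ℕ → Fin N) (n : ℕ) => ω (n + 1) :=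
  measurable_pi_iff.2 fun n => measurable_pi_apply (n + 1)

/-- The Bernoulli measure on two letters with weights `ρ`, `1 - ρ`. -/
noncomputable def letterMeasure (ρ : ℝ) : Measure (Fin 2) :=
  ENNReal.ofReal ρ • Measure.dirac 0 + ENNReal.ofReal (1 - ρ) • Measure.dirac 1

theorem isProbabilityMeasure_letterMeasure {ρ : ℝ} (h0 : 0 < ρ) (h1 : ρ < 1) :
    IsProbabilityMeasure (letterMeasure ρ) := by
  constructor
  simp only [letterMeasure, Measure.coe_add, Measure.coe_smul, Pi.add_apply, Pi.smul_apply,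
    measure_univ, smul_eq_mul, mul_one]
  rw [← ENNReal.ofReal_add h0.le (by linarith)]
  simp

/-- The Bernoulli measure on infinite words. -/
noncomputable def wordMeasure (ρ : ℝ) [IsProbabilityMeasure (letterMeasure ρ)] :
    Measure (ℕ → Fin 2) :=
  Measure.infinitePi fun _ => letterMeasure ρ

instance (ρ : ℝ) [IsProbabilityMeasure (letterMeasure ρ)] :
    IsProbabilityMeasure (wordMeasure ρ) := by
  unfold wordMeasure
  infer_instance

theorem preimage_prependLetter_pi (i : Fin 2) (n : ℕ) (t : ℕ → Set (Fin 2)) :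
    (i ∈ t 0 → prependLetter i ⁻¹' Set.pi (Finset.range (n + 1)) t =
      Set.pi (Finset.range n) fun m => t (m + 1)) ∧
    (i ∉ t 0 → prependLetter i ⁻¹' Set.pi (Finset.range (n + 1)) t = ∅) := by
  constructor
  · intro hi
    ext ω
    simp only [Set.mem_preimage, Set.mem_pi, Finset.coe_range, Set.mem_Iio]
    constructor
    · intro h m hm
      exact h (m + 1) (by omega)
    · intro h m hm
      cases m with
      | zero => exact hi
      | succ m => exact h m (by omega)
  · intro hi
    ext ω
    simp only [Set.mem_preimage, Set.mem_pi, Finset.coe_range, Set.mem_Iio, Set.mem_empty_iff_false,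
      iff_false]
    intro h
    exact hi (h 0 (by omega))

theorem wordMeasure_eq (ρ : ℝ) [IsProbabilityMeasure (letterMeasure ρ)] :
    wordMeasure ρ = ENNReal.ofReal ρ • (wordMeasure ρ).map (prependLetter 0) +
      ENNReal.ofReal (1 - ρ) • (wordMeasure ρ).map (prependLetter 1) := by
  symm
  refine Measure.eq_infinitePi _ fun s t ht => ?_
  classical
  obtain ⟨n, hn⟩ := s.exists_nat_subset_range
  -- The box over `s` is rewritten as a box over an initial segment of length `n + 1`, which surely
  -- contains the index `0`, so that the first letter can be split off.
  set t' : ℕ → Set (Fin 2) := fun m => if m ∈ s then t m else Set.univ with ht'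
  have hpi : Set.pi (s : Set ℕ) t = Set.pi (Finset.range (n + 1)) t' := by
    ext ω
    simp only [Set.mem_pi, Finset.mem_coe, ht', Finset.mem_range]
    constructor
    · intro h m _
      by_cases hm : m ∈ s
      · simpa [hm] using h m hm
      · simp [hm]
    · intro h m hm
      have := h m (by have := Finset.mem_range.1 (hn hm); omega)
      simpa [hm] using this
  have hprod : ∏ m ∈ s, letterMeasure ρ (t m) = ∏ m ∈ Finset.range (n + 1),
      letterMeasure ρ (t' m) := by
    rw [← Finset.prod_subset (hn.trans (Finset.range_mono (Nat.le_succ n)))]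
    · exact Finset.prod_congr rfl fun m hm => by simp [ht', hm]
    · intro m _ hm
      simp [ht', hm]
  have htm : ∀ m, MeasurableSet (t' m) := fun m => MeasurableSet.of_discrete
  have hmeas : MeasurableSet (Set.pi (Finset.range (n + 1) : Set ℕ) t') :=
    MeasurableSet.pi (Finset.countable_toSet _) fun m _ => htm m
  have hP : wordMeasure ρ (Set.pi (Finset.range n) fun m => t' (m + 1)) =
      ∏ m ∈ Finset.range n, letterMeasure ρ (t' (m + 1)) :=
    Measure.infinitePi_pi _ fun m _ => htm _
  have hi : ∀ i : Fin 2, (wordMeasure ρ).map (prependLetter i)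
      (Set.pi (Finset.range (n + 1)) t') = (t' 0).indicator (fun _ => 1) i *
        ∏ m ∈ Finset.range n, letterMeasure ρ (t' (m + 1)) := by
    intro i
    rw [Measure.map_apply (measurable_prependLetter i) hmeas]
    by_cases h : i ∈ t' 0
    · rw [(preimage_prependLetter_pi i n t').1 h, hP, Set.indicator_of_mem h, one_mul]
    · rw [(preimage_prependLetter_pi i n t').2 h, measure_empty, Set.indicator_of_notMem h,
        zero_mul]
  rw [hpi, hprod, Finset.prod_range_succ']
  simp only [Measure.coe_add, Measure.coe_smul, Pi.add_apply, Pi.smul_apply, smul_eq_mul, hi]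
  rw [letterMeasure, Measure.coe_add, Measure.coe_smul, Measure.coe_smul, Pi.add_apply,
    Pi.smul_apply, Pi.smul_apply, Measure.dirac_apply' _ (htm 0), Measure.dirac_apply' _ (htm 0),
    smul_eq_mul, smul_eq_mul]
  simp only [Set.indicator, Pi.one_apply]
  ring

/-- Replace in an infinite word each `0` by the block `00`. -/
def doubleZeros : ℕ → (ℕ → Fin 2) → Fin 2
  | 0, x => x 0
  | 1, x => if x 0 = 0 then 0 else doubleZeros 0 fun n => x (n + 1)
  | n + 2, x => if x 0 = 0 then doubleZeros n fun n => x (n + 1)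
      else doubleZeros (n + 1) fun n => x (n + 1)

/-- Replace in an infinite word each `0` by the block `00`. -/
def doubleWord (x : ℕ → Fin 2) : ℕ → Fin 2 := fun n => doubleZeros n x

theorem doubleWord_zero (x : ℕ → Fin 2) : doubleWord (prependLetter 0 x) =
    prependLetter 0 (prependLetter 0 (doubleWord x)) := by
  funext n
  match n with
  | 0 => rfl
  | 1 => rfl
  | n + 2 => rfl

theorem doubleWord_one (x : ℕ → Fin 2) : doubleWord (prependLetter 1 x) =
    prependLetter 1 (doubleWord x) := by
  funext n
  match n with
  | 0 => rfl
  | 1 => rfl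
  | n + 2 => rfl

theorem measurable_doubleZeros : ∀ n, Measurable (doubleZeros n)
  | 0 => measurable_pi_apply 0
  | 1 => Measurable.ite (measurable_pi_apply 0 (measurableSet_singleton 0)) measurable_const
      ((measurable_doubleZeros 0).comp measurable_shift)
  | n + 2 => Measurable.ite (measurable_pi_apply 0 (measurableSet_singleton 0))
      ((measurable_doubleZeros n).comp measurable_shift)
      ((measurable_doubleZeros (n + 1)).comp measurable_shift)

theorem measurable_doubleWord : Measurable doubleWord :=
  measurable_pi_iff.2 measurable_doubleZeros

/-- Whether the number of letters `0` in `ω_0 ⋯ ω_{n-1}` after the last `1` is even. -/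
def evenRun (ω : ℕ → Fin 2) : ℕ → Bool
  | 0 => true
  | n + 1 => if ω n = 0 then !evenRun ω n else true

/-- The words that are concatenations of blocks `00` and `1` and contain infinitely many `1`s. -/
def blockSet : Set (ℕ → Fin 2) :=
  {ω | (∀ n, ω n = 1 → evenRun ω n = true) ∧ ∀ n, ∃ m, n ≤ m ∧ ω m = 1}

theorem evenRun_one (ω : ℕ → Fin 2) (n : ℕ) :
    evenRun (prependLetter 1 ω) (n + 1) = evenRun ω n := by
  induction n with
  | zero => rfl
  | succ n ih =>
    rw [evenRun, ih, evenRun]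
    rfl

theorem evenRun_zero_zero (ω : ℕ → Fin 2) (n : ℕ) :
    evenRun (prependLetter 0 (prependLetter 0 ω)) (n + 2) = evenRun ω n := by
  induction n with
  | zero => rfl
  | succ n ih =>
    rw [evenRun, ih, evenRun]
    rfl

theorem forall_exists_prependLetter (i : Fin 2) (ω : ℕ → Fin 2) :
    (∀ n, ∃ m, n ≤ m ∧ prependLetter i ω m = 1) ↔ ∀ n, ∃ m, n ≤ m ∧ ω m = 1 := by
  constructor
  · intro h n
    obtain ⟨m, hm, h1⟩ := h (n + 1)
    obtain ⟨m, rfl⟩ := Nat.exists_eq_add_of_le' (Nat.one_le_of_lt hm)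
    exact ⟨m, by omega, h1⟩
  · intro h n
    obtain ⟨m, hm, h1⟩ := h n
    exact ⟨m + 1, by omega, h1⟩

theorem one_mem_blockSet {ω : ℕ → Fin 2} : prependLetter 1 ω ∈ blockSet ↔ ω ∈ blockSet := by
  simp only [blockSet, Set.mem_ofPred_eq, forall_exists_prependLetter]
  refine and_congr_left fun _ => ⟨fun h n hn => ?_, fun h n hn => ?_⟩
  · rw [← evenRun_one]
    exact h (n + 1) hn
  · cases n with
    | zero => rfl
    | succ n => rw [evenRun_one]; exact h n hn

theorem zero_zero_mem_blockSet {ω : ℕ → Fin 2} :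
    prependLetter 0 (prependLetter 0 ω) ∈ blockSet ↔ ω ∈ blockSet := by
  simp only [blockSet, Set.mem_ofPred_eq, forall_exists_prependLetter]
  refine and_congr_left fun _ => ⟨fun h n hn => ?_, fun h n hn => ?_⟩
  · rw [← evenRun_zero_zero]
    exact h (n + 2) hn
  · match n with
    | 0 => rfl
    | 1 => exact absurd hn (by simp [prependLetter])
    | n + 2 => rw [evenRun_zero_zero]; exact h n hn

theorem zero_one_notMem_blockSet (ω : ℕ → Fin 2) :
    prependLetter 0 (prependLetter 1 ω) ∉ blockSet := fun h => by
  have := h.1 1 rfl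
  simp [evenRun, prependLetter] at this

/-- The runs of zeros before the first `1` of the two words differ in parity. That there is a first
`1` is the reason for demanding infinitely many in `blockSet`: the word `000…` would spoil the
disjointness. -/
theorem zero_mem_blockSet_disjoint {ω : ℕ → Fin 2} (h : ω ∈ blockSet) :
    prependLetter 0 ω ∉ blockSet := by
  intro h'
  have hex : ∃ m, ω m = 1 := by
    obtain ⟨m, -, hm⟩ := h.2 0
    exact ⟨m, hm⟩
  classical
  set n := Nat.find hex with hn
  have h1 : ω n = 1 := Nat.find_spec hex
  have h0 : ∀ m < n, ω m = 0 := by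
    intro m hm
    have := Nat.find_min hex hm
    generalize ω m = i at *
    revert i; decide
  have key : ∀ m ≤ n, evenRun (prependLetter 0 ω) (m + 1) = !evenRun ω m := by
    intro m hm
    induction m with
    | zero => rfl
    | succ m ih =>
      have h2 : ω m = 0 := h0 m (by omega)
      have h3 : prependLetter 0 ω (m + 1) = 0 := h2
      rw [evenRun, if_pos h3, ih (by omega), evenRun, if_pos h2]
  have := key n le_rfl
  rw [h.1 n h1, h'.1 (n + 1) h1] at this
  exact absurd this (by decide)

theorem measurable_evenRun (n : ℕ) : Measurable fun ω : ℕ → Fin 2 => evenRun ω n := by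
  induction n with
  | zero => exact measurable_const
  | succ n ih =>
    exact Measurable.ite (measurable_pi_apply n (measurableSet_singleton 0))
      ((measurable_of_countable (fun b : Bool => !b)).comp ih) measurable_const

theorem measurableSet_blockSet : MeasurableSet blockSet := by
  have : blockSet = (⋂ n : ℕ, ({ω : ℕ → Fin 2 | ω n = 1}ᶜ ∪ {ω | evenRun ω n = true})) ∩
      ⋂ n : ℕ, ⋃ m : ℕ, ⋃ _ : n ≤ m, {ω : ℕ → Fin 2 | ω m = 1} := by
    ext ω
    simp [blockSet, imp_iff_not_or]
  rw [this]
  have h1 : ∀ n, MeasurableSet {ω : ℕ → Fin 2 | ω n = 1} := fun n =>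
    measurable_pi_apply n (measurableSet_singleton 1)
  exact (MeasurableSet.iInter fun n => (h1 n).compl.union
    (measurable_evenRun n (measurableSet_singleton true))).inter
    (MeasurableSet.iInter fun n => MeasurableSet.iUnion fun m => MeasurableSet.iUnion fun _ => h1 m)

end Words

/-! ### The length measure of the skeleton on the space of codes -/

section SkeletonMeasure

/-- The law of a random concatenation of blocks `00` and `1`. -/
noncomputable def blockMeasure (ρ : ℝ) [IsProbabilityMeasure (letterMeasure ρ)] :
    Measure (ℕ → Fin 2) :=
  (wordMeasure ρ).map doubleWord

variable {ρ : ℝ} [IsProbabilityMeasure (letterMeasure ρ)]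

instance : IsProbabilityMeasure (blockMeasure ρ) :=
  Measure.isProbabilityMeasure_map measurable_doubleWord.aemeasurable

/-- The first block is `00` with probability `ρ` and `1` with probability `1 - ρ`, and the rest is
an independent word of the same law. With `ρ = r 0 ^ 2` this is the splitting of the arc `oe` at the
branching point. -/
theorem blockMeasure_apply {A : Set (ℕ → Fin 2)} (hA : MeasurableSet A) :
    blockMeasure ρ A =
      ENNReal.ofReal ρ * blockMeasure ρ {ω | prependLetter 0 (prependLetter 0 ω) ∈ A} +
      ENNReal.ofReal (1 - ρ) * blockMeasure ρ {ω | prependLetter 1 ω ∈ A} := by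
  have h0 := measurable_prependLetter (N := 2) 0
  have h1 := measurable_prependLetter (N := 2) 1
  have hA' := measurable_doubleWord hA
  have e0 : MeasurableSet {ω | prependLetter 0 (prependLetter 0 ω) ∈ A} := (h0.comp h0) hA
  have e1 : MeasurableSet {ω | prependLetter 1 ω ∈ A} := h1 hA
  rw [blockMeasure, Measure.map_apply measurable_doubleWord hA,
    Measure.map_apply measurable_doubleWord e0, Measure.map_apply measurable_doubleWord e1]
  conv_lhs => rw [wordMeasure_eq]
  rw [Measure.coe_add, Pi.add_apply, Measure.coe_smul, Measure.coe_smul, Pi.smul_apply,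
    Pi.smul_apply, Measure.map_apply h0 hA', Measure.map_apply h1 hA']
  simp only [Set.preimage, Set.mem_ofPred_eq, doubleWord_zero, doubleWord_one, smul_eq_mul]

theorem subsingleton_measure_le {κ : Measure (ℕ → Fin 2)} {A : Set (ℕ → Fin 2)}
    (hA : A.Subsingleton) : κ A ≤ ⨆ x, κ {x} := by
  rcases hA.eq_empty_or_singleton with rfl | ⟨x, rfl⟩
  · simp
  · exact le_iSup (fun x => κ {x}) x

/-- A word cannot start with both `00` and `1`, so only one term of the self-similarity survives on
an atom. The supremum `s` of the atoms then satisfies `s ≤ m * s` with `m < 1`. -/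
theorem blockMeasure_singleton (hρ0 : 0 < ρ) (hρ1 : ρ < 1) (x : ℕ → Fin 2) :
    blockMeasure ρ {x} = 0 := by
  set s := ⨆ x, blockMeasure ρ {x} with hs
  have hs1 : s ≤ 1 := iSup_le fun x => prob_le_one
  set m := ENNReal.ofReal (max ρ (1 - ρ)) with hm
  have hm1 : m < 1 := by
    rw [hm, ENNReal.ofReal_lt_one]
    exact max_lt hρ1 (by linarith)
  have key : s ≤ m * s := by
    refine iSup_le fun x => ?_
    rw [blockMeasure_apply (measurableSet_singleton x)]
    have sub0 : {ω | prependLetter 0 (prependLetter 0 ω) ∈ ({x} : Set _)}.Subsingleton := by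
      intro a ha b hb
      exact prependLetter_injective 0 (prependLetter_injective 0
        ((Set.mem_singleton_iff.1 ha).trans (Set.mem_singleton_iff.1 hb).symm))
    have sub1 : {ω | prependLetter 1 ω ∈ ({x} : Set _)}.Subsingleton := by
      intro a ha b hb
      exact prependLetter_injective 1
        ((Set.mem_singleton_iff.1 ha).trans (Set.mem_singleton_iff.1 hb).symm)
    have h0 : ENNReal.ofReal ρ ≤ m := ENNReal.ofReal_le_ofReal (le_max_left _ _)
    have h1 : ENNReal.ofReal (1 - ρ) ≤ m := ENNReal.ofReal_le_ofReal (le_max_right _ _)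
    rcases SelfSimilarStructure.IsHataTree.fin_two (x 0) with hx | hx
    · have : {ω | prependLetter 1 ω ∈ ({x} : Set _)} = ∅ := by
        ext ω
        simp only [Set.mem_singleton_iff, Set.mem_ofPred_eq, Set.mem_empty_iff_false, iff_false]
        rintro rfl
        exact absurd hx (by simp [prependLetter])
      rw [this, measure_empty, mul_zero, add_zero]
      exact mul_le_mul' h0 (subsingleton_measure_le sub0)
    · have : {ω | prependLetter 0 (prependLetter 0 ω) ∈ ({x} : Set _)} = ∅ := by
        ext ω
        simp only [Set.mem_singleton_iff, Set.mem_ofPred_eq, Set.mem_empty_iff_false, iff_false]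
        rintro rfl
        exact absurd hx (by simp [prependLetter])
      rw [this, measure_empty, mul_zero, zero_add]
      exact mul_le_mul' h1 (subsingleton_measure_le sub1)
  have hs0 : s = 0 := by
    by_contra hne
    have hlt : m * s < 1 * s :=
      ENNReal.mul_lt_mul_left hne (hs1.trans_lt ENNReal.one_lt_top).ne hm1
    rw [one_mul] at hlt
    exact absurd key (not_le.2 hlt)
  exact le_antisymm ((le_iSup (fun x => blockMeasure ρ {x}) x).trans hs0.le) zero_le

theorem evenRun_doubleWord (n : ℕ) : ∀ x : ℕ → Fin 2, doubleWord x n = 1 →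
    evenRun (doubleWord x) n = true := by
  induction n using Nat.strong_induction_on with
  | _ n ih =>
    intro x
    rw [← SelfSimilarStructure.IsHataTree.prependLetter_shift x]
    rcases SelfSimilarStructure.IsHataTree.fin_two (x 0) with hx | hx
    · rw [hx, doubleWord_zero]
      match n with
      | 0 => exact fun _ => rfl
      | 1 => exact fun h => absurd h (by simp [prependLetter])
      | n + 2 =>
        rw [evenRun_zero_zero]
        exact ih n (by omega) _
    · rw [hx, doubleWord_one]
      cases n with
      | zero => exact fun _ => rfl
      | succ n =>
        rw [evenRun_one]
        exact ih n (by omega) _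

theorem countable_eventually_zero :
    {ω : ℕ → Fin 2 | ¬ ∀ n, ∃ m, n ≤ m ∧ ω m = 1}.Countable := by
  have : {ω : ℕ → Fin 2 | ¬ ∀ n, ∃ m, n ≤ m ∧ ω m = 1} =
      ⋃ n : ℕ, {ω : ℕ → Fin 2 | ∀ m, n ≤ m → ω m = 0} := by
    ext ω
    have h : ∀ m, ω m = 0 ↔ ¬ ω m = 1 := by
      intro m
      generalize ω m = i
      revert i; decide
    simp [h]
  rw [this]
  refine Set.countable_iUnion fun n => Set.Finite.countable ?_
  refine Set.Finite.of_injOn (f := fun (ω : ℕ → Fin 2) (i : Fin n) => ω i) (t := Set.univ)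
    (fun _ _ => Set.mem_univ _) ?_ Set.finite_univ
  intro ω hω ω' hω' h
  funext m
  rcases lt_or_ge m n with hm | hm
  · exact congrFun h ⟨m, hm⟩
  · rw [hω m hm, hω' m hm]

/-- Doubled words satisfy the parity condition without exception; words with finitely many letters
`1` are countable in number, and there are no atoms. -/
theorem blockMeasure_compl_blockSet (hρ0 : 0 < ρ) (hρ1 : ρ < 1) :
    blockMeasure ρ blockSetᶜ = 0 := by
  have : NullSingletonClass (blockMeasure ρ) := ⟨blockMeasure_singleton hρ0 hρ1⟩
  have h1 : blockMeasure ρ {ω | ¬ ∀ n, ω n = 1 → evenRun ω n = true} = 0 := by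
    have hm : MeasurableSet {ω : ℕ → Fin 2 | ¬ ∀ n, ω n = 1 → evenRun ω n = true} := by
      have : {ω : ℕ → Fin 2 | ¬ ∀ n, ω n = 1 → evenRun ω n = true} =
          ⋃ n : ℕ, ({ω : ℕ → Fin 2 | ω n = 1} ∩ {ω | evenRun ω n = true}ᶜ) := by
        ext ω
        simp
      rw [this]
      exact MeasurableSet.iUnion fun n => (measurable_pi_apply n (measurableSet_singleton 1)).inter
        (measurable_evenRun n (measurableSet_singleton true)).compl
    rw [blockMeasure, Measure.map_apply measurable_doubleWord hm]
    have : doubleWord ⁻¹' {ω | ¬ ∀ n, ω n = 1 → evenRun ω n = true} = ∅ := by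
      ext x
      simp only [Set.mem_preimage, Set.mem_ofPred_eq, Set.mem_empty_iff_false, iff_false, not_not]
      exact fun n => evenRun_doubleWord n x
    rw [this, measure_empty]
  have h2 := countable_eventually_zero.measure_zero (blockMeasure ρ)
  refine measure_mono_null ?_ (measure_union_null h1 h2)
  intro ω hω
  by_contra h
  simp only [Set.mem_union, Set.mem_ofPred_eq, not_or, not_not] at h
  exact hω h

/-- The properties of the length measure on the skeleton of Hata's tree-like set, lifted to the
space of words; `r` are the length ratios. -/
structure IsSkeletonMeasure (r : Fin 2 → ℝ) (Λ : Measure (ℕ → Fin 2)) : Prop where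
  self_similar : Λ = ENNReal.ofReal (r 0) • Λ.map (prependLetter 0) +
    ENNReal.ofReal (r 1) • Λ.map (prependLetter 1)
  blockSet_eq : Λ blockSet = 1
  singleton : ∀ x, Λ {x} = 0
  concentrated : Λ {ω | ∀ n : ℕ, (fun m => ω (m + n)) ∉ blockSet} = 0

/-- One step of the self-similar construction of a measure. -/
noncomputable def subdivide (r : Fin 2 → ℝ) (κ : Measure (ℕ → Fin 2)) : Measure (ℕ → Fin 2) :=
  ENNReal.ofReal (r 0) • κ.map (prependLetter 0) + ENNReal.ofReal (r 1) • κ.map (prependLetter 1)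

theorem subdivide_apply (r : Fin 2 → ℝ) (κ : Measure (ℕ → Fin 2)) {A : Set (ℕ → Fin 2)}
    (hA : MeasurableSet A) : subdivide r κ A =
      ENNReal.ofReal (r 0) * κ {ω | prependLetter 0 ω ∈ A} +
      ENNReal.ofReal (r 1) * κ {ω | prependLetter 1 ω ∈ A} := by
  rw [subdivide, Measure.coe_add, Pi.add_apply, Measure.coe_smul, Measure.coe_smul, Pi.smul_apply,
    Pi.smul_apply, Measure.map_apply (measurable_prependLetter 0) hA,
    Measure.map_apply (measurable_prependLetter 1) hA]
  rfl

theorem subdivide_add (r : Fin 2 → ℝ) (κ κ' : Measure (ℕ → Fin 2)) :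
    subdivide r (κ + κ') = subdivide r κ + subdivide r κ' := by
  ext A hA
  simp only [subdivide_apply r _ hA, Measure.coe_add, Pi.add_apply]
  ring

theorem subdivide_sum (r : Fin 2 → ℝ) (κ : ℕ → Measure (ℕ → Fin 2)) :
    subdivide r (Measure.sum κ) = Measure.sum fun n => subdivide r (κ n) := by
  ext A hA
  have h0 : MeasurableSet {ω : ℕ → Fin 2 | prependLetter 0 ω ∈ A} := measurable_prependLetter 0 hA
  have h1 : MeasurableSet {ω : ℕ → Fin 2 | prependLetter 1 ω ∈ A} := measurable_prependLetter 1 hA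
  rw [subdivide_apply r _ hA, Measure.sum_apply _ hA, Measure.sum_apply _ h0,
    Measure.sum_apply _ h1, ← ENNReal.tsum_mul_left, ← ENNReal.tsum_mul_left, ← ENNReal.tsum_add]
  simp only [subdivide_apply r _ hA]

theorem measurableSet_ne_orbit :
    MeasurableSet {ω : ℕ → Fin 2 | ∀ n : ℕ, (fun m => ω (m + n)) ∉ blockSet} := by
  have : {ω : ℕ → Fin 2 | ∀ n : ℕ, (fun m => ω (m + n)) ∉ blockSet} =
      ⋂ n : ℕ, (fun (ω : ℕ → Fin 2) m => ω (m + n)) ⁻¹' blockSetᶜ := by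
    ext ω
    simp
  rw [this]
  exact MeasurableSet.iInter fun n => measurableSet_blockSet.compl.preimage
    (measurable_pi_iff.2 fun m => measurable_pi_apply (m + n))

theorem prependLetter_mem_ne_orbit {i : Fin 2} {ω : ℕ → Fin 2}
    (h : ∀ n : ℕ, (fun m => prependLetter i ω (m + n)) ∉ blockSet) :
    ∀ n : ℕ, (fun m => ω (m + n)) ∉ blockSet := fun n => h (n + 1)

/-- `β` is the length on the arc `oe`, and `M` adds the arc `oq`, the image of `oe` under `0`, of
length `r 0`. Subdividing this network of level zero returns it together with one new branch, the
image of `oe` under `10`, whose length measure is `κ`. Hence `M` plus the sum of all iterated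
subdivisions of `κ` is a fixed point of the subdivision. -/
theorem exists_skeletonMeasure {r : Fin 2 → ℝ} (h0 : 0 < r 0) (h01 : r 0 < 1)
    (h1 : r 1 = 1 - r 0 ^ 2) : ∃ Λ, IsSkeletonMeasure r Λ := by
  set ρ := r 0 ^ 2 with hρ
  have hρ0 : 0 < ρ := pow_pos h0 2
  have hρ1 : ρ < 1 := pow_lt_one₀ h0.le h01 two_ne_zero
  have := isProbabilityMeasure_letterMeasure hρ0 hρ1
  have p0 := measurable_prependLetter (N := 2) 0
  have p1 := measurable_prependLetter (N := 2) 1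
  set β := blockMeasure ρ with hβ
  obtain ⟨κ, hκ⟩ : ∃ κ : Measure (ℕ → Fin 2), κ = (ENNReal.ofReal (r 1) * ENNReal.ofReal (r 0)) •
    β.map (prependLetter 1 ∘ prependLetter 0) := ⟨_, rfl⟩
  obtain ⟨M, hM⟩ : ∃ M : Measure (ℕ → Fin 2),
    M = β + ENNReal.ofReal (r 0) • β.map (prependLetter 0) := ⟨_, rfl⟩
  have κ_apply : ∀ A, MeasurableSet A → κ A = (ENNReal.ofReal (r 1) * ENNReal.ofReal (r 0)) *
      β {ω | prependLetter 1 (prependLetter 0 ω) ∈ A} := by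
    intro A hA
    rw [hκ, Measure.coe_smul, Pi.smul_apply, Measure.map_apply (p1.comp p0) hA]
    rfl
  have M_apply : ∀ A, MeasurableSet A → M A = β A + ENNReal.ofReal (r 0) *
      β {ω | prependLetter 0 ω ∈ A} := by
    intro A hA
    rw [hM, Measure.coe_add, Pi.add_apply, Measure.coe_smul, Pi.smul_apply,
      Measure.map_apply p0 hA]
    rfl
  -- The four terms of the left side sit on the prefixes `0`, `00`, `1`, `10`. Those on `00` and `1`
  -- recombine to `β`, with weights `r 0 ^ 2` and `r 1 = 1 - r 0 ^ 2`; the one on `0` is the arc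
  -- `oq`, the one on `10` is `κ`.
  have hsub : subdivide r M = M + κ := by
    ext A hA
    have e0 : MeasurableSet {ω : ℕ → Fin 2 | prependLetter 0 ω ∈ A} := p0 hA
    have e1 : MeasurableSet {ω : ℕ → Fin 2 | prependLetter 1 ω ∈ A} := p1 hA
    rw [subdivide_apply r _ hA, Measure.coe_add, Pi.add_apply, M_apply _ e0, M_apply _ e1,
      M_apply _ hA, κ_apply _ hA]
    simp only [Set.mem_ofPred_eq]
    conv_rhs => rw [hβ, blockMeasure_apply hA, ← hβ]
    rw [← h1, hρ, sq, ENNReal.ofReal_mul h0.le]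
    ring
  have null_step : ∀ {A B : Set (ℕ → Fin 2)}, MeasurableSet A →
      (∀ i, ∀ ω, prependLetter i ω ∈ A → ω ∈ B) → ∀ κ' : Measure (ℕ → Fin 2), κ' B = 0 →
      subdivide r κ' A = 0 := by
    intro A B hA hAB κ' h
    have k0 : κ' {ω | prependLetter 0 ω ∈ A} = 0 := measure_mono_null (fun ω hω => hAB 0 ω hω) h
    have k1 : κ' {ω | prependLetter 1 ω ∈ A} = 0 := measure_mono_null (fun ω hω => hAB 1 ω hω) h
    rw [subdivide_apply r _ hA, k0, k1]
    simp
  have hβ0 : ∀ x, β {x} = 0 := blockMeasure_singleton hρ0 hρ1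
  have subs : ∀ (f : (ℕ → Fin 2) → ℕ → Fin 2), Function.Injective f → ∀ (κ' : Measure (ℕ → Fin 2)),
      (∀ x, κ' {x} = 0) → ∀ x, κ' {ω | f ω ∈ ({x} : Set _)} = 0 := by
    intro f hf κ' h x
    have hS : {ω | f ω ∈ ({x} : Set _)}.Subsingleton := fun a ha b hb => hf (by
      rw [Set.mem_singleton_iff.1 ha, Set.mem_singleton_iff.1 hb])
    exact le_antisymm ((subsingleton_measure_le hS).trans (by simp [h])) zero_le
  have hS := measurableSet_blockSet
  have hS0 : MeasurableSet {ω : ℕ → Fin 2 | ω 0 = 0 ∧ (fun n => ω (n + 1)) ∈ blockSet} :=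
    (measurable_pi_apply 0 (measurableSet_singleton 0)).inter (measurable_shift hS)
  have zero_mem : ∀ ω, prependLetter 0 ω ∈ blockSet →
      ω ∈ {ω : ℕ → Fin 2 | ω 0 = 0 ∧ (fun n => ω (n + 1)) ∈ blockSet} := by
    intro ω hω
    rw [← SelfSimilarStructure.IsHataTree.prependLetter_shift ω] at hω
    rcases SelfSimilarStructure.IsHataTree.fin_two (ω 0) with h | h
    · rw [h] at hω
      exact ⟨h, zero_zero_mem_blockSet.1 hω⟩
    · rw [h] at hω
      exact absurd hω (zero_one_notMem_blockSet _)
  have hβS : β blockSetᶜ = 0 := blockMeasure_compl_blockSet hρ0 hρ1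
  have hβ0S : β {ω | prependLetter 0 ω ∈ blockSet} = 0 := by
    refine measure_mono_null ?_ hβS
    intro ω hω hω'
    exact zero_mem_blockSet_disjoint hω' hω
  -- Later branches give no mass to the two original arcs. Both arcs are treated together, because
  -- stripping a letter `0` exchanges them.
  have iter : ∀ n, (subdivide r)^[n] κ blockSet = 0 ∧
      (subdivide r)^[n] κ {ω : ℕ → Fin 2 | ω 0 = 0 ∧ (fun n => ω (n + 1)) ∈ blockSet} = 0 ∧
      (subdivide r)^[n] κ {ω | ∀ n : ℕ, (fun m => ω (m + n)) ∉ blockSet} = 0 ∧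
      ∀ x, (subdivide r)^[n] κ {x} = 0 := by
    intro n
    induction n with
    | zero =>
      refine ⟨?_, ?_, ?_, fun x => ?_⟩
      · rw [Function.iterate_zero, id, κ_apply _ hS]
        simp only [one_mem_blockSet, hβ0S, mul_zero]
      · rw [Function.iterate_zero, id, κ_apply _ hS0]
        have : {ω | prependLetter 1 (prependLetter 0 ω) ∈
            {ω : ℕ → Fin 2 | ω 0 = 0 ∧ (fun n => ω (n + 1)) ∈ blockSet}} = ∅ := by
          ext ω
          simp [prependLetter]
        rw [this, measure_empty, mul_zero]
      · rw [Function.iterate_zero, id, κ_apply _ measurableSet_ne_orbit,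
          measure_mono_null (fun ω hω hω' => ?_) hβS, mul_zero]
        exact hω 2 hω'
      · have := subs _ ((prependLetter_injective (N := 2) 1).comp (prependLetter_injective 0)) β hβ0 x
        simp only [Function.comp] at this
        rw [Function.iterate_zero, id, κ_apply _ (measurableSet_singleton x), this, mul_zero]
    | succ n ih =>
      obtain ⟨i1, i2, i3, i4⟩ := ih
      simp only [Function.iterate_succ_apply']
      refine ⟨?_, ?_, ?_, fun x => ?_⟩
      · refine null_step hS (B := _ ∪ _) ?_ _ (measure_union_null i1 i2)
        intro i ω hω
        rcases SelfSimilarStructure.IsHataTree.fin_two i with rfl | rfl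
        · exact Or.inr (zero_mem ω hω)
        · exact Or.inl (one_mem_blockSet.1 hω)
      · exact null_step hS0 (fun i ω hω => hω.2) _ i1
      · exact null_step measurableSet_ne_orbit (fun i ω hω => prependLetter_mem_ne_orbit hω) _ i3
      · rw [subdivide_apply r _ (measurableSet_singleton x), subs _ (prependLetter_injective 0) _ i4,
          subs _ (prependLetter_injective 1) _ i4]
        simp
  refine ⟨M + Measure.sum fun n => (subdivide r)^[n] κ, ?_, ?_, ?_, ?_⟩
  -- Subdivision shifts the series by one term, and `hsub` supplies the missing term `κ`.
  · change _ = subdivide r _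
    rw [subdivide_add, hsub, subdivide_sum, add_assoc]
    ext A hA
    rw [Measure.coe_add, Pi.add_apply, Measure.coe_add, Pi.add_apply, Measure.coe_add, Pi.add_apply,
      Measure.sum_apply _ hA, Measure.sum_apply _ hA, tsum_eq_zero_add' ENNReal.summable]
    simp only [Function.iterate_zero, id, Function.iterate_succ_apply']
  · rw [Measure.coe_add, Pi.add_apply, M_apply _ hS, hβ0S, Measure.sum_apply _ hS]
    simp only [(iter _).1, tsum_zero, mul_zero, add_zero]
    rw [prob_compl_eq_zero_iff hS] at hβS
    exact hβS
  · intro x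
    have hx := measurableSet_singleton x
    rw [Measure.coe_add, Pi.add_apply, M_apply _ hx, hβ0, subs _ (prependLetter_injective 0) β hβ0,
      Measure.sum_apply _ hx]
    simp [(iter _).2.2.2]
  · have hm := measurableSet_ne_orbit
    rw [Measure.coe_add, Pi.add_apply, M_apply _ hm, Measure.sum_apply _ hm]
    simp only [(iter _).2.2.1, tsum_zero, add_zero]
    have k0 : β {ω | ∀ n : ℕ, (fun m => ω (m + n)) ∉ blockSet} = 0 :=
      measure_mono_null (fun ω hω hω' => hω 0 hω') hβS
    have k1 : β {ω | prependLetter 0 ω ∈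
        {ω : ℕ → Fin 2 | ∀ n : ℕ, (fun m => ω (m + n)) ∉ blockSet}} = 0 :=
      measure_mono_null (fun ω hω hω' => hω 1 hω') hβS
    rw [k0, k1]
    simp

end SkeletonMeasure

/-! ### Square-integrable functions -/

section L2

variable {Ω : Type*} [MeasurableSpace Ω] {P : Measure Ω}

theorem MeasureTheory.MemLp.integrable_mul_two {f g : Ω → ℝ} (hf : MemLp f 2 P)
    (hg : MemLp g 2 P) : Integrable (fun ω => f ω * g ω) P :=
  hf.integrable_mul hg

theorem MeasureTheory.MemLp.inner_toLp {f g : Ω → ℝ} (hf : MemLp f 2 P) (hg : MemLp g 2 P) :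
    inner ℝ (hf.toLp f) (hg.toLp g) = ∫ ω, f ω * g ω ∂P := by
  rw [L2.inner_def]
  refine integral_congr_ae ?_
  filter_upwards [hf.coeFn_toLp, hg.coeFn_toLp] with ω h1 h2
  rw [h1, h2]
  simp [mul_comm]

theorem MeasureTheory.MemLp.norm_toLp_sq {f : Ω → ℝ} (hf : MemLp f 2 P) :
    ‖hf.toLp f‖ ^ 2 = ∫ ω, f ω ^ 2 ∂P := by
  rw [← real_inner_self_eq_norm_sq, hf.inner_toLp hf]
  simp only [sq]

theorem tendsto_toLp_iff {f : ℕ → Ω → ℝ} {g : Ω → ℝ} (hf : ∀ n, MemLp (f n) 2 P)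
    (hg : MemLp g 2 P) : Tendsto (fun n => (hf n).toLp (f n)) atTop (𝓝 (hg.toLp g)) ↔
      Tendsto (fun n => ∫ ω, (f n ω - g ω) ^ 2 ∂P) atTop (𝓝 0) := by
  rw [tendsto_iff_norm_sub_tendsto_zero]
  have e : ∀ n, ∫ ω, (f n ω - g ω) ^ 2 ∂P = ‖(hf n).toLp (f n) - hg.toLp g‖ ^ 2 := by
    intro n
    rw [← MemLp.toLp_sub, MemLp.norm_toLp_sq]
    rfl
  simp only [e]
  constructor
  · intro h
    simpa using h.pow 2
  · intro h
    have := h.sqrt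
    simpa [Real.sqrt_sq (norm_nonneg _)] using this

theorem tendsto_integral_mul {f f' : ℕ → Ω → ℝ} {g g' : Ω → ℝ} (hf : ∀ n, MemLp (f n) 2 P)
    (hg : MemLp g 2 P) (hf' : ∀ n, MemLp (f' n) 2 P) (hg' : MemLp g' 2 P)
    (h : Tendsto (fun n => ∫ ω, (f n ω - g ω) ^ 2 ∂P) atTop (𝓝 0))
    (h' : Tendsto (fun n => ∫ ω, (f' n ω - g' ω) ^ 2 ∂P) atTop (𝓝 0)) :
    Tendsto (fun n => ∫ ω, f n ω * f' n ω ∂P) atTop (𝓝 (∫ ω, g ω * g' ω ∂P)) := by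
  simp only [← MemLp.inner_toLp (hf _) (hf' _), ← MemLp.inner_toLp hg hg']
  exact ((tendsto_toLp_iff hf hg).2 h).inner ((tendsto_toLp_iff hf' hg').2 h')

end L2

/-! ### Consequences of self-similarity -/

namespace IsSkeletonMeasure

variable {r : Fin 2 → ℝ} {Λ : Measure (ℕ → Fin 2)} (hΛ : IsSkeletonMeasure r Λ)
include hΛ

theorem measure_eq {A : Set (ℕ → Fin 2)} (hA : MeasurableSet A) :
    Λ A = ENNReal.ofReal (r 0) * Λ {ω | prependLetter 0 ω ∈ A} +
      ENNReal.ofReal (r 1) * Λ {ω | prependLetter 1 ω ∈ A} := by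
  conv_lhs => rw [hΛ.self_similar]
  exact subdivide_apply r Λ hA

theorem integrable_iff (h0 : 0 < r 0) (h1 : 0 < r 1) {F : (ℕ → Fin 2) → ℝ} (hF : Measurable F) :
    Integrable F Λ ↔ ∀ i, Integrable (fun ω => F (prependLetter i ω)) Λ := by
  conv_lhs => rw [hΛ.self_similar]
  rw [integrable_add_measure, integrable_smul_measure (by simpa using h0) ENNReal.ofReal_ne_top,
    integrable_smul_measure (by simpa using h1) ENNReal.ofReal_ne_top,
    integrable_map_measure hF.aestronglyMeasurable (measurable_prependLetter 0).aemeasurable,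
    integrable_map_measure hF.aestronglyMeasurable (measurable_prependLetter 1).aemeasurable,
    Fin.forall_fin_two]
  rfl

theorem integral_eq (h0 : 0 < r 0) (h1 : 0 < r 1) {F : (ℕ → Fin 2) → ℝ} (hF : Measurable F)
    (hI : Integrable F Λ) : ∫ ω, F ω ∂Λ = r 0 * ∫ ω, F (prependLetter 0 ω) ∂Λ +
      r 1 * ∫ ω, F (prependLetter 1 ω) ∂Λ := by
  have hI' := hI
  rw [hΛ.self_similar, integrable_add_measure] at hI'
  conv_lhs => rw [hΛ.self_similar]
  rw [integral_add_measure hI'.1 hI'.2, integral_smul_measure, integral_smul_measure,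
    integral_map (measurable_prependLetter 0).aemeasurable hF.aestronglyMeasurable,
    integral_map (measurable_prependLetter 1).aemeasurable hF.aestronglyMeasurable,
    ENNReal.toReal_ofReal h0.le, ENNReal.toReal_ofReal h1.le]
  rfl

theorem memLp_iff (h0 : 0 < r 0) (h1 : 0 < r 1) {F : (ℕ → Fin 2) → ℝ} (hF : Measurable F) :
    MemLp F 2 Λ ↔ ∀ i, MemLp (fun ω => F (prependLetter i ω)) 2 Λ := by
  rw [memLp_two_iff_integrable_sq hF.aestronglyMeasurable,
    hΛ.integrable_iff h0 h1 (hF.pow_const 2)]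
  refine forall_congr' fun i => ?_
  have := (hF.comp (measurable_prependLetter i)).aestronglyMeasurable (μ := Λ)
  exact (memLp_two_iff_integrable_sq this).symm

/-- These sets exhaust the words up to the null set `concentrated`, and so make `Λ` σ-finite. Each
step multiplies the mass by `r 0 + r 1`. -/
theorem measure_shift_iterate (n : ℕ) :
    Λ {ω | (fun m => ω (m + n)) ∈ blockSet} < ⊤ := by
  induction n with
  | zero =>
    have := hΛ.blockSet_eq
    simp only [add_zero]
    change Λ blockSet < ⊤
    rw [this]
    exact ENNReal.one_lt_top
  | succ n ih =>
    have hm : MeasurableSet {ω : ℕ → Fin 2 | (fun m => ω (m + (n + 1))) ∈ blockSet} :=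
      measurableSet_blockSet.preimage (measurable_pi_iff.2 fun m => measurable_pi_apply (m + (n + 1)))
    rw [hΛ.measure_eq hm]
    exact ENNReal.add_lt_top.2 ⟨ENNReal.mul_lt_top ENNReal.ofReal_lt_top ih,
      ENNReal.mul_lt_top ENNReal.ofReal_lt_top ih⟩

end IsSkeletonMeasure

/-! ### Discrete gradients -/

/-- The set of words `0ω` with `ω` in `blockSet`. -/
def zeroBlockSet : Set (ℕ → Fin 2) := {ω | ω 0 = 0 ∧ (fun n => ω (n + 1)) ∈ blockSet}

theorem measurableSet_zeroBlockSet : MeasurableSet zeroBlockSet :=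
  (measurable_pi_apply 0 (measurableSet_singleton 0)).inter (measurable_shift measurableSet_blockSet)

theorem zero_mem_zeroBlockSet {ω : ℕ → Fin 2} : prependLetter 0 ω ∈ zeroBlockSet ↔ ω ∈ blockSet :=
  ⟨fun h => h.2, fun h => ⟨rfl, h⟩⟩

theorem one_notMem_zeroBlockSet (ω : ℕ → Fin 2) : prependLetter 1 ω ∉ zeroBlockSet :=
  fun h => absurd h.1 (by simp [prependLetter])

theorem zero_mem_blockSet {ω : ℕ → Fin 2} : prependLetter 0 ω ∈ blockSet ↔ ω ∈ zeroBlockSet := by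
  constructor
  · intro hω
    rw [← SelfSimilarStructure.IsHataTree.prependLetter_shift ω] at hω
    rcases SelfSimilarStructure.IsHataTree.fin_two (ω 0) with h | h
    · rw [h] at hω
      exact ⟨h, zero_zero_mem_blockSet.1 hω⟩
    · rw [h] at hω
      exact absurd hω (zero_one_notMem_blockSet _)
  · rintro ⟨h, hω⟩
    rw [← SelfSimilarStructure.IsHataTree.prependLetter_shift ω, h]
    exact zero_zero_mem_blockSet.2 hω

theorem notMem_zeroBlockSet_of_mem {ω : ℕ → Fin 2} (h : ω ∈ blockSet) : ω ∉ zeroBlockSet := by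
  rintro ⟨h0, hω⟩
  rw [← SelfSimilarStructure.IsHataTree.prependLetter_shift ω, h0] at h
  exact zero_mem_blockSet_disjoint hω h

/-- The function with value `α` on `blockSet` and `β` on `zeroBlockSet`. -/
noncomputable def blockFun (α β : ℝ) (ω : ℕ → Fin 2) : ℝ :=
  blockSet.indicator (fun _ => α) ω + zeroBlockSet.indicator (fun _ => β) ω

theorem blockFun_of_mem {α β : ℝ} {ω : ℕ → Fin 2} (h : ω ∈ blockSet) : blockFun α β ω = α := by
  rw [blockFun, Set.indicator_of_mem h, Set.indicator_of_notMem (notMem_zeroBlockSet_of_mem h),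
    add_zero]

theorem blockFun_of_mem_zero {α β : ℝ} {ω : ℕ → Fin 2} (h : ω ∈ zeroBlockSet) :
    blockFun α β ω = β := by
  rw [blockFun, Set.indicator_of_mem h,
    Set.indicator_of_notMem fun h' => notMem_zeroBlockSet_of_mem h' h, zero_add]

theorem blockFun_of_notMem {α β : ℝ} {ω : ℕ → Fin 2} (h : ω ∉ blockSet) (h' : ω ∉ zeroBlockSet) :
    blockFun α β ω = 0 := by
  rw [blockFun, Set.indicator_of_notMem h, Set.indicator_of_notMem h', add_zero]

theorem measurable_blockFun (α β : ℝ) : Measurable (blockFun α β) :=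
  (measurable_const.indicator measurableSet_blockSet).add
    (measurable_const.indicator measurableSet_zeroBlockSet)

/-- The letter `0` carries the arc `oe` onto `oq` and `oq` into `oe`, so the two values are
exchanged. In `blockFun_one` the letter `1` carries `oe` into itself and `oq` off both arcs. -/
theorem blockFun_zero (α β : ℝ) (ω : ℕ → Fin 2) :
    blockFun α β (prependLetter 0 ω) = blockFun β α ω := by
  by_cases h : ω ∈ blockSet
  · rw [blockFun_of_mem h, blockFun_of_mem_zero (zero_mem_zeroBlockSet.2 h)]
  · by_cases h' : ω ∈ zeroBlockSet
    · rw [blockFun_of_mem_zero h', blockFun_of_mem (zero_mem_blockSet.2 h')]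
    · rw [blockFun_of_notMem h h', blockFun_of_notMem (fun k => h' (zero_mem_blockSet.1 k))
        fun k => h (zero_mem_zeroBlockSet.1 k)]

theorem blockFun_one (α β : ℝ) (ω : ℕ → Fin 2) :
    blockFun α β (prependLetter 1 ω) = blockFun α 0 ω := by
  by_cases h : ω ∈ blockSet
  · rw [blockFun_of_mem h, blockFun_of_mem (one_mem_blockSet.2 h)]
  · rw [blockFun_of_notMem (fun k => h (one_mem_blockSet.1 k)) (one_notMem_zeroBlockSet ω)]
    simp [blockFun, h]

namespace IsSkeletonMeasure

variable {r : Fin 2 → ℝ} {Λ : Measure (ℕ → Fin 2)} (hΛ : IsSkeletonMeasure r Λ)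
include hΛ

theorem zeroBlockSet_eq : Λ zeroBlockSet = ENNReal.ofReal (r 0) := by
  rw [hΛ.measure_eq measurableSet_zeroBlockSet]
  simp only [zero_mem_zeroBlockSet, one_notMem_zeroBlockSet, Set.ofPred_mem_eq, hΛ.blockSet_eq]
  simp

theorem memLp_blockFun (α β : ℝ) : MemLp (blockFun α β) 2 Λ := by
  refine MemLp.add ?_ ?_
  · exact memLp_indicator_const 2 measurableSet_blockSet α (Or.inr (by simp [hΛ.blockSet_eq]))
  · exact memLp_indicator_const 2 measurableSet_zeroBlockSet β (Or.inr (by simp [hΛ.zeroBlockSet_eq]))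

theorem integral_blockFun_mul (h0 : 0 ≤ r 0) (α β α' β' : ℝ) :
    ∫ ω, blockFun α β ω * blockFun α' β' ω ∂Λ = α * α' + r 0 * (β * β') := by
  have e : ∀ ω, blockFun α β ω * blockFun α' β' ω =
      blockSet.indicator (fun _ => α * α') ω + zeroBlockSet.indicator (fun _ => β * β') ω := by
    intro ω
    by_cases h : ω ∈ blockSet
    · rw [blockFun_of_mem h, blockFun_of_mem h, Set.indicator_of_mem h,
        Set.indicator_of_notMem (notMem_zeroBlockSet_of_mem h), add_zero]
    · by_cases h' : ω ∈ zeroBlockSet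
      · rw [blockFun_of_mem_zero h', blockFun_of_mem_zero h', Set.indicator_of_mem h',
          Set.indicator_of_notMem h, zero_add]
      · rw [blockFun_of_notMem h h', Set.indicator_of_notMem h, Set.indicator_of_notMem h',
          zero_mul, add_zero]
  simp only [e]
  rw [integral_add, integral_indicator_const _ measurableSet_blockSet,
    integral_indicator_const _ measurableSet_zeroBlockSet, measureReal_def, measureReal_def,
    hΛ.blockSet_eq, hΛ.zeroBlockSet_eq, ENNReal.toReal_ofReal h0]
  · simp
  · exact (integrable_indicator_iff measurableSet_blockSet).2
      (integrableOn_const (by simp [hΛ.blockSet_eq]))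
  · exact (integrable_indicator_iff measurableSet_zeroBlockSet).2
      (integrableOn_const (by simp [hΛ.zeroBlockSet_eq]))

end IsSkeletonMeasure

/-- A tree-like self-similar structure with resistance ratios `r` and the length measure of its
skeleton. -/
structure HataNetwork (K : Type*) [TopologicalSpace K] where
  L : SelfSimilarStructure K 2
  o : K
  e : K
  q : K
  tree : L.IsHataTree o e q
  r : Fin 2 → ℝ
  r_pos : ∀ i, 0 < r i
  r_lt_one : ∀ i, r i < 1
  r_one : r 1 = 1 - r 0 ^ 2
  Λ : Measure (ℕ → Fin 2)
  skeleton : IsSkeletonMeasure r Λ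

namespace HataNetwork

variable {K : Type*} [TopologicalSpace K] (X : HataNetwork K)

/-- The energy of level `m` on the tree, with unit conductance between `o` and `e`. -/
noncomputable def energy : ℕ → (K → ℝ) → (K → ℝ) → ℝ
  | 0, u, v => (u X.e - u X.o) * (v X.e - v X.o) +
      (X.r 0)⁻¹ * ((u X.q - u X.o) * (v X.q - v X.o))
  | m + 1, u, v => (X.r 0)⁻¹ * energy m (fun x => u (X.L.ψ 0 x)) (fun x => v (X.L.ψ 0 x)) +
      (X.r 1)⁻¹ * energy m (fun x => u (X.L.ψ 1 x)) (fun x => v (X.L.ψ 1 x))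

/-- The gradient of level `m` as a function on words: the difference quotients of `u` along the
edges of level `m`. -/
noncomputable def grad : ℕ → (K → ℝ) → (ℕ → Fin 2) → ℝ
  | 0, u, ω => blockFun (u X.e - u X.o) ((X.r 0)⁻¹ * (u X.q - u X.o)) ω
  | m + 1, u, ω => (X.r (ω 0))⁻¹ * grad m (fun x => u (X.L.ψ (ω 0) x)) fun n => ω (n + 1)

theorem grad_succ (m : ℕ) (u : K → ℝ) (i : Fin 2) (ω : ℕ → Fin 2) :
    X.grad (m + 1) u (prependLetter i ω) = (X.r i)⁻¹ * X.grad m (fun x => u (X.L.ψ i x)) ω :=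
  rfl

theorem measurable_grad (m : ℕ) : ∀ u : K → ℝ, Measurable (X.grad m u) := by
  induction m with
  | zero => exact fun u => measurable_blockFun _ _
  | succ m ih =>
    intro u
    have : X.grad (m + 1) u = fun ω => if ω 0 = 0
        then (X.r 0)⁻¹ * X.grad m (fun x => u (X.L.ψ 0 x)) (fun n => ω (n + 1))
        else (X.r 1)⁻¹ * X.grad m (fun x => u (X.L.ψ 1 x)) (fun n => ω (n + 1)) := by
      funext ω
      rw [grad]
      rcases SelfSimilarStructure.IsHataTree.fin_two (ω 0) with h | h <;> simp [h]
    rw [this]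
    exact Measurable.ite (measurable_pi_apply 0 (measurableSet_singleton 0))
      (((ih _).comp measurable_shift).const_mul _) (((ih _).comp measurable_shift).const_mul _)

theorem memLp_grad (m : ℕ) : ∀ u : K → ℝ, MemLp (X.grad m u) 2 X.Λ := by
  induction m with
  | zero => exact fun u => X.skeleton.memLp_blockFun _ _
  | succ m ih =>
    intro u
    rw [X.skeleton.memLp_iff (X.r_pos 0) (X.r_pos 1) (X.measurable_grad _ u)]
    intro i
    simp only [grad_succ]
    exact (ih _).const_mul _

/-- The fundamental theorem of calculus along the arcs `oe` and `oq`: the induction splits `oe` at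
`ψ_0(q) = ψ_1(o)`, where the increments telescope. -/
theorem integral_blockFun_mul_grad (n : ℕ) : ∀ (α β : ℝ) (v : K → ℝ),
    ∫ ω, blockFun α β ω * X.grad n v ω ∂X.Λ = α * (v X.e - v X.o) + β * (v X.q - v X.o) := by
  induction n with
  | zero =>
    intro α β v
    simp only [grad]
    rw [X.skeleton.integral_blockFun_mul (X.r_pos 0).le]
    have := (X.r_pos 0).ne'
    field_simp
  | succ n ih =>
    intro α β v
    rw [X.skeleton.integral_eq (F := fun ω => _ * _) (X.r_pos 0) (X.r_pos 1)
      ((measurable_blockFun α β).mul (X.measurable_grad _ v))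
      ((X.skeleton.memLp_blockFun α β).integrable_mul_two (X.memLp_grad _ v))]
    simp only [grad_succ, blockFun_zero, blockFun_one]
    have e : ∀ (i : Fin 2) (a b : ℝ), X.r i * ∫ ω, blockFun a b ω *
        ((X.r i)⁻¹ * X.grad n (fun x => v (X.L.ψ i x)) ω) ∂X.Λ =
        ∫ ω, blockFun a b ω * X.grad n (fun x => v (X.L.ψ i x)) ω ∂X.Λ := by
      intro i a b
      rw [← integral_const_mul]
      congr 1
      funext ω
      have := (X.r_pos i).ne'
      field_simp
    rw [e, e, ih, ih, X.tree.zero_e, X.tree.zero_o, X.tree.zero_q, X.tree.one_e]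
    ring

/-- A gradient of level `m` is constant on each edge of that level, and integrating a finer gradient
over such an edge gives the increment of `v`. The right side does not depend on `n`, so `grad m v`
is the orthogonal projection of `grad n v` to the gradients of level `m`. -/
theorem integral_grad_mul_grad (m : ℕ) : ∀ (n : ℕ), m ≤ n → ∀ u v : K → ℝ,
    ∫ ω, X.grad m u ω * X.grad n v ω ∂X.Λ = X.energy m u v := by
  induction m with
  | zero =>
    intro n _ u v
    simp only [grad]
    rw [X.integral_blockFun_mul_grad, energy]
    ring
  | succ m ih =>
    intro n hn u v
    obtain ⟨n, rfl⟩ := Nat.exists_eq_add_of_le' (Nat.one_le_of_lt hn)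
    rw [X.skeleton.integral_eq (F := fun ω => _ * _) (X.r_pos 0) (X.r_pos 1)
      ((X.measurable_grad _ u).mul (X.measurable_grad _ v))
      ((X.memLp_grad _ u).integrable_mul_two (X.memLp_grad _ v))]
    simp only [grad_succ]
    have e : ∀ (i : Fin 2), X.r i * ∫ ω, ((X.r i)⁻¹ * X.grad m (fun x => u (X.L.ψ i x)) ω) *
        ((X.r i)⁻¹ * X.grad n (fun x => v (X.L.ψ i x)) ω) ∂X.Λ =
        (X.r i)⁻¹ * X.energy m (fun x => u (X.L.ψ i x)) (fun x => v (X.L.ψ i x)) := by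
      intro i
      rw [← ih n (by omega), ← integral_const_mul, ← integral_const_mul]
      congr 1
      funext ω
      have := (X.r_pos i).ne'
      field_simp
    rw [e, e, energy]

end HataNetwork

/-! ### Monotone energies and gradients as limits in L² -/

namespace HataNetwork

variable {K : Type*} [TopologicalSpace K] (X : HataNetwork K)

theorem grad_add (m : ℕ) : ∀ (u v : K → ℝ) (ω : ℕ → Fin 2),
    X.grad m (fun x => u x + v x) ω = X.grad m u ω + X.grad m v ω := by
  induction m with
  | zero =>
    intro u v ω
    simp only [grad, blockFun, Set.indicator]
    split_ifs <;> ring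
  | succ m ih =>
    intro u v ω
    simp only [grad]
    rw [ih, mul_add]

theorem grad_const_mul (m : ℕ) : ∀ (a : ℝ) (u : K → ℝ) (ω : ℕ → Fin 2),
    X.grad m (fun x => a * u x) ω = a * X.grad m u ω := by
  induction m with
  | zero =>
    intro a u ω
    simp only [grad, blockFun, Set.indicator]
    split_ifs <;> ring
  | succ m ih =>
    intro a u ω
    simp only [grad]
    rw [ih]
    ring

theorem grad_const (m : ℕ) (a : ℝ) (ω : ℕ → Fin 2) : X.grad m (fun _ => a) ω = 0 := by
  induction m generalizing ω with
  | zero => simp [grad, blockFun]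
  | succ m ih => simp only [grad, ih, mul_zero]

theorem energy_self (m : ℕ) (u : K → ℝ) : X.energy m u u = ∫ ω, X.grad m u ω ^ 2 ∂X.Λ := by
  rw [← X.integral_grad_mul_grad m m le_rfl]
  simp only [sq]

theorem energy_nonneg (m : ℕ) (u : K → ℝ) : 0 ≤ X.energy m u u := by
  rw [energy_self]
  exact integral_nonneg fun ω => sq_nonneg _

/-- Pythagoras for the projection. It gives both the monotonicity of the energies and, when they
converge, the Cauchy property of the gradients. -/
theorem integral_grad_sub_sq {m n : ℕ} (h : m ≤ n) (u : K → ℝ) :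
    ∫ ω, (X.grad n u ω - X.grad m u ω) ^ 2 ∂X.Λ = X.energy n u u - X.energy m u u := by
  have e : ∀ ω, (X.grad n u ω - X.grad m u ω) ^ 2 = X.grad n u ω * X.grad n u ω -
      2 * (X.grad m u ω * X.grad n u ω) + X.grad m u ω * X.grad m u ω := fun ω => by ring
  have i1 := (X.memLp_grad n u).integrable_mul_two (X.memLp_grad n u)
  have i2 := ((X.memLp_grad m u).integrable_mul_two (X.memLp_grad n u)).const_mul 2
  have i3 := (X.memLp_grad m u).integrable_mul_two (X.memLp_grad m u)
  have i12 : Integrable (fun ω => X.grad n u ω * X.grad n u ω -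
    2 * (X.grad m u ω * X.grad n u ω)) X.Λ := i1.sub i2
  simp only [e]
  rw [integral_add i12 i3, integral_sub i1 i2, integral_const_mul,
    X.integral_grad_mul_grad n n le_rfl, X.integral_grad_mul_grad m n h,
    X.integral_grad_mul_grad m m le_rfl]
  ring

theorem energy_mono (u : K → ℝ) : Monotone fun m => X.energy m u u := by
  intro m n h
  have := X.integral_grad_sub_sq h u
  have h0 : 0 ≤ ∫ ω, (X.grad n u ω - X.grad m u ω) ^ 2 ∂X.Λ := integral_nonneg fun ω => sq_nonneg _
  simp only
  linarith

/-- The energies `𝓔⁽ᵐ⁾(u, u)` converge. -/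
def FiniteEnergy (u : K → ℝ) : Prop := ∃ a : ℝ, Tendsto (fun m => X.energy m u u) atTop (𝓝 a)

variable {X}

theorem finiteEnergy_of_le {u : K → ℝ} {C : ℝ} (h : ∀ m, X.energy m u u ≤ C) :
    X.FiniteEnergy u :=
  ⟨_, tendsto_atTop_ciSup (X.energy_mono u) ⟨C, by rintro _ ⟨m, rfl⟩; exact h m⟩⟩

variable (X)

/-- `g` is the limit in `L²` of the gradients of `u`. -/
def HasGrad (u : K → ℝ) (g : (ℕ → Fin 2) → ℝ) : Prop :=
  Measurable g ∧ MemLp g 2 X.Λ ∧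
    Tendsto (fun m => ∫ ω, (X.grad m u ω - g ω) ^ 2 ∂X.Λ) atTop (𝓝 0)

variable {X}

theorem FiniteEnergy.exists_hasGrad {u : K → ℝ} (h : X.FiniteEnergy u) : ∃ g, X.HasGrad u g := by
  obtain ⟨a, ha⟩ := h
  have hc : CauchySeq fun m => (X.memLp_grad m u).toLp (X.grad m u) := by
    refine Metric.cauchySeq_iff'.2 fun ε hε => ?_
    obtain ⟨N, hN⟩ := Metric.cauchySeq_iff'.1 ha.cauchySeq (ε ^ 2) (pow_pos hε 2)
    refine ⟨N, fun n hn => ?_⟩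
    have h1 := hN n hn
    rw [Real.dist_eq, ← X.integral_grad_sub_sq hn] at h1
    have h2 := (le_abs_self _).trans_lt h1
    have h3 : ∫ ω, (X.grad n u ω - X.grad N u ω) ^ 2 ∂X.Λ =
        ‖(X.memLp_grad n u).toLp (X.grad n u) - (X.memLp_grad N u).toLp (X.grad N u)‖ ^ 2 := by
      rw [← MemLp.toLp_sub, MemLp.norm_toLp_sq]
      rfl
    rw [h3] at h2
    rw [dist_eq_norm]
    exact lt_of_pow_lt_pow_left₀ 2 hε.le h2
  obtain ⟨G, hG⟩ := cauchySeq_tendsto_of_complete hc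
  have hGm := (Lp.memLp G).1
  have hmk : MemLp (hGm.mk G) 2 X.Λ := (memLp_congr_ae hGm.ae_eq_mk).1 (Lp.memLp G)
  refine ⟨hGm.mk G, hGm.stronglyMeasurable_mk.measurable, hmk, ?_⟩
  rw [← tendsto_toLp_iff (fun m => X.memLp_grad m u) hmk]
  convert hG using 2
  refine Lp.ext ?_
  filter_upwards [hmk.coeFn_toLp, hGm.ae_eq_mk] with ω h1 h2
  rw [h1, ← h2]

namespace HasGrad

variable {u v : K → ℝ} {g h : (ℕ → Fin 2) → ℝ}

theorem tendsto_energy (hu : X.HasGrad u g) (hv : X.HasGrad v h) :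
    Tendsto (fun m => X.energy m u v) atTop (𝓝 (∫ ω, g ω * h ω ∂X.Λ)) := by
  have := tendsto_integral_mul (fun m => X.memLp_grad m u) hu.2.1 (fun m => X.memLp_grad m v)
    hv.2.1 hu.2.2 hv.2.2
  simpa only [X.integral_grad_mul_grad _ _ le_rfl] using this

theorem finiteEnergy (hu : X.HasGrad u g) : X.FiniteEnergy u := ⟨_, hu.tendsto_energy hu⟩

theorem energy_le (hu : X.HasGrad u g) (m : ℕ) : X.energy m u u ≤ ∫ ω, g ω ^ 2 ∂X.Λ := by
  have := (X.energy_mono u).ge_of_tendsto (hu.tendsto_energy hu) m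
  simpa only [sq] using this

theorem integrable_sub_sq (hu : X.HasGrad u g) (m : ℕ) :
    Integrable (fun ω => (X.grad m u ω - g ω) ^ 2) X.Λ :=
  ((X.memLp_grad m u).sub hu.2.1).integrable_sq

theorem add (hu : X.HasGrad u g) (hv : X.HasGrad v h) :
    X.HasGrad (fun x => u x + v x) fun ω => g ω + h ω := by
  refine ⟨hu.1.add hv.1, hu.2.1.add hv.2.1, ?_⟩
  refine squeeze_zero (g := fun m => 2 * ∫ ω, (X.grad m u ω - g ω) ^ 2 ∂X.Λ +
    2 * ∫ ω, (X.grad m v ω - h ω) ^ 2 ∂X.Λ) (fun m => integral_nonneg fun ω => sq_nonneg _)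
    (fun m => ?_) ?_
  · rw [← integral_const_mul, ← integral_const_mul, ← integral_add
      ((hu.integrable_sub_sq m).const_mul 2) ((hv.integrable_sub_sq m).const_mul 2)]
    refine integral_mono_of_nonneg (ae_of_all _ fun ω => sq_nonneg _)
      (((hu.integrable_sub_sq m).const_mul 2).add ((hv.integrable_sub_sq m).const_mul 2))
      (ae_of_all _ fun ω => ?_)
    simp only [grad_add]
    nlinarith [sq_nonneg ((X.grad m u ω - g ω) - (X.grad m v ω - h ω))]
  · simpa using (hu.2.2.const_mul 2).add (hv.2.2.const_mul 2)

theorem const_mul (hu : X.HasGrad u g) (a : ℝ) :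
    X.HasGrad (fun x => a * u x) fun ω => a * g ω := by
  refine ⟨hu.1.const_mul a, hu.2.1.const_mul a, ?_⟩
  have e : ∀ m, ∫ ω, (X.grad m (fun x => a * u x) ω - a * g ω) ^ 2 ∂X.Λ =
      a ^ 2 * ∫ ω, (X.grad m u ω - g ω) ^ 2 ∂X.Λ := by
    intro m
    rw [← integral_const_mul]
    congr 1
    funext ω
    rw [grad_const_mul]
    ring
  simp only [e]
  simpa using hu.2.2.const_mul (a ^ 2)

theorem const (a : ℝ) : X.HasGrad (fun _ => a) fun _ => 0 := by
  refine ⟨measurable_const, MemLp.zero', ?_⟩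
  simp [grad_const]

/-- The gradient of a function whose restrictions to the two pieces have gradients. -/
theorem glue {u : K → ℝ} {g : Fin 2 → (ℕ → Fin 2) → ℝ}
    (h : ∀ i, X.HasGrad (fun x => u (X.L.ψ i x)) (g i)) :
    X.HasGrad u fun ω => (X.r (ω 0))⁻¹ * g (ω 0) fun n => ω (n + 1) := by
  set G : (ℕ → Fin 2) → ℝ := fun ω => (X.r (ω 0))⁻¹ * g (ω 0) fun n => ω (n + 1) with hG
  have hGi : ∀ i ω, G (prependLetter i ω) = (X.r i)⁻¹ * g i ω := fun i ω => rfl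
  have hm : Measurable G := by
    have : G = fun ω => if ω 0 = 0 then (X.r 0)⁻¹ * g 0 (fun n => ω (n + 1))
        else (X.r 1)⁻¹ * g 1 (fun n => ω (n + 1)) := by
      funext ω
      rw [hG]
      rcases SelfSimilarStructure.IsHataTree.fin_two (ω 0) with h | h <;> simp [h]
    rw [this]
    exact Measurable.ite (measurable_pi_apply 0 (measurableSet_singleton 0))
      (((h 0).1.comp measurable_shift).const_mul _) (((h 1).1.comp measurable_shift).const_mul _)
  have hL : MemLp G 2 X.Λ := by
    rw [X.skeleton.memLp_iff (X.r_pos 0) (X.r_pos 1) hm]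
    intro i
    simp only [hGi]
    exact (h i).2.1.const_mul _
  refine ⟨hm, hL, ?_⟩
  rw [← tendsto_add_atTop_iff_nat 1]
  have e : ∀ m, ∫ ω, (X.grad (m + 1) u ω - G ω) ^ 2 ∂X.Λ =
      (X.r 0)⁻¹ * ∫ ω, (X.grad m (fun x => u (X.L.ψ 0 x)) ω - g 0 ω) ^ 2 ∂X.Λ +
      (X.r 1)⁻¹ * ∫ ω, (X.grad m (fun x => u (X.L.ψ 1 x)) ω - g 1 ω) ^ 2 ∂X.Λ := by
    intro m
    rw [X.skeleton.integral_eq (F := fun ω => (X.grad (m + 1) u ω - G ω) ^ 2) (X.r_pos 0) (X.r_pos 1)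
      (((X.measurable_grad _ u).sub hm).pow_const 2) (((X.memLp_grad _ u).sub hL).integrable_sq)]
    have ei : ∀ i, X.r i * ∫ ω, (X.grad (m + 1) u (prependLetter i ω) -
        G (prependLetter i ω)) ^ 2 ∂X.Λ =
        (X.r i)⁻¹ * ∫ ω, (X.grad m (fun x => u (X.L.ψ i x)) ω - g i ω) ^ 2 ∂X.Λ := by
      intro i
      rw [← integral_const_mul, ← integral_const_mul]
      congr 1
      funext ω
      rw [grad_succ, hGi]
      have := (X.r_pos i).ne'
      field_simp
    simp only [ei]
  simp only [e]
  simpa using ((h 0).2.2.const_mul (X.r 0)⁻¹).add ((h 1).2.2.const_mul (X.r 1)⁻¹)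

end HasGrad

/-! ### Oscillation and the product rule -/

variable (X)

/-- The oscillation of `u` on cells of level `m` is at most `ε`. -/
def OscLE (m : ℕ) (ε : ℝ) (u : K → ℝ) : Prop :=
  ∀ ω ω' : ℕ → Fin 2, (∀ k < m, ω k = ω' k) → |u (X.L.π ω) - u (X.L.π ω')| ≤ ε

variable {X}

theorem OscLE.mono {m n : ℕ} {ε : ℝ} {u : K → ℝ} (h : X.OscLE m ε u) (hmn : m ≤ n) :
    X.OscLE n ε u :=
  fun ω ω' hω => h ω ω' fun k hk => hω k (hk.trans_le hmn)

theorem OscLE.comp {m : ℕ} {ε : ℝ} {u : K → ℝ} (h : X.OscLE (m + 1) ε u) (i : Fin 2) :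
    X.OscLE m ε fun x => u (X.L.ψ i x) := by
  intro ω ω' hω
  simp only [X.L.ψ_π]
  refine h _ _ fun k hk => ?_
  cases k with
  | zero => rfl
  | succ k => exact hω k (by omega)

/-- Uniform continuity of `u ∘ π` on the compact space of words, for the metric in which words
agreeing up to `m` have distance at most `2⁻ᵐ`. -/
theorem exists_oscLE {u : K → ℝ} (hu : Continuous u) {ε : ℝ} (hε : 0 < ε) : ∃ m, X.OscLE m ε u := by
  let : MetricSpace (ℕ → Fin 2) := PiNat.metricSpace
  have hc : Continuous fun ω : ℕ → Fin 2 => u (X.L.π ω) := hu.comp X.L.continuous_π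
  have huc := CompactSpace.uniformContinuous_of_continuous hc
  obtain ⟨δ, hδ, h⟩ := Metric.uniformContinuous_iff.1 huc ε hε
  obtain ⟨m, hm⟩ := exists_pow_lt_of_lt_one hδ (one_half_lt_one (α := ℝ))
  refine ⟨m, fun ω ω' hω => ?_⟩
  have : dist ω ω' ≤ (1 / 2) ^ m := PiNat.mem_cylinder_iff_dist_le.1 fun k hk => hω k hk
  exact (h (this.trans_lt hm)).le

/-- Leibniz rule for difference quotients. On one edge the defect consists of increments of one
function times the deviation of the other from its value at `π ω`; this point lies in the same cell,
so the deviation is at most `ε`. Both sides scale alike under a letter. -/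
theorem grad_mul_sub_le (m : ℕ) : ∀ {ε : ℝ} {u v : K → ℝ}, X.OscLE m ε u → X.OscLE m ε v →
    ∀ ω, |X.grad m (fun x => u x * v x) ω -
      (u (X.L.π ω) * X.grad m v ω + v (X.L.π ω) * X.grad m u ω)| ≤
      ε * (|X.grad m u ω| + |X.grad m v ω|) := by
  induction m with
  | zero =>
    intro ε u v hu hv ω
    have hx : ∀ (w : K → ℝ), X.OscLE 0 ε w → ∀ y, |w y - w (X.L.π ω)| ≤ ε := by
      intro w hw y
      obtain ⟨ω', rfl⟩ := X.L.surjective_π y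
      exact hw ω' ω fun k hk => absurd hk (Nat.not_lt_zero k)
    have key : ∀ y z : K, |u y * v y - u z * v z -
        (u (X.L.π ω) * (v y - v z) + v (X.L.π ω) * (u y - u z))| ≤
        ε * (|u y - u z| + |v y - v z|) := by
      intro y z
      have e : u y * v y - u z * v z - (u (X.L.π ω) * (v y - v z) + v (X.L.π ω) * (u y - u z)) =
        (v z - v (X.L.π ω)) * (u y - u z) + (u y - u (X.L.π ω)) * (v y - v z) := by ring
      rw [e]
      refine (abs_add_le _ _).trans ?_
      rw [abs_mul, abs_mul, mul_add]
      exact add_le_add (mul_le_mul_of_nonneg_right (hx v hv z) (abs_nonneg _))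
        (mul_le_mul_of_nonneg_right (hx u hu y) (abs_nonneg _))
    simp only [grad]
    by_cases h : ω ∈ blockSet
    · simp only [blockFun_of_mem h]
      exact key _ _
    · by_cases h' : ω ∈ zeroBlockSet
      · simp only [blockFun_of_mem_zero h']
        have hr := inv_pos.2 (X.r_pos 0)
        have e : (X.r 0)⁻¹ * (u X.q * v X.q - u X.o * v X.o) -
            (u (X.L.π ω) * ((X.r 0)⁻¹ * (v X.q - v X.o)) +
              v (X.L.π ω) * ((X.r 0)⁻¹ * (u X.q - u X.o))) =
            (X.r 0)⁻¹ * (u X.q * v X.q - u X.o * v X.o -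
            (u (X.L.π ω) * (v X.q - v X.o) + v (X.L.π ω) * (u X.q - u X.o))) := by ring
        rw [e, abs_mul, abs_mul, abs_mul, abs_of_pos hr, ← mul_add, mul_left_comm]
        exact mul_le_mul_of_nonneg_left (key _ _) hr.le
      · simp [blockFun_of_notMem h h']
  | succ m ih =>
    intro ε u v hu hv ω
    have h := ih (hu.comp (ω 0)) (hv.comp (ω 0)) fun n => ω (n + 1)
    have hr := inv_pos.2 (X.r_pos (ω 0))
    rw [← SelfSimilarStructure.IsHataTree.π_cons] at h
    simp only [grad]
    generalize X.grad m _ _ = A at *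
    generalize X.grad m _ _ = B at *
    generalize X.grad m _ _ = C at *
    have e : (X.r (ω 0))⁻¹ * A - (u (X.L.π ω) * ((X.r (ω 0))⁻¹ * B) +
        v (X.L.π ω) * ((X.r (ω 0))⁻¹ * C)) =
        (X.r (ω 0))⁻¹ * (A - (u (X.L.π ω) * B + v (X.L.π ω) * C)) := by ring
    rw [e, abs_mul, abs_mul, abs_mul, abs_of_pos hr, ← mul_add, mul_left_comm]
    exact mul_le_mul_of_nonneg_left h hr.le

theorem memLp_mul_of_bound {u : (ℕ → Fin 2) → ℝ} {g : (ℕ → Fin 2) → ℝ} {M : ℝ} (hu : Measurable u)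
    (hM : ∀ ω, |u ω| ≤ M) (hg : MemLp g 2 X.Λ) : MemLp (fun ω => u ω * g ω) 2 X.Λ := by
  refine hg.of_le_mul (c := M) (hu.aestronglyMeasurable.mul hg.1) (ae_of_all _ fun ω => ?_)
  rw [Real.norm_eq_abs, abs_mul, Real.norm_eq_abs]
  exact mul_le_mul_of_nonneg_right (hM ω) (abs_nonneg _)

theorem measurable_comp_π {u : K → ℝ} (hu : Continuous u) :
    Measurable fun ω => u (X.L.π ω) :=
  (hu.comp X.L.continuous_π).measurable

theorem exists_bound {u : K → ℝ} (hu : Continuous u) :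
    ∃ M, 0 ≤ M ∧ ∀ ω, |u (X.L.π ω)| ≤ M := by
  obtain ⟨M, hM⟩ := isCompact_univ.exists_bound_of_continuousOn
    (hu.comp X.L.continuous_π).continuousOn
  exact ⟨max M 0, le_max_right _ _, fun ω => (hM ω (Set.mem_univ _)).trans (le_max_left _ _)⟩

/-- The error splits into the Leibniz defect, small by uniform continuity since the energies stay
bounded, and the two errors `grad m v - h` and `grad m u - g` multiplied by bounded functions. -/
theorem HasGrad.mul {u v : K → ℝ} {g h : (ℕ → Fin 2) → ℝ} (hu : X.HasGrad u g)
    (hv : X.HasGrad v h) (huc : Continuous u) (hvc : Continuous v) :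
    X.HasGrad (fun x => u x * v x) fun ω => u (X.L.π ω) * h ω + v (X.L.π ω) * g ω := by
  obtain ⟨M, hM0, hM⟩ := exists_bound (X := X) huc
  obtain ⟨N, hN0, hN⟩ := exists_bound (X := X) hvc
  have mu := measurable_comp_π (X := X) huc
  have mv := measurable_comp_π (X := X) hvc
  refine ⟨(mu.mul hv.1).add (mv.mul hu.1), (memLp_mul_of_bound mu hM hv.2.1).add
    (memLp_mul_of_bound mv hN hu.2.1), ?_⟩
  set C := ∫ ω, g ω ^ 2 ∂X.Λ + ∫ ω, h ω ^ 2 ∂X.Λ with hC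
  have bound : ∀ (ε : ℝ) (m : ℕ), X.OscLE m ε u → X.OscLE m ε v →
      ∫ ω, (X.grad m (fun x => u x * v x) ω -
        (u (X.L.π ω) * h ω + v (X.L.π ω) * g ω)) ^ 2 ∂X.Λ ≤
      6 * ε ^ 2 * C + 3 * M ^ 2 * ∫ ω, (X.grad m v ω - h ω) ^ 2 ∂X.Λ +
        3 * N ^ 2 * ∫ ω, (X.grad m u ω - g ω) ^ 2 ∂X.Λ := by
    intro ε m h1 h2
    have i1 := (X.memLp_grad m u).integrable_sq.const_mul (6 * ε ^ 2)
    have i2 := (X.memLp_grad m v).integrable_sq.const_mul (6 * ε ^ 2)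
    have i3 := (hv.integrable_sub_sq m).const_mul (3 * M ^ 2)
    have i4 := (hu.integrable_sub_sq m).const_mul (3 * N ^ 2)
    have e1 : 6 * ε ^ 2 * ∫ ω, X.grad m u ω ^ 2 ∂X.Λ + 6 * ε ^ 2 * ∫ ω, X.grad m v ω ^ 2 ∂X.Λ ≤
        6 * ε ^ 2 * C := by
      rw [← X.energy_self, ← X.energy_self, ← mul_add]
      exact mul_le_mul_of_nonneg_left (add_le_add (hu.energy_le m) (hv.energy_le m)) (by positivity)
    have i12 : Integrable (fun ω => 6 * ε ^ 2 * X.grad m u ω ^ 2 + 6 * ε ^ 2 * X.grad m v ω ^ 2)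
      X.Λ := i1.add i2
    have i123 : Integrable (fun ω => 6 * ε ^ 2 * X.grad m u ω ^ 2 + 6 * ε ^ 2 * X.grad m v ω ^ 2 +
      3 * M ^ 2 * (X.grad m v ω - h ω) ^ 2) X.Λ := i12.add i3
    refine le_trans ?_ (add_le_add_left (add_le_add_left e1 _) _)
    rw [← integral_const_mul, ← integral_const_mul, ← integral_const_mul, ← integral_const_mul,
      ← integral_add i1 i2, ← integral_add i12 i3, ← integral_add i123 i4]
    refine integral_mono_of_nonneg (ae_of_all _ fun ω => sq_nonneg _) (i123.add i4)
      (ae_of_all _ fun ω => ?_)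
    have h3 := grad_mul_sub_le m h1 h2 ω
    simp only
    generalize X.grad m (fun x => u x * v x) ω = A at *
    generalize X.grad m u ω = U at *
    generalize X.grad m v ω = V at *
    have hMu : u (X.L.π ω) ^ 2 ≤ M ^ 2 := sq_le_sq' (abs_le.1 (hM ω)).1 (abs_le.1 (hM ω)).2
    have hNv : v (X.L.π ω) ^ 2 ≤ N ^ 2 := sq_le_sq' (abs_le.1 (hN ω)).1 (abs_le.1 (hN ω)).2
    generalize u (X.L.π ω) = a at *
    generalize v (X.L.π ω) = b at *
    have s1 : (A - (a * V + b * U)) ^ 2 ≤ 2 * ε ^ 2 * (U ^ 2 + V ^ 2) := by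
      have : (A - (a * V + b * U)) ^ 2 ≤ (ε * (|U| + |V|)) ^ 2 := by
        rw [← sq_abs (A - _)]
        exact pow_le_pow_left₀ (abs_nonneg _) h3 2
      refine this.trans ?_
      have h4 : (|U| + |V|) ^ 2 ≤ 2 * (U ^ 2 + V ^ 2) := by
        nlinarith [sq_nonneg (|U| - |V|), sq_abs U, sq_abs V]
      rw [mul_pow]
      nlinarith [mul_le_mul_of_nonneg_left h4 (sq_nonneg ε)]
    have s2 : a ^ 2 * (V - h ω) ^ 2 ≤ M ^ 2 * (V - h ω) ^ 2 :=
      mul_le_mul_of_nonneg_right hMu (sq_nonneg _)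
    have s3 : b ^ 2 * (U - g ω) ^ 2 ≤ N ^ 2 * (U - g ω) ^ 2 :=
      mul_le_mul_of_nonneg_right hNv (sq_nonneg _)
    have s4 : ∀ x y z : ℝ, (x + y + z) ^ 2 ≤ 3 * (x ^ 2 + y ^ 2 + z ^ 2) := fun x y z => by
      nlinarith [sq_nonneg (x - y), sq_nonneg (y - z), sq_nonneg (x - z)]
    have s5 := s4 (A - (a * V + b * U)) (a * (V - h ω)) (b * (U - g ω))
    have e2 : A - (a * V + b * U) + a * (V - h ω) + b * (U - g ω) = A - (a * h ω + b * g ω) := by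
      ring
    rw [e2] at s5
    nlinarith
  have hC0 : 0 ≤ C := add_nonneg (integral_nonneg fun ω => sq_nonneg _)
    (integral_nonneg fun ω => sq_nonneg _)
  have lim : Tendsto (fun m => 3 * M ^ 2 * ∫ ω, (X.grad m v ω - h ω) ^ 2 ∂X.Λ +
      3 * N ^ 2 * ∫ ω, (X.grad m u ω - g ω) ^ 2 ∂X.Λ) atTop (𝓝 0) := by
    simpa using (hv.2.2.const_mul (3 * M ^ 2)).add (hu.2.2.const_mul (3 * N ^ 2))
  rw [Metric.tendsto_atTop]
  intro δ hδ
  -- Any constant above `12` in place of `13` would do; `C + 1` avoids dividing by zero.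
  obtain ⟨ε, hε, hεδ⟩ : ∃ ε : ℝ, 0 < ε ∧ 6 * ε ^ 2 * C < δ / 2 := by
    refine ⟨Real.sqrt (δ / (13 * (C + 1))), by positivity, ?_⟩
    rw [Real.sq_sqrt (by positivity)]
    have : 6 * (δ / (13 * (C + 1))) * C = δ / 2 * (12 * C / (13 * (C + 1))) := by
      field_simp
      ring
    rw [this]
    have h1 : 12 * C / (13 * (C + 1)) < 1 := by
      rw [div_lt_one (by positivity)]
      linarith
    nlinarith
  obtain ⟨m1, h1⟩ := exists_oscLE (X := X) huc hε
  obtain ⟨m2, h2⟩ := exists_oscLE (X := X) hvc hε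
  obtain ⟨m3, h3⟩ := Metric.tendsto_atTop.1 lim (δ / 2) (half_pos hδ)
  refine ⟨max m1 (max m2 m3), fun m hm => ?_⟩
  have b := bound ε m (h1.mono ((le_max_left _ _).trans hm))
    (h2.mono (((le_max_left _ _).trans (le_max_right _ _)).trans hm))
  have l := h3 m (((le_max_right _ _).trans (le_max_right _ _)).trans hm)
  rw [Real.dist_eq, sub_zero] at l ⊢
  rw [abs_of_nonneg (integral_nonneg fun ω => sq_nonneg _)]
  have := (le_abs_self _).trans_lt l
  linarith

end HataNetwork

namespace HataNetwork

/-! ### The resistance estimate and the Markov property -/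

section Estimates

variable {K : Type*} [TopologicalSpace K] {X : HataNetwork K}

theorem energy_comp_le {m : ℕ} {u : K → ℝ} (i : Fin 2) :
    X.energy m (fun x => u (X.L.ψ i x)) (fun x => u (X.L.ψ i x)) ≤
      X.r i * X.energy (m + 1) u u := by
  have h0 := X.energy_nonneg m fun x => u (X.L.ψ 0 x)
  have h1 := X.energy_nonneg m fun x => u (X.L.ψ 1 x)
  have r0 := X.r_pos 0
  have r1 := X.r_pos 1
  rw [← inv_mul_le_iff₀ (X.r_pos i), energy]
  have k0 := mul_nonneg (inv_pos.2 r0).le h0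
  have k1 := mul_nonneg (inv_pos.2 r1).le h1
  rcases SelfSimilarStructure.IsHataTree.fin_two i with rfl | rfl <;> linarith

theorem sq_sub_q_le (u : K → ℝ) : (u X.q - u X.o) ^ 2 ≤ X.r 0 * X.energy 0 u u := by
  rw [← inv_mul_le_iff₀ (X.r_pos 0), energy, ← sq, ← sq]
  nlinarith [sq_nonneg (u X.e - u X.o)]

/-- Chaining along the code. Passing from `o` to `ψ_i(o)` costs at most `s`, and inside the cell the
energy is smaller by the factor `θ ^ 2`, so the costs form a geometric series; `ε` accounts for the
last cell. -/
theorem abs_sub_le_of_oscLE {θ : ℝ} (h0 : 0 ≤ θ) (h1 : θ < 1) (hr : ∀ i, X.r i ≤ θ ^ 2) (n : ℕ) :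
    ∀ {u : K → ℝ} {ε s : ℝ}, 0 ≤ s → X.OscLE n ε u → (∀ m, X.energy m u u ≤ s ^ 2) →
      ∀ ω, |u (X.L.π ω) - u X.o| ≤ ε + (1 - θ)⁻¹ * s := by
  induction n with
  | zero =>
    intro u ε s hs hu _ ω
    have h := hu ω (fun _ => 0) fun k hk => absurd hk (Nat.not_lt_zero k)
    rw [X.tree.π_zero] at h
    have : 0 ≤ (1 - θ)⁻¹ * s := mul_nonneg (inv_nonneg.2 (by linarith)) hs
    linarith
  | succ n ih =>
    intro u ε s hs hu hE ω
    have hv : ∀ i m, X.energy m (fun x => u (X.L.ψ i x)) (fun x => u (X.L.ψ i x)) ≤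
        (θ * s) ^ 2 := by
      intro i m
      calc _ ≤ X.r i * X.energy (m + 1) u u := energy_comp_le i
        _ ≤ θ ^ 2 * s ^ 2 := mul_le_mul (hr i) (hE _) (X.energy_nonneg _ _) (sq_nonneg θ)
        _ = _ := by ring
    have h2 := ih (mul_nonneg h0 hs) (hu.comp (ω 0)) (hv (ω 0)) fun n => ω (n + 1)
    rw [← SelfSimilarStructure.IsHataTree.π_cons] at h2
    have h3 : |u (X.L.ψ (ω 0) X.o) - u X.o| ≤ s := by
      rcases SelfSimilarStructure.IsHataTree.fin_two (ω 0) with h | h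
      · rw [h, X.tree.zero_o, sub_self, abs_zero]
        exact hs
      · rw [h, ← X.tree.zero_q]
        refine abs_le_of_sq_le_sq ?_ hs
        have := sq_sub_q_le (X := X) fun x => u (X.L.ψ 0 x)
        simp only [X.tree.zero_o] at this
        have h4 := hv 0 0
        have h5 := X.energy_nonneg 0 fun x => u (X.L.ψ 0 x)
        have h6 : X.r 0 ≤ 1 := (X.r_lt_one 0).le
        have h7 : (θ * s) ^ 2 ≤ s ^ 2 := by
          rw [mul_pow]
          have : θ ^ 2 ≤ 1 := pow_le_one₀ h0 h1.le
          nlinarith [sq_nonneg s]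
        nlinarith
    have h4 : (1 - θ)⁻¹ * s = (1 - θ)⁻¹ * (θ * s) + s := by
      have : 1 - θ ≠ 0 := by linarith
      field_simp
      ring
    have h5 := abs_add_le (u (X.L.π ω) - u (X.L.ψ (ω 0) X.o)) (u (X.L.ψ (ω 0) X.o) - u X.o)
    rw [sub_add_sub_cancel] at h5
    linarith

variable (X) in
/-- The oscillation of a continuous function is controlled by its energy. -/
theorem exists_resistance_bound : ∃ C : ℝ, 0 < C ∧ ∀ u : K → ℝ, Continuous u → ∀ s : ℝ, 0 ≤ s →
    (∀ m, X.energy m u u ≤ s ^ 2) → ∀ x, |u x - u X.o| ≤ C * s := by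
  set θ := Real.sqrt (max (X.r 0) (X.r 1)) with hθ
  have hmax : 0 < max (X.r 0) (X.r 1) := lt_max_of_lt_left (X.r_pos 0)
  have h1 : θ < 1 := by
    rw [hθ, Real.sqrt_lt' one_pos, one_pow]
    exact max_lt (X.r_lt_one 0) (X.r_lt_one 1)
  have hr : ∀ i, X.r i ≤ θ ^ 2 := by
    intro i
    rw [hθ, Real.sq_sqrt hmax.le]
    rcases SelfSimilarStructure.IsHataTree.fin_two i with rfl | rfl
    · exact le_max_left _ _
    · exact le_max_right _ _
  refine ⟨(1 - θ)⁻¹, inv_pos.2 (by linarith), fun u hu s hs hE x => ?_⟩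
  refine le_of_forall_pos_le_add fun ε hε => ?_
  obtain ⟨n, hn⟩ := exists_oscLE (X := X) hu hε
  obtain ⟨ω, rfl⟩ := X.L.surjective_π x
  rw [add_comm]
  exact abs_sub_le_of_oscLE (Real.sqrt_nonneg _) h1 hr n hs hn hE ω

theorem energy_comp_lipschitz {φ : ℝ → ℝ} (hφ : ∀ x y, |φ x - φ y| ≤ |x - y|) (m : ℕ) :
    ∀ u : K → ℝ, X.energy m (fun x => φ (u x)) (fun x => φ (u x)) ≤ X.energy m u u := by
  have hsq : ∀ x y, (φ x - φ y) * (φ x - φ y) ≤ (x - y) * (x - y) := by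
    intro x y
    rw [← sq, ← sq, ← sq_abs, ← sq_abs (x - y)]
    exact pow_le_pow_left₀ (abs_nonneg _) (hφ x y) 2
  have r0 := inv_pos.2 (X.r_pos 0)
  have r1 := inv_pos.2 (X.r_pos 1)
  induction m with
  | zero =>
    intro u
    exact add_le_add (hsq _ _) (mul_le_mul_of_nonneg_left (hsq _ _) r0.le)
  | succ m ih =>
    intro u
    exact add_le_add (mul_le_mul_of_nonneg_left (ih _) r0.le)
      (mul_le_mul_of_nonneg_left (ih _) r1.le)

theorem continuous_energy_apply (m : ℕ) {ι : Type*} {l : Filter ι} : ∀ {f : ι → K → ℝ} {u : K → ℝ},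
    (∀ x, Tendsto (fun i => f i x) l (𝓝 (u x))) →
      Tendsto (fun i => X.energy m (f i) (f i)) l (𝓝 (X.energy m u u)) := by
  induction m with
  | zero =>
    intro f u h
    exact ((((h X.e).sub (h X.o)).mul ((h X.e).sub (h X.o))).add
      ((((h X.q).sub (h X.o)).mul ((h X.q).sub (h X.o))).const_mul _))
  | succ m ih =>
    intro f u h
    exact ((ih fun x => h (X.L.ψ 0 x)).const_mul _).add ((ih fun x => h (X.L.ψ 1 x)).const_mul _)

theorem hasGrad_of_forall {u : K → ℝ} {α β : ℝ} (h : ∀ m ω, X.grad m u ω = blockFun α β ω) :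
    X.HasGrad u (blockFun α β) := by
  refine ⟨measurable_blockFun α β, X.skeleton.memLp_blockFun α β, ?_⟩
  simp [h]

theorem FiniteEnergy.add {u v : K → ℝ} (hu : X.FiniteEnergy u) (hv : X.FiniteEnergy v) :
    X.FiniteEnergy fun x => u x + v x := by
  obtain ⟨g, hg⟩ := hu.exists_hasGrad
  obtain ⟨h, hh⟩ := hv.exists_hasGrad
  exact (hg.add hh).finiteEnergy

theorem FiniteEnergy.const_mul {u : K → ℝ} (hu : X.FiniteEnergy u) (a : ℝ) :
    X.FiniteEnergy fun x => a * u x := by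
  obtain ⟨g, hg⟩ := hu.exists_hasGrad
  exact (hg.const_mul a).finiteEnergy

theorem finiteEnergy_const (a : ℝ) : X.FiniteEnergy fun _ : K => a :=
  (HasGrad.const a).finiteEnergy

theorem finiteEnergy_glue {u : K → ℝ} (h : ∀ i, X.FiniteEnergy fun x => u (X.L.ψ i x)) :
    X.FiniteEnergy u := by
  choose g hg using fun i => (h i).exists_hasGrad
  exact (HasGrad.glue hg).finiteEnergy

end Estimates

/-! ### Gluing and harmonic functions -/

section Functions

variable {K : Type*} [TopologicalSpace K] [T2Space K] {X : HataNetwork K}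

/-- A continuous surjection from a compact space to a Hausdorff space is a quotient map. -/
theorem exists_lift (U : C(ℕ → Fin 2, ℝ)) (h : ∀ ω ω', X.L.π ω = X.L.π ω' → U ω = U ω') :
    ∃ u : C(K, ℝ), ∀ ω, u (X.L.π ω) = U ω := by
  have hq : IsQuotientMap (⟨X.L.π, X.L.continuous_π⟩ : C(ℕ → Fin 2, K)) :=
    X.L.continuous_π.isClosedMap.isQuotientMap X.L.continuous_π X.L.surjective_π
  refine ⟨hq.lift U fun ω ω' hω => h ω ω' hω, fun ω => ?_⟩
  exact congrFun (congrArg DFunLike.coe (hq.lift_comp U fun ω ω' hω => h ω ω' hω)) ω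

theorem exists_glue (u : Fin 2 → C(K, ℝ)) (h : u 0 X.q = u 1 X.o) :
    ∃ v : C(K, ℝ), ∀ i x, v (X.L.ψ i x) = u i x := by
  let U : C(ℕ → Fin 2, ℝ) :=
    ⟨fun ω => u (ω 0) (X.L.π fun n => ω (n + 1)), by
      have hc : Continuous fun p : Fin 2 × K => u p.1 p.2 :=
        continuous_prod_of_discrete_left.2 fun i => (u i).continuous
      have hπ : Continuous fun ω : ℕ → Fin 2 => X.L.π fun n => ω (n + 1) :=
        X.L.continuous_π.comp (by fun_prop)
      exact hc.comp (f := fun ω : ℕ → Fin 2 => (ω 0, X.L.π fun n => ω (n + 1)))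
        ((continuous_apply 0).prodMk hπ)⟩
  have key : ∀ ω ω', ω 0 = 0 → ω' 0 = 1 → X.L.π ω = X.L.π ω' → U ω = U ω' := by
    intro ω ω' h0 h1 hω
    rw [SelfSimilarStructure.IsHataTree.π_cons, SelfSimilarStructure.IsHataTree.π_cons X.L ω', h0,
      h1] at hω
    obtain ⟨e1, e2⟩ := X.tree.inter _ _ hω
    change u (ω 0) _ = u (ω' 0) _
    rw [h0, h1, e1, e2, h]
  obtain ⟨v, hv⟩ := exists_lift (X := X) U (by
    intro ω ω' hω
    rcases SelfSimilarStructure.IsHataTree.fin_two (ω 0) with h0 | h0 <;>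
      rcases SelfSimilarStructure.IsHataTree.fin_two (ω' 0) with h1 | h1
    · rw [SelfSimilarStructure.IsHataTree.π_cons, SelfSimilarStructure.IsHataTree.π_cons X.L ω', h0,
        h1] at hω
      change u (ω 0) _ = u (ω' 0) _
      rw [h0, h1, X.L.injective_ψ 0 hω]
    · exact key ω ω' h0 h1 hω
    · exact (key ω' ω h1 h0 hω.symm).symm
    · rw [SelfSimilarStructure.IsHataTree.π_cons, SelfSimilarStructure.IsHataTree.π_cons X.L ω', h0,
        h1] at hω
      change u (ω 0) _ = u (ω' 0) _
      rw [h0, h1, X.L.injective_ψ 1 hω])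
  refine ⟨v, fun i x => ?_⟩
  obtain ⟨ω, rfl⟩ := X.L.surjective_π x
  rw [X.L.ψ_π, hv]
  rfl

/-- The operator on `C(Σ)` whose fixed point is the arc-length coordinate of the projection to the
arc from `o` to `e`. -/
noncomputable def arcOperator (ρ : ℝ) (f : C(ℕ → Fin 2, ℝ)) : C(ℕ → Fin 2, ℝ) where
  toFun ω := (1 - ((ω 0 : ℕ) : ℝ)) * ((1 - ((ω 1 : ℕ) : ℝ)) * (ρ * f fun n => ω (n + 2))) +
    ((ω 0 : ℕ) : ℝ) * (ρ + (1 - ρ) * f fun n => ω (n + 1))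
  continuous_toFun := by
    have h : ∀ k : ℕ, Continuous fun ω : ℕ → Fin 2 => (((ω k : Fin 2) : ℕ) : ℝ) := fun k =>
      (continuous_of_discreteTopology (f := fun i : Fin 2 => ((i : ℕ) : ℝ))).comp
        (continuous_apply k)
    have := h 0
    have := h 1
    fun_prop

theorem arcOperator_zero_zero (ρ : ℝ) (f : C(ℕ → Fin 2, ℝ)) (ω : ℕ → Fin 2) :
    arcOperator ρ f (prependLetter 0 (prependLetter 0 ω)) = ρ * f ω := by
  simp only [arcOperator, ContinuousMap.coe_mk, prependLetter]
  simp

theorem arcOperator_zero_one (ρ : ℝ) (f : C(ℕ → Fin 2, ℝ)) (ω : ℕ → Fin 2) :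
    arcOperator ρ f (prependLetter 0 (prependLetter 1 ω)) = 0 := by
  simp only [arcOperator, ContinuousMap.coe_mk, prependLetter]
  simp

theorem arcOperator_one (ρ : ℝ) (f : C(ℕ → Fin 2, ℝ)) (ω : ℕ → Fin 2) :
    arcOperator ρ f (prependLetter 1 ω) = ρ + (1 - ρ) * f ω := by
  simp only [arcOperator, ContinuousMap.coe_mk, prependLetter]
  simp

theorem word_cases (ω : ℕ → Fin 2) : (∃ η, ω = prependLetter 0 (prependLetter 0 η)) ∨
    (∃ η, ω = prependLetter 0 (prependLetter 1 η)) ∨ ∃ η, ω = prependLetter 1 η := by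
  have h := SelfSimilarStructure.IsHataTree.prependLetter_shift ω
  have h' := SelfSimilarStructure.IsHataTree.prependLetter_shift fun n => ω (n + 1)
  rcases SelfSimilarStructure.IsHataTree.fin_two (ω 0) with h0 | h0
  · rcases SelfSimilarStructure.IsHataTree.fin_two (ω 1) with h1 | h1
    · simp only [zero_add, h1] at h'
      exact Or.inl ⟨_, by rw [← h, h0, ← h']⟩
    · simp only [zero_add, h1] at h'
      exact Or.inr (Or.inl ⟨_, by rw [← h, h0, ← h']⟩)
  · exact Or.inr (Or.inr ⟨_, by rw [← h0, h]⟩)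

theorem arcOperator_contracting {ρ : ℝ} (h0 : 0 < ρ) (h1 : ρ < 1) :
    ContractingWith ⟨max ρ (1 - ρ), le_max_of_le_left h0.le⟩ (arcOperator ρ) := by
  have hm : 0 ≤ max ρ (1 - ρ) := le_max_of_le_left h0.le
  refine ⟨max_lt h1 (by linarith), LipschitzWith.of_dist_le_mul fun f g => ?_⟩
  refine (ContinuousMap.dist_le (mul_nonneg hm dist_nonneg)).2 fun ω => ?_
  have hd := fun ω => ContinuousMap.dist_apply_le_dist (f := f) (g := g) ω
  rcases word_cases ω with ⟨η, rfl⟩ | ⟨η, rfl⟩ | ⟨η, rfl⟩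
  · rw [arcOperator_zero_zero, arcOperator_zero_zero, Real.dist_eq, ← mul_sub, abs_mul,
      abs_of_pos h0, ← Real.dist_eq]
    exact mul_le_mul (le_max_left _ _) (hd η) dist_nonneg hm
  · rw [arcOperator_zero_one, arcOperator_zero_one, dist_self]
    exact mul_nonneg hm dist_nonneg
  · rw [arcOperator_one, arcOperator_one, Real.dist_eq, add_sub_add_left_eq_sub, ← mul_sub,
      abs_mul, abs_of_pos (by linarith), ← Real.dist_eq]
    exact mul_le_mul (le_max_right _ _) (hd η) dist_nonneg hm

theorem exists_ne_first {ω ω' : ℕ → Fin 2} (h : ω ≠ ω') :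
    ∃ n, (∀ k < n, ω k = ω' k) ∧ ω n ≠ ω' n := by
  classical
  have hex : ∃ n, ω n ≠ ω' n := Function.ne_iff.1 h
  exact ⟨Nat.find hex, fun k hk => not_not.1 (Nat.find_min hex hk), Nat.find_spec hex⟩

variable (X) in
/-- The arc-length coordinate of the projection to the arc from `o` to `e`. -/
theorem exists_arcFun : ∃ h : C(K, ℝ), (∀ x, h (X.L.ψ 0 (X.L.ψ 0 x)) = X.r 0 ^ 2 * h x) ∧
    (∀ x, h (X.L.ψ 0 (X.L.ψ 1 x)) = 0) ∧
    ∀ x, h (X.L.ψ 1 x) = X.r 0 ^ 2 + (1 - X.r 0 ^ 2) * h x := by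
  set ρ := X.r 0 ^ 2 with hρ
  have h0 : 0 < ρ := pow_pos (X.r_pos 0) 2
  have h1 : ρ < 1 := pow_lt_one₀ (X.r_pos 0).le (X.r_lt_one 0) two_ne_zero
  set f := (arcOperator_contracting h0 h1).fixedPoint with hf
  have hfix : ∀ ω, f ω = arcOperator ρ f ω := fun ω =>
    (DFunLike.congr_fun (arcOperator_contracting h0 h1).fixedPoint_isFixedPt ω).symm
  have f00 : ∀ ω, f (prependLetter 0 (prependLetter 0 ω)) = ρ * f ω := fun ω => by
    rw [hfix, arcOperator_zero_zero]
  have f01 : ∀ ω, f (prependLetter 0 (prependLetter 1 ω)) = 0 := fun ω => by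
    rw [hfix, arcOperator_zero_one]
  have f1 : ∀ ω, f (prependLetter 1 ω) = ρ + (1 - ρ) * f ω := fun ω => by
    rw [hfix, arcOperator_one]
  have hconst : ∀ i : Fin 2, (fun _ : ℕ => i) = prependLetter i fun _ => i := fun i => by
    funext n
    cases n <;> rfl
  have fz : f (fun _ => 0) = 0 := by
    have h := f00 fun _ => 0
    rw [← hconst, ← hconst] at h
    nlinarith
  have fo : f (fun _ => 1) = 1 := by
    have h := f1 fun _ => 1
    rw [← hconst] at h
    nlinarith
  -- The only such pair is `00111…` and `1000…`, the codes of the branching point. The second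
  -- equation is needed because the operator reads two letters after a `0`, so compatibility of `f`
  -- has to be proved together with that of `f` after prepending `0`.
  have branch : ∀ ω ω', ω 0 = 0 → ω' 0 = 1 → X.L.π ω = X.L.π ω' →
      f ω = f ω' ∧ f (prependLetter 0 ω) = f (prependLetter 0 ω') := by
    intro ω ω' h0 h1 hω
    have e0 := SelfSimilarStructure.IsHataTree.prependLetter_shift ω
    have e1 := SelfSimilarStructure.IsHataTree.prependLetter_shift ω'
    rw [SelfSimilarStructure.IsHataTree.π_cons, SelfSimilarStructure.IsHataTree.π_cons X.L ω', h0,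
      h1] at hω
    obtain ⟨k1, k2⟩ := X.tree.inter _ _ hω
    rw [h0, X.tree.π_eq_q k1] at e0
    rw [h1, X.tree.π_eq_o k2] at e1
    rw [← e0, ← e1]
    constructor
    · rw [f00, f1, fz, fo]
      ring
    · rw [f00, f01]
      rw [hconst 1, f01]
      ring
  -- Induction on the first position where the two codes differ.
  have resp : ∀ n, ∀ ω ω', (∀ k < n, ω k = ω' k) → ω n ≠ ω' n → X.L.π ω = X.L.π ω' →
      f ω = f ω' ∧ f (prependLetter 0 ω) = f (prependLetter 0 ω') := by
    intro n
    induction n with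
    | zero =>
      intro ω ω' _ hn hω
      rcases SelfSimilarStructure.IsHataTree.fin_two (ω 0) with h0 | h0 <;>
        rcases SelfSimilarStructure.IsHataTree.fin_two (ω' 0) with h1 | h1
      · exact absurd (h0.trans h1.symm) hn
      · exact branch ω ω' h0 h1 hω
      · obtain ⟨k1, k2⟩ := branch ω' ω h1 h0 hω.symm
        exact ⟨k1.symm, k2.symm⟩
      · exact absurd (h0.trans h1.symm) hn
    | succ n ih =>
      intro ω ω' hk hn hω
      have e0 := SelfSimilarStructure.IsHataTree.prependLetter_shift ω
      have e1 := SelfSimilarStructure.IsHataTree.prependLetter_shift ω'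
      have h00 := hk 0 (Nat.succ_pos n)
      rw [SelfSimilarStructure.IsHataTree.π_cons, SelfSimilarStructure.IsHataTree.π_cons X.L ω',
        h00] at hω
      obtain ⟨k1, k2⟩ := ih (fun n => ω (n + 1)) (fun n => ω' (n + 1))
        (fun k hk' => hk (k + 1) (by omega)) hn (X.L.injective_ψ _ hω)
      rw [← e0, ← e1, h00]
      rcases SelfSimilarStructure.IsHataTree.fin_two (ω' 0) with h0 | h0 <;> rw [h0]
      · exact ⟨k2, by rw [f00, f00, k1]⟩
      · exact ⟨by rw [f1, f1, k1], by rw [f01, f01]⟩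
  obtain ⟨h, hh⟩ := exists_lift (X := X) f (by
    intro ω ω' hω
    by_cases hne : ω = ω'
    · rw [hne]
    · obtain ⟨n, hn, hn'⟩ := exists_ne_first hne
      exact (resp n ω ω' hn hn' hω).1)
  refine ⟨h, fun x => ?_, fun x => ?_, fun x => ?_⟩ <;> obtain ⟨ω, rfl⟩ := X.L.surjective_π x
  · rw [X.L.ψ_π, X.L.ψ_π, hh, hh, f00]
  · rw [X.L.ψ_π, X.L.ψ_π, hh, f01]
  · rw [X.L.ψ_π, hh, hh, f1]

variable (X) in
/-- The harmonic functions with boundary values `1` at `e`, and `1` at `q`. -/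
theorem exists_harmonic : ∃ h k : C(K, ℝ), (h X.o = 0 ∧ h X.e = 1 ∧ h X.q = 0) ∧
    (k X.o = 0 ∧ k X.e = 0 ∧ k X.q = 1) ∧ X.HasGrad h (blockFun 1 0) ∧
    X.HasGrad k (blockFun 0 (X.r 0)⁻¹) := by
  obtain ⟨h, h00, h01, h1⟩ := exists_arcFun X
  have r0 := X.r_pos 0
  have r1 := X.r_pos 1
  have hρ : X.r 0 ^ 2 < 1 := pow_lt_one₀ r0.le (X.r_lt_one 0) two_ne_zero
  -- `ψ_0` exchanges the two arcs, so `h ∘ ψ_0` is supported by `oq` up to constant branches; the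
  -- factor normalizes its value at `q`, since `h(ψ_0(q)) = h(ψ_1(o)) = r 0 ^ 2`.
  let k : C(K, ℝ) := ⟨fun x => (X.r 0 ^ 2)⁻¹ * h (X.L.ψ 0 x), by
    have := X.L.continuous_ψ 0
    fun_prop⟩
  have hk : ∀ x, k x = (X.r 0 ^ 2)⁻¹ * h (X.L.ψ 0 x) := fun x => rfl
  have h0 : ∀ x, h (X.L.ψ 0 x) = X.r 0 ^ 2 * k x := fun x => by
    rw [hk]
    field_simp
  have k0 : ∀ x, k (X.L.ψ 0 x) = h x := fun x => by
    rw [hk, h00]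
    field_simp
  have k1 : ∀ x, k (X.L.ψ 1 x) = 0 := fun x => by rw [hk, h01, mul_zero]
  have ho : h X.o = 0 := by
    have := h00 X.o
    rw [X.tree.zero_o, X.tree.zero_o] at this
    nlinarith
  have he : h X.e = 1 := by
    have := h1 X.e
    rw [X.tree.one_e] at this
    have h0 : X.r 0 ^ 2 * (h X.e - 1) = 0 := by linarith
    exact sub_eq_zero.1 ((mul_eq_zero.1 h0).resolve_left (pow_pos r0 2).ne')
  have hq : h X.q = 0 := by
    rw [← X.tree.zero_e, ← X.tree.one_e, h01]
  have ko : k X.o = 0 := by rw [hk, X.tree.zero_o, ho, mul_zero]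
  have ke : k X.e = 0 := by rw [hk, X.tree.zero_e, hq, mul_zero]
  have kq : k X.q = 1 := by rw [← X.tree.zero_e, k0, he]
  -- Refinement leaves these gradients unchanged, which is what makes the two functions harmonic.
  have key : ∀ m, (∀ ω, X.grad m h ω = blockFun 1 0 ω) ∧
      ∀ ω, X.grad m k ω = blockFun 0 (X.r 0)⁻¹ ω := by
    intro m
    induction m with
    | zero =>
      constructor <;> intro ω <;> simp only [grad, ho, he, hq, ko, ke, kq] <;> congr 1 <;> simp
    | succ m ih =>
      have scale : ∀ (a α β : ℝ) (ω : ℕ → Fin 2), a * blockFun α β ω =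
          blockFun (a * α) (a * β) ω := by
        intro a α β ω
        simp only [blockFun, Set.indicator]
        split_ifs <;> ring
      constructor <;> intro ω <;>
        rw [← SelfSimilarStructure.IsHataTree.prependLetter_shift ω, grad_succ] <;>
        rcases SelfSimilarStructure.IsHataTree.fin_two (ω 0) with hω | hω <;> rw [hω]
      · simp only [h0]
        rw [grad_const_mul, ih.2, blockFun_zero, scale, scale]
        congr 1 <;> (try field_simp)
        simp
      · simp only [h1]
        rw [grad_add, grad_const, grad_const_mul, ih.1, blockFun_one, zero_add, scale, scale,
          X.r_one]
        have : 1 - X.r 0 ^ 2 ≠ 0 := by linarith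
        congr 1 <;> field_simp
      · simp only [k0]
        rw [ih.1, blockFun_zero, scale]
        simp
      · simp only [k1]
        rw [grad_const, blockFun_one]
        simp [blockFun]
  exact ⟨h, k, ⟨ho, he, hq⟩, ⟨ko, ke, kq⟩, hasGrad_of_forall fun m => (key m).1,
    hasGrad_of_forall fun m => (key m).2⟩

/-- Harmonic interpolation on the cells of level `n`. On a cell the error is at most `ε` for the
variation of `u` plus `B * ε` for each of the two harmonic terms. Agreement at the boundary points
is carried along because it makes the two halves match at the junction. -/
theorem exists_interpolation {h k : C(K, ℝ)} (hh : h X.o = 0 ∧ h X.e = 1 ∧ h X.q = 0)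
    (hk : k X.o = 0 ∧ k X.e = 0 ∧ k X.q = 1) (hhE : X.FiniteEnergy h) (hkE : X.FiniteEnergy k)
    {B : ℝ} (hhB : ∀ x, |h x| ≤ B) (hkB : ∀ x, |k x| ≤ B) (n : ℕ) : ∀ u : C(K, ℝ), ∃ v : C(K, ℝ),
      X.FiniteEnergy v ∧ (v X.o = u X.o ∧ v X.e = u X.e ∧ v X.q = u X.q) ∧
      ∀ ε, X.OscLE n ε u → ∀ x, |u x - v x| ≤ (1 + 2 * B) * ε := by
  induction n with
  | zero =>
    intro u
    refine ⟨⟨fun x => u X.o + ((u X.e - u X.o) * h x + (u X.q - u X.o) * k x), by fun_prop⟩, ?_,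
      ?_, fun ε hε x => ?_⟩
    · exact (finiteEnergy_const _).add ((hhE.const_mul _).add (hkE.const_mul _))
    · simp [hh, hk]
    · have osc : ∀ y z, |u y - u z| ≤ ε := by
        intro y z
        obtain ⟨ω, rfl⟩ := X.L.surjective_π y
        obtain ⟨ω', rfl⟩ := X.L.surjective_π z
        exact hε ω ω' fun k hk => absurd hk (Nat.not_lt_zero k)
      have hB : 0 ≤ B := (abs_nonneg _).trans (hhB x)
      have hε0 : 0 ≤ ε := (abs_nonneg _).trans (osc x x)
      have e : u x - (u X.o + ((u X.e - u X.o) * h x + (u X.q - u X.o) * k x)) =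
          (u x - u X.o) + (-((u X.e - u X.o) * h x) + -((u X.q - u X.o) * k x)) := by ring
      change |u x - (u X.o + ((u X.e - u X.o) * h x + (u X.q - u X.o) * k x))| ≤ _
      rw [e]
      refine (abs_add_le _ _).trans ?_
      have h1 := abs_add_le (-((u X.e - u X.o) * h x)) (-((u X.q - u X.o) * k x))
      rw [abs_neg, abs_neg, abs_mul, abs_mul] at h1
      have h2 := mul_le_mul (osc X.e X.o) (hhB x) (abs_nonneg _) hε0
      have h3 := mul_le_mul (osc X.q X.o) (hkB x) (abs_nonneg _) hε0
      have h4 := osc x X.o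
      linarith
  | succ n ih =>
    intro u
    let w : Fin 2 → C(K, ℝ) := fun i => u.comp ⟨X.L.ψ i, X.L.continuous_ψ i⟩
    have hw : ∀ i x, w i x = u (X.L.ψ i x) := fun i x => rfl
    choose v hvE hvb hv using fun i => ih (w i)
    obtain ⟨z, hz⟩ := exists_glue (X := X) v (by
      rw [(hvb 0).2.2, (hvb 1).1, hw, hw, X.tree.zero_q])
    refine ⟨z, finiteEnergy_glue fun i => ?_, ⟨?_, ?_, ?_⟩, fun ε hε x => ?_⟩
    · simp only [hz]
      exact hvE i
    · have := hz 0 X.o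
      rw [X.tree.zero_o, (hvb 0).1, hw, X.tree.zero_o] at this
      exact this
    · have := hz 1 X.e
      rw [X.tree.one_e, (hvb 1).2.1, hw, X.tree.one_e] at this
      exact this
    · have := hz 0 X.e
      rw [X.tree.zero_e, (hvb 0).2.1, hw, X.tree.zero_e] at this
      exact this
    · obtain ⟨ω, rfl⟩ := X.L.surjective_π x
      rw [SelfSimilarStructure.IsHataTree.π_cons, hz, ← hw]
      exact hv (ω 0) ε (hε.comp (ω 0)) _

variable (X) in
/-- The continuous functions of finite energy are uniformly dense in `C(K)`. -/
theorem exists_finiteEnergy_approx (u : C(K, ℝ)) {ε : ℝ} (hε : 0 < ε) :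
    ∃ v : C(K, ℝ), X.FiniteEnergy v ∧ ∀ x, |u x - v x| ≤ ε := by
  obtain ⟨h, k, hh, hk, hhg, hkg⟩ := exists_harmonic X
  obtain ⟨A, hA0, hA⟩ := exists_bound (X := X) h.continuous
  obtain ⟨B, hB0, hB⟩ := exists_bound (X := X) k.continuous
  have hp : 0 < 1 + 2 * max A B := by
    have := le_max_of_le_left (b := A) (c := B) hA0
    linarith
  obtain ⟨n, hn⟩ := exists_oscLE (X := X) u.continuous (div_pos hε hp)
  obtain ⟨v, hv, -, hvu⟩ := exists_interpolation hh hk hhg.finiteEnergy hkg.finiteEnergy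
    (B := max A B)
    (fun x => by
      obtain ⟨ω, rfl⟩ := X.L.surjective_π x
      exact (hA ω).trans (le_max_left _ _))
    (fun x => by
      obtain ⟨ω, rfl⟩ := X.L.surjective_π x
      exact (hB ω).trans (le_max_right _ _)) n u
  refine ⟨v, hv, fun x => (hvu _ hn x).trans ?_⟩
  rw [mul_div_cancel₀ _ hp.ne']

/-- The harmonic function of the arc `oe` has gradient `1` on `blockSet`. For a deeper edge, a
function found in a smaller cell is transplanted and continued by its value at the junction in the
other cell. -/
theorem exists_hasGrad_ne_zero_of_level (n : ℕ) : ∀ {B : Set (ℕ → Fin 2)}, MeasurableSet B →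
    X.Λ (B ∩ {ω | (fun m => ω (m + n)) ∈ blockSet}) ≠ 0 →
    ∃ (u : C(K, ℝ)) (g : (ℕ → Fin 2) → ℝ), X.HasGrad u g ∧ X.Λ (B ∩ {ω | g ω ≠ 0}) ≠ 0 := by
  induction n with
  | zero =>
    intro B _ h
    obtain ⟨u, -, -, -, hu, -⟩ := exists_harmonic X
    refine ⟨u, _, hu, fun h0 => h (measure_mono_null ?_ h0)⟩
    rintro ω ⟨hω, hω'⟩
    refine ⟨hω, ?_⟩
    change blockFun 1 0 ω ≠ 0
    rw [blockFun_of_mem (by simpa using hω')]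
    exact one_ne_zero
  | succ n ih =>
    intro B hB h
    have hS : MeasurableSet {ω : ℕ → Fin 2 | (fun m => ω (m + (n + 1))) ∈ blockSet} :=
      measurableSet_blockSet.preimage (measurable_pi_iff.2 fun m => measurable_pi_apply _)
    have hi : ∃ i, X.Λ {ω | prependLetter i ω ∈
        B ∩ {ω | (fun m => ω (m + (n + 1))) ∈ blockSet}} ≠ 0 := by
      by_contra hne
      push Not at hne
      rw [X.skeleton.measure_eq (hB.inter hS), hne, hne] at h
      simp at h
    obtain ⟨i, hi⟩ := hi
    obtain ⟨u, g, hug, hg⟩ := ih (B := {ω | prependLetter i ω ∈ B})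
      (measurable_prependLetter i hB) hi
    have hglue : ∃ (v : C(K, ℝ)) (G : Fin 2 → (ℕ → Fin 2) → ℝ),
        (∀ j, X.HasGrad (fun x => v (X.L.ψ j x)) (G j)) ∧ G i = g := by
      rcases SelfSimilarStructure.IsHataTree.fin_two i with rfl | rfl
      · obtain ⟨v, hv⟩ := exists_glue (X := X) ![u, ContinuousMap.const K (u X.q)] (by simp)
        refine ⟨v, ![g, fun _ => 0], fun j => ?_, rfl⟩
        simp only [hv]
        rcases SelfSimilarStructure.IsHataTree.fin_two j with rfl | rfl
        · exact hug
        · exact HasGrad.const (u X.q)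
      · obtain ⟨v, hv⟩ := exists_glue (X := X) ![ContinuousMap.const K (u X.o), u] (by simp)
        refine ⟨v, ![fun _ => 0, g], fun j => ?_, rfl⟩
        simp only [hv]
        rcases SelfSimilarStructure.IsHataTree.fin_two j with rfl | rfl
        · exact HasGrad.const (u X.o)
        · exact hug
    obtain ⟨v, G, hG, hGi⟩ := hglue
    have hv := HasGrad.glue (u := v) hG
    refine ⟨v, _, hv, fun h0 => hg ?_⟩
    have hm := hB.inter (hv.1 (measurableSet_singleton 0).compl)
    change X.Λ (B ∩ _ ⁻¹' {0}ᶜ) = 0 at h0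
    rw [X.skeleton.measure_eq hm, add_eq_zero, mul_eq_zero, mul_eq_zero] at h0
    have h0i : X.Λ {ω | prependLetter i ω ∈ B ∩
        (fun ω : ℕ → Fin 2 => (X.r (ω 0))⁻¹ * G (ω 0) fun n => ω (n + 1)) ⁻¹' {0}ᶜ} = 0 := by
      rcases SelfSimilarStructure.IsHataTree.fin_two i with rfl | rfl
      · exact h0.1.resolve_left (by simpa using X.r_pos 0)
      · exact h0.2.resolve_left (by simpa using X.r_pos 1)
    refine measure_mono_null ?_ h0i
    rintro ω ⟨hω, hω'⟩
    refine ⟨hω, ?_⟩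
    change (X.r i)⁻¹ * G i ω ≠ 0
    rw [hGi]
    exact mul_ne_zero (inv_pos.2 (X.r_pos i)).ne' hω'

/-- The gradients of the functions of finite energy separate sets of positive length from null
sets. -/
theorem exists_hasGrad_ne_zero {B : Set (ℕ → Fin 2)} (hB : MeasurableSet B) (h : X.Λ B ≠ 0) :
    ∃ (u : C(K, ℝ)) (g : (ℕ → Fin 2) → ℝ), X.HasGrad u g ∧ X.Λ (B ∩ {ω | g ω ≠ 0}) ≠ 0 := by
  by_contra hne
  have hn : ∀ n : ℕ, X.Λ (B ∩ {ω | (fun m => ω (m + n)) ∈ blockSet}) = 0 := fun n => by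
    by_contra h0
    exact hne (exists_hasGrad_ne_zero_of_level n hB h0)
  refine h (measure_mono_null ?_ (measure_union_null (measure_iUnion_null hn)
    X.skeleton.concentrated))
  intro ω hω
  by_cases h0 : ∃ n : ℕ, (fun m => ω (m + n)) ∈ blockSet
  · obtain ⟨n, hn⟩ := h0
    exact Or.inl (Set.mem_iUnion.2 ⟨n, hω, hn⟩)
  · exact Or.inr (not_exists.1 h0)

end Functions

end HataNetwork

/-! ### The network of a regular harmonic structure -/

namespace SelfSimilarStructure.IsHataTree

variable {K : Type*} [TopologicalSpace K] {L : SelfSimilarStructure K 2} {o e q : K}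
  {D : Matrix L.V₀ L.V₀ ℝ} {r : Fin 2 → ℝ}

/-- The network of a regular harmonic structure. -/
noncomputable def network (T : L.IsHataTree o e q) (h : L.IsRegularHarmonicStructure D r) :
    HataNetwork K where
  L := L
  o := o
  e := e
  q := q
  tree := T
  r := r
  r_pos := h.r_pos
  r_lt_one := h.r_lt_one
  r_one := (T.conductances h).2.2.2
  Λ := (exists_skeletonMeasure (h.r_pos 0) (h.r_lt_one 0) (T.conductances h).2.2.2).choose
  skeleton := (exists_skeletonMeasure (h.r_pos 0) (h.r_lt_one 0)
    (T.conductances h).2.2.2).choose_spec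

theorem energy_eq (T : L.IsHataTree o e q) (h : L.IsRegularHarmonicStructure D r) (m : ℕ) :
    ∀ u v : K → ℝ, L.energy D r m u v =
      D ⟨o, T.o_mem⟩ ⟨e, T.e_mem⟩ * (T.network h).energy m u v := by
  induction m with
  | zero =>
    intro u v
    obtain ⟨-, h2, h3, -⟩ := T.conductances h
    rw [L.energy_zero, T.energy₀_eq h.toIsHarmonicStructure, h2, h3, HataNetwork.energy]
    change _ = _ * ((u e - u o) * (v e - v o) + (r 0)⁻¹ * ((u q - u o) * (v q - v o)))
    ring
  | succ m ih =>
    intro u v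
    rw [L.energy_succ, Fin.sum_univ_two, ih, ih, HataNetwork.energy]
    change _ = _ * ((r 0)⁻¹ * _ + (r 1)⁻¹ * _)
    simp only [network]
    ring

end SelfSimilarStructure.IsHataTree

/-! ### The Dirichlet form -/

theorem ContinuousMap.toAEEqFun_injective {K : Type*} [TopologicalSpace K] [MeasurableSpace K]
    [BorelSpace K] [SecondCountableTopology K] (μ : Measure K) [μ.IsOpenPosMeasure] :
    Function.Injective fun u : C(K, ℝ) => u.toAEEqFun μ := by
  intro u v h
  have h' : (u : K → ℝ) =ᵐ[μ] v := AEEqFun.mk_eq_mk.1 h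
  exact DFunLike.coe_injective (Measure.eq_of_ae_eq h' u.continuous v.continuous)

theorem SelfSimilarStructure.contRep_toAEEqFun {K : Type*} [TopologicalSpace K] [MeasurableSpace K]
    [BorelSpace K] [SecondCountableTopology K] (μ : Measure K) [μ.IsOpenPosMeasure] (u : C(K, ℝ)) :
    contRep μ (u.toAEEqFun μ) = u :=
  Function.leftInverse_invFun (ContinuousMap.toAEEqFun_injective μ) u

namespace HataNetwork

section Form

variable {K : Type*} [TopologicalSpace K] [MeasurableSpace K] [BorelSpace K]
  {μ : Measure K}

/-- `F` is the form with values `a ∫ g_u g_v dΛ`, where `g_u` is the gradient of `u`. -/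
structure IsEnergyForm (X : HataNetwork K) (a : ℝ) (F : FormData K μ) : Prop where
  pos : 0 < a
  mem_domain : ∀ f, f ∈ F.domain ↔ ∃ u : C(K, ℝ), u.toAEEqFun μ = f ∧ X.FiniteEnergy u
  form_eq : ∀ (u v : C(K, ℝ)) (g h : (ℕ → Fin 2) → ℝ), X.HasGrad u g → X.HasGrad v h →
    F.form (u.toAEEqFun μ) (v.toAEEqFun μ) = a * ∫ ω, g ω * h ω ∂X.Λ

theorem _root_.SelfSimilarStructure.IsHataTree.isEnergyForm [SecondCountableTopology K] [μ.IsOpenPosMeasure]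
    {L : SelfSimilarStructure K 2} {o e q : K} {D : Matrix L.V₀ L.V₀ ℝ} {r : Fin 2 → ℝ}
    (T : L.IsHataTree o e q) (h : L.IsRegularHarmonicStructure D r) :
    (T.network h).IsEnergyForm (D ⟨o, T.o_mem⟩ ⟨e, T.e_mem⟩) (L.dirichletForm μ D r) where
  pos := (T.conductances h).1
  mem_domain f := by
    have ha := (T.conductances h).1
    refine exists_congr fun u => and_congr_right fun _ => ?_
    simp only [T.energy_eq h]
    constructor
    · rintro ⟨b, hb⟩
      refine ⟨(D ⟨o, T.o_mem⟩ ⟨e, T.e_mem⟩)⁻¹ * b, (hb.const_mul _).congr fun m => ?_⟩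
      rw [inv_mul_cancel_left₀ ha.ne']
    · rintro ⟨b, hb⟩
      exact ⟨_, hb.const_mul _⟩
  form_eq u v g k hu hv := by
    refine Tendsto.limUnder_eq ?_
    rw [SelfSimilarStructure.contRep_toAEEqFun, SelfSimilarStructure.contRep_toAEEqFun]
    simp only [T.energy_eq h]
    exact (hu.tendsto_energy hv).const_mul _

theorem integral_toAEEqFun_mul (u v : C(K, ℝ)) :
    ∫ x, u.toAEEqFun μ x * v.toAEEqFun μ x ∂μ = ∫ x, u x * v x ∂μ := by
  refine integral_congr_ae ?_
  filter_upwards [u.coeFn_toAEEqFun μ, v.coeFn_toAEEqFun μ] with x h1 h2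
  rw [h1, h2]

theorem toAEEqFun_truncate (u : C(K, ℝ)) :
    (0 ⊔ u.toAEEqFun μ) ⊓ 1 = ((0 ⊔ u) ⊓ 1 : C(K, ℝ)).toAEEqFun μ := by
  refine AEEqFun.ext ?_
  filter_upwards [AEEqFun.coeFn_inf (0 ⊔ u.toAEEqFun μ) 1, AEEqFun.coeFn_sup 0 (u.toAEEqFun μ),
    u.coeFn_toAEEqFun μ, ((0 ⊔ u) ⊓ 1 : C(K, ℝ)).coeFn_toAEEqFun μ,
    AEEqFun.coeFn_zero (μ := μ) (β := ℝ), AEEqFun.coeFn_one (μ := μ) (β := ℝ)] with x h1 h2 h3 h4 h5 h6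
  rw [h1, h2, h3, h4, h5, h6]
  rfl

theorem integrable_continuous [CompactSpace K] [IsFiniteMeasure μ] (u : C(K, ℝ)) :
    Integrable u μ := by
  obtain ⟨C, hC⟩ := isCompact_univ.exists_bound_of_continuousOn u.continuous.continuousOn
  exact Integrable.of_bound u.continuous.aestronglyMeasurable C
    (ae_of_all _ fun x => hC x (Set.mem_univ x))

theorem memLp_continuous [CompactSpace K] [IsFiniteMeasure μ] (u : C(K, ℝ)) (p : ENNReal) :
    MemLp u p μ := by
  obtain ⟨C, hC⟩ := isCompact_univ.exists_bound_of_continuousOn u.continuous.continuousOn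
  exact MemLp.of_bound u.continuous.aestronglyMeasurable C
    (ae_of_all _ fun x => hC x (Set.mem_univ x))

namespace IsEnergyForm

variable {X : HataNetwork K} {a : ℝ} {F : FormData K μ} (hF : X.IsEnergyForm a F)
include hF

theorem form₁_eq {u : C(K, ℝ)} {g : (ℕ → Fin 2) → ℝ} (hu : X.HasGrad u g) :
    F.form₁ (u.toAEEqFun μ) (u.toAEEqFun μ) = a * ∫ ω, g ω ^ 2 ∂X.Λ + ∫ x, u x ^ 2 ∂μ := by
  rw [FormData.form₁, hF.form_eq u u g g hu hu, integral_toAEEqFun_mul]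
  simp only [sq]

theorem exists_rep {f : K →ₘ[μ] ℝ} (hf : f ∈ F.domain) : ∃ (u : C(K, ℝ))
    (g : (ℕ → Fin 2) → ℝ), u.toAEEqFun μ = f ∧ X.HasGrad u g := by
  obtain ⟨u, hu, hE⟩ := (hF.mem_domain f).1 hf
  obtain ⟨g, hg⟩ := hE.exists_hasGrad
  exact ⟨u, g, hu, hg⟩

theorem mem_of_hasGrad {u : C(K, ℝ)} {g : (ℕ → Fin 2) → ℝ} (hu : X.HasGrad u g) :
    u.toAEEqFun μ ∈ F.domain :=
  (hF.mem_domain _).2 ⟨u, rfl, hu.finiteEnergy⟩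

theorem finiteEnergy_of_mem [SecondCountableTopology K] [μ.IsOpenPosMeasure] {u : C(K, ℝ)}
    (hu : u.toAEEqFun μ ∈ F.domain) : X.FiniteEnergy u := by
  obtain ⟨v, hv, hE⟩ := (hF.mem_domain _).1 hu
  rwa [← ContinuousMap.toAEEqFun_injective μ hv]

/-- The form norm dominates the uniform norm. -/
theorem exists_sq_le [CompactSpace K] [IsProbabilityMeasure μ] : ∃ C : ℝ, 0 < C ∧
    ∀ (u : C(K, ℝ)) (g : (ℕ → Fin 2) → ℝ), X.HasGrad u g → ∀ x,
      u x ^ 2 ≤ C * F.form₁ (u.toAEEqFun μ) (u.toAEEqFun μ) := by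
  obtain ⟨C, hC0, hC⟩ := exists_resistance_bound X
  have ha := hF.pos
  refine ⟨2 + 8 * C ^ 2 / a, by positivity, fun u g hu x => ?_⟩
  rw [hF.form₁_eq hu]
  set I := ∫ ω, g ω ^ 2 ∂X.Λ with hI
  have hI0 : 0 ≤ I := integral_nonneg fun ω => sq_nonneg _
  have hosc := hC u u.continuous (Real.sqrt I) (Real.sqrt_nonneg _) fun m => by
    rw [Real.sq_sqrt hI0]
    exact hu.energy_le m
  -- To be averaged over `y` with respect to the probability measure `μ`; the factor `8` is `2 * 2 ^
  -- 2`, two points being each at distance at most `C * √I` in value from `u X.o`.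
  have hpt : ∀ y, u x ^ 2 ≤ 2 * u y ^ 2 + 8 * C ^ 2 * I := by
    intro y
    have h1 := abs_sub_le (u x) (u X.o) (u y)
    rw [abs_sub_comm (u X.o)] at h1
    have h2 : |u x - u y| ≤ 2 * C * Real.sqrt I := by linarith [hosc x, hosc y]
    have h3 : (u x - u y) ^ 2 ≤ 4 * C ^ 2 * I := by
      rw [← sq_abs]
      calc |u x - u y| ^ 2 ≤ (2 * C * Real.sqrt I) ^ 2 := pow_le_pow_left₀ (abs_nonneg _) h2 2
        _ = _ := by rw [mul_pow, Real.sq_sqrt hI0]; ring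
    nlinarith [sq_nonneg (u x - 2 * u y)]
  have hint : Integrable (fun y => u y ^ 2) μ := integrable_continuous (u ^ 2)
  have h4 : ∫ _, u x ^ 2 ∂μ ≤ ∫ y, (2 * u y ^ 2 + 8 * C ^ 2 * I) ∂μ :=
    integral_mono (integrable_const _) ((hint.const_mul 2).add (integrable_const _)) hpt
  rw [integral_add (hint.const_mul 2) (integrable_const _), integral_const_mul] at h4
  simp only [integral_const, probReal_univ, one_smul] at h4
  have hJ : 0 ≤ ∫ y, u y ^ 2 ∂μ := integral_nonneg fun y => sq_nonneg _
  have e : (2 + 8 * C ^ 2 / a) * (a * I + ∫ y, u y ^ 2 ∂μ) =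
      2 * ∫ y, u y ^ 2 ∂μ + 8 * C ^ 2 * I + (2 * a * I + 8 * C ^ 2 / a * ∫ y, u y ^ 2 ∂μ) := by
    field_simp
    ring
  rw [e]
  have : 0 ≤ 2 * a * I + 8 * C ^ 2 / a * ∫ y, u y ^ 2 ∂μ := by positivity
  linarith

/-- A Cauchy sequence for the form norm is uniformly Cauchy. Energies of a fixed level pass to the
pointwise limit, so the Cauchy bound for `u i - u j` survives for `u i - v` at all levels; this
gives `v` finite energy and the convergence. -/
theorem closed [CompactSpace K] [IsProbabilityMeasure μ] (f : ℕ → (K →ₘ[μ] ℝ))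
    (hf : ∀ i, f i ∈ F.domain)
    (hc : ∀ ε : ℝ, 0 < ε → ∃ n, ∀ i ≥ n, ∀ j ≥ n, F.form₁ (f i - f j) (f i - f j) < ε) :
    ∃ g ∈ F.domain, Tendsto (fun i => F.form₁ (f i - g) (f i - g)) atTop (𝓝 0) := by
  obtain ⟨C, hC0, hC⟩ := hF.exists_sq_le
  have ha := hF.pos
  choose u g hu hg using fun i => hF.exists_rep (hf i)
  obtain rfl : (fun i => (u i).toAEEqFun μ) = f := funext hu
  have hsub : ∀ i j, X.HasGrad (u i - u j : C(K, ℝ)) fun ω => g i ω + -1 * g j ω := by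
    intro i j
    have := (hg i).add ((hg j).const_mul (-1))
    refine (congrArg (fun w => X.HasGrad w _) ?_).mp this
    funext x
    simp [sub_eq_add_neg]
  have hcu : ∀ ε : ℝ, 0 < ε → ∃ n, ∀ i ≥ n, ∀ j ≥ n,
      a * ∫ ω, (g i ω + -1 * g j ω) ^ 2 ∂X.Λ ≤ ε ∧ ∀ x, (u i x - u j x) ^ 2 ≤ C * ε := by
    intro ε hε
    obtain ⟨n, hn⟩ := hc ε hε
    refine ⟨n, fun i hi j hj => ?_⟩
    have h1 : F.form₁ ((u i - u j : C(K, ℝ)).toAEEqFun μ) ((u i - u j : C(K, ℝ)).toAEEqFun μ) < ε :=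
      hn i hi j hj
    refine ⟨?_, fun x => ?_⟩
    · rw [hF.form₁_eq (hsub i j)] at h1
      have : 0 ≤ ∫ x, (u i - u j : C(K, ℝ)) x ^ 2 ∂μ := integral_nonneg fun x => sq_nonneg _
      linarith
    · exact (hC _ _ (hsub i j) x).trans (mul_le_mul_of_nonneg_left h1.le hC0.le)
  have hcs : CauchySeq u := by
    refine Metric.cauchySeq_iff.2 fun ε hε => ?_
    obtain ⟨n, hn⟩ := hcu ((ε / 2) ^ 2 / C) (by positivity)
    refine ⟨n, fun i hi j hj => lt_of_le_of_lt ?_ (half_lt_self hε)⟩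
    refine (ContinuousMap.dist_le (half_pos hε).le).2 fun x => ?_
    have := (hn i hi j hj).2 x
    rw [mul_div_cancel₀ _ hC0.ne'] at this
    exact abs_le_of_sq_le_sq this (half_pos hε).le
  obtain ⟨v, hv⟩ := cauchySeq_tendsto_of_complete hcs
  have hvx : ∀ x, Tendsto (fun j => u j x) atTop (𝓝 (v x)) := fun x =>
    ((continuous_eval_const x).tendsto v).comp hv
  have lim : ∀ ε : ℝ, 0 < ε → ∃ n, ∀ i ≥ n, (∀ m, a * X.energy m (u i - v : C(K, ℝ))
      (u i - v : C(K, ℝ)) ≤ ε) ∧ ∀ x, (u i x - v x) ^ 2 ≤ C * ε := by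
    intro ε hε
    obtain ⟨n, hn⟩ := hcu ε hε
    refine ⟨n, fun i hi => ⟨fun m => ?_, fun x => ?_⟩⟩
    · have : Tendsto (fun j => a * X.energy m (u i - u j : C(K, ℝ)) (u i - u j : C(K, ℝ))) atTop
          (𝓝 (a * X.energy m (u i - v : C(K, ℝ)) (u i - v : C(K, ℝ)))) :=
        (continuous_energy_apply m fun x => (tendsto_const_nhds.sub (hvx x))).const_mul a
      refine le_of_tendsto this (eventually_atTop.2 ⟨n, fun j hj => ?_⟩)
      exact (mul_le_mul_of_nonneg_left ((hsub i j).energy_le m) ha.le).trans (hn i hi j hj).1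
    · exact le_of_tendsto ((tendsto_const_nhds.sub (hvx x)).pow 2)
        (eventually_atTop.2 ⟨n, fun j hj => (hn i hi j hj).2 x⟩)
  have hE : ∀ i, (∃ b, ∀ m, a * X.energy m (u i - v : C(K, ℝ)) (u i - v : C(K, ℝ)) ≤ b) →
      ∃ h, X.HasGrad (u i - v : C(K, ℝ)) h := by
    rintro i ⟨b, hb⟩
    refine (finiteEnergy_of_le (C := a⁻¹ * b) fun m => ?_).exists_hasGrad
    rw [le_inv_mul_iff₀ ha]
    exact hb m
  obtain ⟨n, hn⟩ := lim 1 one_pos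
  obtain ⟨h, hh⟩ := hE n ⟨1, (hn n le_rfl).1⟩
  have hvg : X.HasGrad v fun ω => g n ω + -1 * h ω := by
    refine (congrArg (fun w => X.HasGrad w _) ?_).mp ((hg n).add (hh.const_mul (-1)))
    funext x
    simp
  refine ⟨_, hF.mem_of_hasGrad hvg, ?_⟩
  rw [Metric.tendsto_atTop]
  intro ε hε
  -- With this bound `η`, the energy contributes at most `η` and the integral at most `C * η`, in
  -- total `ε / 2`.
  obtain ⟨n, hn⟩ := lim (ε / (2 * (1 + C))) (by positivity)
  refine ⟨n, fun i hi => ?_⟩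
  obtain ⟨h1, h2⟩ := hn i hi
  obtain ⟨h, hh⟩ := hE i ⟨_, h1⟩
  change dist (F.form₁ ((u i - v : C(K, ℝ)).toAEEqFun μ) ((u i - v : C(K, ℝ)).toAEEqFun μ)) 0 < ε
  rw [hF.form₁_eq hh, Real.dist_eq, sub_zero, abs_of_nonneg (add_nonneg
    (mul_nonneg ha.le (integral_nonneg fun ω => sq_nonneg _)) (integral_nonneg fun ω => sq_nonneg _))]
  have h3 : a * ∫ ω, h ω ^ 2 ∂X.Λ ≤ ε / (2 * (1 + C)) := by
    have := (hh.tendsto_energy hh).const_mul a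
    simp only [← sq] at this
    exact le_of_tendsto' this h1
  have h4 : ∫ x, (u i - v : C(K, ℝ)) x ^ 2 ∂μ ≤ ∫ _, C * (ε / (2 * (1 + C))) ∂μ :=
    integral_mono (integrable_continuous ((u i - v) ^ 2)) (integrable_const _) h2
  simp only [integral_const, probReal_univ, one_smul] at h4
  have h5 : ε / (2 * (1 + C)) + C * (ε / (2 * (1 + C))) = ε / 2 := by
    field_simp
  linarith

theorem dense [T2Space K] [CompactSpace K] [IsProbabilityMeasure μ] [μ.WeaklyRegular]
    {f : K →ₘ[μ] ℝ} (hf : MemLp f 2 μ) {ε : ℝ} (hε : 0 < ε) :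
    ∃ g ∈ F.domain, ∫ x, ((f - g : K →ₘ[μ] ℝ) x) ^ 2 ∂μ < ε := by
  -- Two approximations of size `δ` give a squared error of at most `4 * δ ^ 2`.
  set δ := Real.sqrt (ε / 5) with hδ
  have hδ0 : 0 < δ := Real.sqrt_pos.2 (by positivity)
  have hδ2 : δ ^ 2 = ε / 5 := Real.sq_sqrt (by positivity)
  obtain ⟨φ, hφ, hφm⟩ := hf.exists_boundedContinuous_eLpNorm_sub_le ENNReal.ofNat_ne_top
    (ENNReal.ofReal_pos.2 hδ0).ne'
  obtain ⟨v, hv, hvφ⟩ := exists_finiteEnergy_approx X φ.toContinuousMap hδ0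
  refine ⟨_, (hF.mem_domain _).2 ⟨v, rfl, hv⟩, ?_⟩
  have h1 : ∫ x, (f x - φ x) ^ 2 ∂μ ≤ δ ^ 2 := by
    have := (hf.sub hφm).norm_toLp_sq
    simp only [Pi.sub_apply] at this
    rw [← this, Lp.norm_toLp]
    exact pow_le_pow_left₀ ENNReal.toReal_nonneg (ENNReal.toReal_le_of_le_ofReal hδ0.le hφ) 2
  have i1 : Integrable (fun x => 2 * (f x - φ x) ^ 2) μ := (hf.sub hφm).integrable_sq.const_mul 2
  calc ∫ x, ((f - v.toAEEqFun μ : K →ₘ[μ] ℝ) x) ^ 2 ∂μ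
      ≤ ∫ x, (2 * (f x - φ x) ^ 2 + 2 * δ ^ 2) ∂μ := by
        refine integral_mono_of_nonneg (ae_of_all _ fun x => sq_nonneg _)
          (i1.add (integrable_const _)) ?_
        filter_upwards [AEEqFun.coeFn_sub f (v.toAEEqFun μ), v.coeFn_toAEEqFun μ] with x e1 e2
        rw [e1, Pi.sub_apply, e2]
        have h2 : (φ x - v x) ^ 2 ≤ δ ^ 2 := by
          rw [← sq_abs]
          exact pow_le_pow_left₀ (abs_nonneg _) (hvφ x) 2
        nlinarith [sq_nonneg ((f x - φ x) - (φ x - v x))]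
    _ ≤ 4 * δ ^ 2 := by
        rw [integral_add i1 (integrable_const _), integral_const_mul]
        simp only [integral_const, probReal_univ, one_smul]
        linarith
    _ < ε := by linarith

theorem isRegularDirichletForm [T2Space K] [CompactSpace K] [IsProbabilityMeasure μ]
    [μ.WeaklyRegular] : F.IsRegularDirichletForm where
  zero_mem := hF.mem_of_hasGrad (u := 0) (HasGrad.const 0)
  add_mem f hf g hg := by
    obtain ⟨u, U, rfl, hu⟩ := hF.exists_rep hf
    obtain ⟨v, V, rfl, hv⟩ := hF.exists_rep hg
    exact hF.mem_of_hasGrad (u := u + v) (hu.add hv)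
  smul_mem b f hf := by
    obtain ⟨u, U, rfl, hu⟩ := hF.exists_rep hf
    exact hF.mem_of_hasGrad (u := b • u) (hu.const_mul b)
  memLp f hf := by
    obtain ⟨u, U, rfl, hu⟩ := hF.exists_rep hf
    exact (memLp_congr_ae (u.coeFn_toAEEqFun μ)).2 (memLp_continuous u 2)
  dense f hf ε hε := hF.dense hf hε
  form_add f hf g hg h hh := by
    obtain ⟨u, U, rfl, hu⟩ := hF.exists_rep hf
    obtain ⟨v, V, rfl, hv⟩ := hF.exists_rep hg
    obtain ⟨w, W, rfl, hw⟩ := hF.exists_rep hh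
    change F.form ((u + v).toAEEqFun μ) _ = _
    rw [hF.form_eq (u + v) w _ W (hu.add hv) hw, hF.form_eq u w U W hu hw,
      hF.form_eq v w V W hv hw, ← mul_add, ← integral_add (hu.2.1.integrable_mul_two hw.2.1)
      (hv.2.1.integrable_mul_two hw.2.1)]
    simp only [add_mul]
  form_smul b f hf g hg := by
    obtain ⟨u, U, rfl, hu⟩ := hF.exists_rep hf
    obtain ⟨v, V, rfl, hv⟩ := hF.exists_rep hg
    change F.form ((b • u).toAEEqFun μ) _ = _
    rw [hF.form_eq (b • u) v _ V (hu.const_mul b) hv, hF.form_eq u v U V hu hv]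
    simp only [mul_assoc]
    rw [integral_const_mul]
    ring
  form_symm f hf g hg := by
    obtain ⟨u, U, rfl, hu⟩ := hF.exists_rep hf
    obtain ⟨v, V, rfl, hv⟩ := hF.exists_rep hg
    rw [hF.form_eq u v U V hu hv, hF.form_eq v u V U hv hu]
    simp only [mul_comm (U _)]
  form_nonneg f hf := by
    obtain ⟨u, U, rfl, hu⟩ := hF.exists_rep hf
    rw [hF.form_eq u u U U hu hu]
    exact mul_nonneg hF.pos.le (integral_nonneg fun ω => mul_self_nonneg _)
  closed := hF.closed
  markov f hf := by
    obtain ⟨u, U, rfl, hu⟩ := hF.exists_rep hf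
    rw [toAEEqFun_truncate]
    -- Truncation is a contraction of the line, hence shortens every increment on every edge.
    have hle : ∀ m, X.energy m ((0 ⊔ u) ⊓ 1 : C(K, ℝ)) ((0 ⊔ u) ⊓ 1 : C(K, ℝ)) ≤
        ∫ ω, U ω ^ 2 ∂X.Λ := by
      intro m
      refine le_trans ?_ (hu.energy_le m)
      refine energy_comp_lipschitz (φ := fun t : ℝ => (0 ⊔ t) ⊓ 1) (fun x y => ?_) m u
      refine (abs_inf_sub_inf_le_abs _ _ _).trans ?_
      simpa only [sup_comm (0 : ℝ)] using abs_sup_sub_sup_le_abs x y 0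
    obtain ⟨V, hV⟩ := (finiteEnergy_of_le hle).exists_hasGrad
    refine ⟨hF.mem_of_hasGrad hV, ?_⟩
    rw [hF.form_eq _ _ V V hV hV, hF.form_eq u u U U hu hu]
    refine mul_le_mul_of_nonneg_left ?_ hF.pos.le
    have := le_of_tendsto' (hV.tendsto_energy hV) hle
    simpa only [sq] using this
  -- Every element of the domain already has a continuous representative, which serves as its own
  -- approximation.
  dense_domain f hf ε hε := by
    obtain ⟨u, U, rfl, hu⟩ := hF.exists_rep hf
    refine ⟨u, HasCompactSupport.of_compactSpace _, hf, ?_⟩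
    have h0 : X.HasGrad (u - u : C(K, ℝ)) fun _ => 0 := by
      rw [sub_self]
      exact HasGrad.const 0
    change F.form₁ ((u - u : C(K, ℝ)).toAEEqFun μ) ((u - u : C(K, ℝ)).toAEEqFun μ) < ε
    rw [hF.form₁_eq h0]
    simpa using hε
  dense_continuous u _ ε hε := by
    obtain ⟨v, hv, hvu⟩ := exists_finiteEnergy_approx X u hε
    exact ⟨v, HasCompactSupport.of_compactSpace _, (hF.mem_domain _).2 ⟨v, rfl, hv⟩, hvu⟩

end IsEnergyForm

end Form

end HataNetwork

/-! ### Forms whose energy measures have squares as densities -/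

namespace FormData

variable {X : Type*} [TopologicalSpace X] [MeasurableSpace X] [BorelSpace X]
  {μ : Measure X}

/-- The energy measures of `E` are `G_f² ℓ`, where `G` is additive and the zero sets of the `G_f`
have no common part of positive `ℓ`-measure. -/
structure HasSquareDensities (E : FormData X μ) (ℓ : Measure X) (G : (X →ₘ[μ] ℝ) → X → ℝ) :
    Prop where
  add_mem : ∀ f ∈ E.domain, ∀ g ∈ E.domain, f + g ∈ E.domain
  measurable : ∀ f ∈ E.domain, Measurable (G f)
  memLp : ∀ f ∈ E.domain, MemLp (G f) 2 ℓ
  energyMeasure_eq : ∀ f ∈ E.domain,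
    (E.energyMeasure f : Measure X) = ℓ.withDensity fun x => ENNReal.ofReal (G f x ^ 2)
  add_ae : ∀ f ∈ E.domain, ∀ g ∈ E.domain, ∀ᵐ x ∂ℓ, G (f + g) x = G f x + G g x
  exists_ne_zero : ∀ B, MeasurableSet B → ℓ B ≠ 0 → ∃ f ∈ E.domain, ℓ ({x | G f x ≠ 0} ∩ B) ≠ 0

namespace HasSquareDensities

variable {E : FormData X μ} {ℓ : Measure X} {G : (X →ₘ[μ] ℝ) → X → ℝ}
  (hG : E.HasSquareDensities ℓ G)
include hG

theorem energyDominant : E.EnergyDominant ℓ := by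
  intro f hf
  rw [hG.energyMeasure_eq f hf]
  exact withDensity_absolutelyContinuous _ _

theorem energyMeasure_eq_zero_iff {f : X →ₘ[μ] ℝ} (hf : f ∈ E.domain) (B : Set X) :
    (E.energyMeasure f : Measure X) B = 0 ↔ ℓ ({x | G f x ≠ 0} ∩ B) = 0 := by
  rw [hG.energyMeasure_eq f hf, withDensity_apply_eq_zero
    ((hG.measurable f hf).pow_const 2).ennreal_ofReal]
  have : {x | ENNReal.ofReal (G f x ^ 2) ≠ 0} = {x | G f x ≠ 0} := by
    ext x
    simp
  rw [this]

/-- On a set of positive `ℓ`-measure some `G f` is nonzero on a part of positive measure, so the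
energy measure of `f` charges it and a dominant `ν` must do so too. -/
theorem absolutelyContinuous {ν : Measure X} (hν : E.EnergyDominant ν) : ℓ ≪ ν := by
  refine Measure.AbsolutelyContinuous.mk fun B hB h0 => ?_
  by_contra h
  obtain ⟨f, hf, hfB⟩ := hG.exists_ne_zero B hB h
  exact hfB ((hG.energyMeasure_eq_zero_iff hf B).1 (hν f hf h0))

theorem isMinimalEnergyDominant [SigmaFinite ℓ] : E.IsMinimalEnergyDominant ℓ :=
  ⟨inferInstance, hG.energyDominant, fun _ _ h => hG.absolutelyContinuous h⟩

theorem real_energyMeasure {f : X →ₘ[μ] ℝ} (hf : f ∈ E.domain) {B : Set X}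
    (hB : MeasurableSet B) : (E.energyMeasure f : Measure X).real B = ∫ x in B, G f x ^ 2 ∂ℓ := by
  rw [measureReal_def, hG.energyMeasure_eq f hf, withDensity_apply _ hB,
    integral_eq_lintegral_of_nonneg_ae (ae_of_all _ fun x => sq_nonneg _)
    ((hG.measurable f hf).pow_const 2).aestronglyMeasurable]

/-- Polarization, using that `G` is additive almost everywhere. -/
theorem mutualEnergyMeasure_apply {f g : X →ₘ[μ] ℝ} (hf : f ∈ E.domain) (hg : g ∈ E.domain)
    {B : Set X} (hB : MeasurableSet B) :
    E.mutualEnergyMeasure f g B = ∫ x in B, G f x * G g x ∂ℓ := by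
  have hfg := hG.add_mem f hf g hg
  have i1 : Integrable (fun x => G f x ^ 2) (ℓ.restrict B) :=
    (hG.memLp f hf).integrable_sq.integrableOn
  have i2 : Integrable (fun x => G g x ^ 2) (ℓ.restrict B) :=
    (hG.memLp g hg).integrable_sq.integrableOn
  have i3 : Integrable (fun x => G f x * G g x) (ℓ.restrict B) :=
    ((hG.memLp f hf).integrable_mul_two (hG.memLp g hg)).integrableOn
  have i12 : Integrable (fun x => G f x ^ 2 + G g x ^ 2) (ℓ.restrict B) := i1.add i2
  have e : ∫ x in B, G (f + g) x ^ 2 ∂ℓ =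
      ∫ x in B, G f x ^ 2 ∂ℓ + ∫ x in B, G g x ^ 2 ∂ℓ + 2 * ∫ x in B, G f x * G g x ∂ℓ := by
    rw [← integral_add i1 i2, ← integral_const_mul, ← integral_add i12 (i3.const_mul 2)]
    refine integral_congr_ae ?_
    filter_upwards [ae_restrict_of_ae (hG.add_ae f hf g hg)] with x hx
    rw [hx]
    ring
  rw [mutualEnergyMeasure]
  simp only [_root_.smul_apply, _root_.sub_apply,
    Measure.toSignedMeasure_apply_measurable hB, hG.real_energyMeasure hf hB,
    hG.real_energyMeasure hg hB, hG.real_energyMeasure hfg hB, e, smul_eq_mul]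
  ring

theorem rnDeriv_mutualEnergyMeasure [SigmaFinite ℓ] {ν : Measure X} [SigmaFinite ν] (hν : ℓ ≪ ν)
    {f g : X →ₘ[μ] ℝ} (hf : f ∈ E.domain) (hg : g ∈ E.domain) :
    ∀ᵐ x ∂ν, (E.mutualEnergyMeasure f g).rnDeriv ν x =
      (ℓ.rnDeriv ν x).toReal * (G f x * G g x) := by
  have hi := (hG.memLp f hf).integrable_mul_two (hG.memLp g hg)
  have hi' : Integrable (fun x => (ℓ.rnDeriv ν x).toReal * (G f x * G g x)) ν :=
    (integrable_rnDeriv_smul_iff hν).2 hi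
  have key := SignedMeasure.eq_rnDeriv (s := E.mutualEnergyMeasure f g) (μ := ν) 0 _ hi'
    VectorMeasure.MutuallySingular.zero_left (by
      rw [zero_add]
      ext B hB
      rw [hG.mutualEnergyMeasure_apply hf hg hB, withDensityᵥ_apply hi' hB]
      exact (setIntegral_rnDeriv_smul hν hB).symm)
  exact key.symm

/-- The density matrix is a scalar times the outer product of the vector of the `G (f i)` with
itself. A bound smaller than one would be zero, would kill all one-by-one matrices, and so would
make every `G f` vanish `ℓ`-almost everywhere. -/
theorem hasIndex_one [SigmaFinite ℓ] (h0 : ℓ ≠ 0)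
    (hex : ∀ f ∈ E.domain, ∃! ν : FiniteMeasure X, E.IsEnergyMeasure f ν) : E.HasIndex 1 := by
  refine ⟨hex, ⟨ℓ, hG.isMinimalEnergyDominant⟩, ?_⟩
  rintro ν ⟨hσ, hdom, -⟩
  have hν := hG.absolutelyContinuous hdom
  constructor
  · intro n f hf
    have h : ∀ᵐ x ∂ν, ∀ i j, (E.mutualEnergyMeasure (f i) (f j)).rnDeriv ν x =
        (ℓ.rnDeriv ν x).toReal * (G (f i) x * G (f j) x) :=
      ae_all_iff.2 fun i => ae_all_iff.2 fun j =>
        hG.rnDeriv_mutualEnergyMeasure hν (hf i) (hf j)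
    filter_upwards [h] with x hx
    have e : E.densityMatrix ν f x = Matrix.vecMulVec
        (fun i => (ℓ.rnDeriv ν x).toReal * G (f i) x) fun j => G (f j) x := by
      ext i j
      rw [densityMatrix, Matrix.of_apply, hx, Matrix.vecMulVec_apply, mul_assoc]
    rw [e]
    exact_mod_cast Matrix.rank_vecMulVec_le _ _
  · intro p hp
    by_contra hlt
    rw [not_le, Order.lt_one_iff] at hlt
    obtain ⟨f, hf, hfne⟩ := hG.exists_ne_zero Set.univ MeasurableSet.univ
      (by rwa [Ne, Measure.measure_univ_eq_zero])
    refine hfne ?_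
    have h1 := hp 1 (fun _ => f) fun _ => hf
    have h2 : ∀ᵐ x ∂ℓ, G f x = 0 := by
      filter_upwards [hν.ae_le h1, hν.ae_le (hG.rnDeriv_mutualEnergyMeasure hν hf hf),
        Measure.rnDeriv_pos hν, hν.ae_le (Measure.rnDeriv_ne_top ℓ ν)] with x e1 e2 e3 e4
      rw [hlt, nonpos_iff_eq_zero, Nat.cast_eq_zero, Matrix.rank, Submodule.finrank_eq_zero, LinearMap.range_eq_bot] at e1
      have e5 : E.densityMatrix ν (fun _ : Fin 1 => f) x 0 0 = 0 := by
        have := congrFun (LinearMap.congr_fun e1 (Pi.single 0 1)) 0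
        simpa using this
      rw [densityMatrix, Matrix.of_apply, e2] at e5
      exact mul_self_eq_zero.1 ((mul_eq_zero.1 e5).resolve_left
        (ENNReal.toReal_pos e3.ne' e4).ne')
    rw [Set.inter_univ]
    exact h2

end HasSquareDensities

end FormData

namespace HataNetwork

/-! ### The length measure on the tree -/

section Length

variable {K : Type*} [TopologicalSpace K] {X : HataNetwork K}

variable (X) in
/-- The words with a shift coding the branching point. -/
def branchWords : Set (ℕ → Fin 2) := {ω | ∃ n : ℕ, X.L.π (fun m => ω (m + n)) = X.L.ψ 1 X.o}

theorem measurable_shift_iterate (n : ℕ) :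
    Measurable fun (ω : ℕ → Fin 2) (m : ℕ) => ω (m + n) :=
  measurable_pi_iff.2 fun m => measurable_pi_apply (m + n)

theorem measurableSet_shift_branch [T1Space K] (n : ℕ) :
    MeasurableSet {ω : ℕ → Fin 2 | X.L.π (fun m => ω (m + n)) = X.L.ψ 1 X.o} :=
  (measurable_shift_iterate n)
    ((isClosed_singleton (x := X.L.ψ 1 X.o)).preimage X.L.continuous_π).measurableSet

/-- The branching point has two codes, each a null set, and self-similarity transfers nullity
through the shifts. -/
theorem measure_branchWords [T1Space K] : X.Λ X.branchWords = 0 := by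
  have h : ∀ n : ℕ, X.Λ {ω | X.L.π (fun m => ω (m + n)) = X.L.ψ 1 X.o} = 0 := by
    intro n
    induction n with
    | zero =>
      simp only [add_zero, X.tree.π_eq_one_o]
      exact measure_union_null (X.skeleton.singleton _) (X.skeleton.singleton _)
    | succ n ih =>
      rw [X.skeleton.measure_eq (measurableSet_shift_branch (n + 1))]
      change _ * X.Λ {ω | X.L.π (fun m => ω (m + n)) = X.L.ψ 1 X.o} +
        _ * X.Λ {ω | X.L.π (fun m => ω (m + n)) = X.L.ψ 1 X.o} = 0
      rw [ih, mul_zero, mul_zero, add_zero]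
  have e : X.branchWords = ⋃ n : ℕ, {ω | X.L.π (fun m => ω (m + n)) = X.L.ψ 1 X.o} := by
    ext ω
    simp [branchWords]
  rw [e]
  exact measure_iUnion_null h

theorem measurableSet_branchWords [T1Space K] : MeasurableSet X.branchWords := by
  have e : X.branchWords = ⋃ n : ℕ, {ω | X.L.π (fun m => ω (m + n)) = X.L.ψ 1 X.o} := by
    ext ω
    simp [branchWords]
  rw [e]
  exact MeasurableSet.iUnion measurableSet_shift_branch

theorem π_shift_eq (n : ℕ) : ∀ {ω ω' : ℕ → Fin 2}, (∀ k < n, ω k = ω' k) →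
    X.L.π ω = X.L.π ω' → X.L.π (fun m => ω (m + n)) = X.L.π fun m => ω' (m + n) := by
  induction n with
  | zero => exact fun _ h => h
  | succ n ih =>
    intro ω ω' hk h
    rw [SelfSimilarStructure.IsHataTree.π_cons, SelfSimilarStructure.IsHataTree.π_cons X.L ω',
      hk 0 n.succ_pos] at h
    exact ih (ω := fun m => ω (m + 1)) (ω' := fun m => ω' (m + 1))
      (fun k hk' => hk (k + 1) (Nat.succ_lt_succ hk')) (X.L.injective_ψ _ h)

/-- From the first difference on, two codes of one point give a common point of both pieces, which
is the branching point. -/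
theorem eq_of_π_eq {ω ω' : ℕ → Fin 2} (hω : ω ∉ X.branchWords) (h : X.L.π ω = X.L.π ω') :
    ω = ω' := by
  by_contra hne
  obtain ⟨n, hn, hn'⟩ := exists_ne_first hne
  refine hω ⟨n, X.tree.mem_overlap.1 ⟨ω n, ω' n, hn', ?_, ?_⟩⟩
  · rw [SelfSimilarStructure.IsHataTree.π_cons]
    simp
  · rw [π_shift_eq n hn h, SelfSimilarStructure.IsHataTree.π_cons]
    simp

variable (X) in
/-- The coding map has a measurable left inverse off a null set. -/
theorem exists_section [T2Space K] [SecondCountableTopology K] [MeasurableSpace K] [BorelSpace K] :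
    ∃ s : K → ℕ → Fin 2, Measurable s ∧ ∀ᵐ ω ∂X.Λ, s (X.L.π ω) = ω := by
  have : StandardBorelSpace ((X.branchWords)ᶜ : Set (ℕ → Fin 2)) :=
    (measurableSet_branchWords (X := X)).compl.standardBorel
  -- Lusin–Souslin: an injective measurable map on a standard Borel space is a measurable embedding.
  have hemb := (X.L.continuous_π.measurable.comp (measurable_subtype_coe
    (p := (· ∈ (X.branchWords)ᶜ)))).measurableEmbedding
    fun ω ω' h => Subtype.ext (eq_of_π_eq ω.2 h)
  obtain ⟨s, hs, hsg⟩ := hemb.exists_measurable_extend measurable_subtype_coe fun _ => inferInstance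
  refine ⟨s, hs, ?_⟩
  have : ∀ᵐ ω ∂X.Λ, ω ∉ X.branchWords := measure_eq_zero_iff_ae_notMem.1 measure_branchWords
  filter_upwards [this] with ω hω
  exact congrFun hsg ⟨ω, hω⟩

instance sigmaFinite : SigmaFinite X.Λ := by
  refine Measure.sigmaFinite_of_countable
    (S := insert {ω | ∀ n : ℕ, (fun m => ω (m + n)) ∉ blockSet}
      (Set.range fun n : ℕ => {ω : ℕ → Fin 2 | (fun m => ω (m + n)) ∈ blockSet}))
    ((Set.countable_range _).insert _) ?_ ?_
  · rintro _ (rfl | ⟨n, rfl⟩)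
    · rw [X.skeleton.concentrated]
      exact ENNReal.zero_lt_top
    · exact X.skeleton.measure_shift_iterate n
  · refine Set.eq_univ_of_forall fun ω => ?_
    by_cases h : ∃ n : ℕ, (fun m => ω (m + n)) ∈ blockSet
    · obtain ⟨n, hn⟩ := h
      exact ⟨_, Or.inr ⟨n, rfl⟩, hn⟩
    · exact ⟨_, Or.inl rfl, not_exists.1 h⟩

theorem HasGrad.ae_eq {u : K → ℝ} {g h : (ℕ → Fin 2) → ℝ} (hg : X.HasGrad u g)
    (hh : X.HasGrad u h) : g =ᵐ[X.Λ] h := by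
  have h1 := (tendsto_toLp_iff (X.memLp_grad · u) hg.2.1).2 hg.2.2
  have h2 := (tendsto_toLp_iff (X.memLp_grad · u) hh.2.1).2 hh.2.2
  exact (MemLp.toLp_eq_toLp_iff hg.2.1 hh.2.1).1 (tendsto_nhds_unique h1 h2)

end Length

/-! ### Energy measures -/

section EnergyMeasure

variable {K : Type*} [TopologicalSpace K] [MeasurableSpace K] [BorelSpace K]

/-- Finite measures which agree on the continuous functions of finite energy are equal. -/
theorem measure_ext [T2Space K] [CompactSpace K] [HasOuterApproxClosed K] (X : HataNetwork K)
    {κ κ' : Measure K} [IsFiniteMeasure κ] [IsFiniteMeasure κ']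
    (h : ∀ v : C(K, ℝ), X.FiniteEnergy v → ∫ x, v x ∂κ = ∫ x, v x ∂κ') : κ = κ' := by
  refine ext_of_forall_integral_eq_of_IsFiniteMeasure fun φ => ?_
  rw [← sub_eq_zero, ← abs_nonpos_iff]
  refine le_of_forall_pos_le_add fun δ hδ => ?_
  set M := κ.real Set.univ + κ'.real Set.univ with hM
  have hM0 : 0 ≤ M := add_nonneg measureReal_nonneg measureReal_nonneg
  obtain ⟨v, hv, hvφ⟩ := exists_finiteEnergy_approx X φ.toContinuousMap
    (show 0 < δ / (M + 1) by positivity)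
  have e : ∀ (P : Measure K) [IsFiniteMeasure P],
      |∫ x, φ x ∂P - ∫ x, v x ∂P| ≤ δ / (M + 1) * P.real Set.univ := by
    intro P _
    have i1 : Integrable φ P := integrable_continuous φ.toContinuousMap
    rw [← integral_sub i1 (integrable_continuous v)]
    exact norm_integral_le_of_norm_le_const (f := fun x => φ x - v x) (ae_of_all _ hvφ)
  have h1 := e κ
  have h2 := e κ'
  rw [← h v hv, abs_sub_comm] at h2
  have h3 := abs_sub_le (∫ x, φ x ∂κ) (∫ x, v x ∂κ) (∫ x, φ x ∂κ')
  have h4 : δ / (M + 1) * κ.real Set.univ + δ / (M + 1) * κ'.real Set.univ ≤ δ := by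
    rw [← mul_add, ← hM, div_mul_eq_mul_div, div_le_iff₀ (by positivity)]
    nlinarith
  linarith

namespace IsEnergyForm

variable {μ : Measure K} {X : HataNetwork K} {a : ℝ} {F : FormData K μ} (hF : X.IsEnergyForm a F)
include hF

/-- By the product rule, with `h` the gradient of `φ`, the right side is `2a ∫ (u h + φ g) g - a ∫ h
(2 u g)`; the terms with `h` cancel. -/
theorem energyIdentity_iff [SecondCountableTopology K] [CompactSpace K] [μ.IsOpenPosMeasure]
    {u : C(K, ℝ)} {g : (ℕ → Fin 2) → ℝ}
    (hu : X.HasGrad u g) (ν : FiniteMeasure K) : F.EnergyIdentity (u.toAEEqFun μ) ν ↔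
      ∀ φ : C(K, ℝ), φ.toAEEqFun μ ∈ F.domain →
        ∫ x, φ x ∂(ν : Measure K) = ∫ ω, φ (X.L.π ω) * (2 * a * g ω ^ 2) ∂X.Λ := by
  have key : ∀ φ : C(K, ℝ), φ.toAEEqFun μ ∈ F.domain →
      2 * F.form (u.toAEEqFun μ * φ.toAEEqFun μ) (u.toAEEqFun μ) -
        F.form (φ.toAEEqFun μ) (u.toAEEqFun μ * u.toAEEqFun μ) =
      ∫ ω, φ (X.L.π ω) * (2 * a * g ω ^ 2) ∂X.Λ := by
    intro φ hφ
    obtain ⟨h, hh⟩ := (hF.finiteEnergy_of_mem hφ).exists_hasGrad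
    have h1 := hu.mul hh u.continuous φ.continuous
    have h2 := hu.mul hu u.continuous u.continuous
    change 2 * F.form ((u * φ).toAEEqFun μ) _ - F.form _ ((u * u).toAEEqFun μ) = _
    rw [hF.form_eq (u * φ) u _ g h1 hu, hF.form_eq φ (u * u) h _ hh h2, ← mul_assoc,
      ← integral_const_mul, ← integral_const_mul, ← integral_sub
      ((h1.2.1.integrable_mul_two hu.2.1).const_mul _)
      ((hh.2.1.integrable_mul_two h2.2.1).const_mul _)]
    congr 1
    funext ω
    ring
  refine forall_congr' fun φ => ?_
  constructor
  · intro h hφ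
    rw [h (HasCompactSupport.of_compactSpace _) hφ, key φ hφ]
  · intro h _ hφ
    rw [h hφ, key φ hφ]

/-- The domain consists of classes of continuous functions on a compact space, so the clause for
unbounded functions is void. -/
theorem isEnergyMeasure_iff [SecondCountableTopology K] [CompactSpace K] [IsFiniteMeasure μ]
    [μ.IsOpenPosMeasure] {u : C(K, ℝ)} {g : (ℕ → Fin 2) → ℝ} (hu : X.HasGrad u g)
    (ν : FiniteMeasure K) : F.IsEnergyMeasure (u.toAEEqFun μ) ν ↔
      ∀ φ : C(K, ℝ), φ.toAEEqFun μ ∈ F.domain →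
        ∫ x, φ x ∂(ν : Measure K) = ∫ ω, φ (X.L.π ω) * (2 * a * g ω ^ 2) ∂X.Λ := by
  have hb : MemLp (u.toAEEqFun μ) ⊤ μ :=
    (memLp_congr_ae (u.coeFn_toAEEqFun μ)).2 (memLp_continuous u ⊤)
  rw [← hF.energyIdentity_iff hu]
  exact ⟨fun h => h.1 hb, fun h => ⟨fun _ => h, fun h' => absurd hb h'⟩⟩

/-- The energy measure of a function with gradient `g`. -/
theorem exists_energyMeasure [SecondCountableTopology K] [CompactSpace K] [IsFiniteMeasure μ]
    [μ.IsOpenPosMeasure] {s : K → ℕ → Fin 2} (hs : Measurable s)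
    (hsπ : ∀ᵐ ω ∂X.Λ, s (X.L.π ω) = ω) {u : C(K, ℝ)} {g : (ℕ → Fin 2) → ℝ}
    (hu : X.HasGrad u g) : ∃ ν : FiniteMeasure K, F.IsEnergyMeasure (u.toAEEqFun μ) ν ∧
      (ν : Measure K) = (X.Λ.map X.L.π).withDensity
        fun x => ENNReal.ofReal ((√(2 * a) * g (s x)) ^ 2) := by
  have hπ := X.L.continuous_π.measurable
  have hgs : Measurable fun x => g (s x) := hu.1.comp hs
  have hsq : ∀ t : ℝ, (√(2 * a) * t) ^ 2 = 2 * a * t ^ 2 := fun t => by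
    rw [mul_pow, Real.sq_sqrt (by linarith [hF.pos])]
  have hd : Measurable fun x => ENNReal.ofReal ((√(2 * a) * g (s x)) ^ 2) :=
    ((hgs.const_mul _).pow_const 2).ennreal_ofReal
  have hfin : ∫⁻ x, ENNReal.ofReal ((√(2 * a) * g (s x)) ^ 2) ∂(X.Λ.map X.L.π) ≠ ⊤ := by
    rw [lintegral_map hd hπ]
    have e : ∫⁻ ω, ENNReal.ofReal ((√(2 * a) * g (s (X.L.π ω))) ^ 2) ∂X.Λ =
        ∫⁻ ω, ENNReal.ofReal (2 * a * g ω ^ 2) ∂X.Λ := by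
      refine lintegral_congr_ae ?_
      filter_upwards [hsπ] with ω hω
      rw [hω, hsq]
    rw [e]
    exact (hu.2.1.integrable_sq.const_mul (2 * a)).lintegral_lt_top.ne
  have := isFiniteMeasure_withDensity hfin
  refine ⟨⟨_, this⟩, (hF.isEnergyMeasure_iff hu _).2 fun φ _ => ?_, rfl⟩
  change ∫ x, φ x ∂((X.Λ.map X.L.π).withDensity _) = _
  rw [integral_withDensity_eq_integral_toReal_smul hd (ae_of_all _ fun x => ENNReal.ofReal_lt_top),
    integral_map (f := fun x => (ENNReal.ofReal ((√(2 * a) * g (s x)) ^ 2)).toReal • φ x)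
    hπ.aemeasurable
    (hd.ennreal_toReal.aestronglyMeasurable.smul φ.continuous.aestronglyMeasurable)]
  refine integral_congr_ae ?_
  filter_upwards [hsπ] with ω hω
  rw [hω, ENNReal.toReal_ofReal (sq_nonneg _), hsq, smul_eq_mul, mul_comm]

theorem existsUnique_energyMeasure [T2Space K] [SecondCountableTopology K] [CompactSpace K]
    [HasOuterApproxClosed K] [IsFiniteMeasure μ] [μ.IsOpenPosMeasure] {f : K →ₘ[μ] ℝ}
    (hf : f ∈ F.domain) : ∃! ν : FiniteMeasure K, F.IsEnergyMeasure f ν := by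
  obtain ⟨u, g, rfl, hu⟩ := hF.exists_rep hf
  obtain ⟨s, hs, hsπ⟩ := X.exists_section
  obtain ⟨ν, hν, -⟩ := hF.exists_energyMeasure hs hsπ hu
  refine ⟨ν, hν, fun ν' hν' => Subtype.ext (measure_ext (κ := (ν' : Measure K))
    (κ' := (ν : Measure K)) X fun v hv => ?_)⟩
  have hv' := (hF.mem_domain _).2 ⟨v, rfl, hv⟩
  exact ((hF.isEnergyMeasure_iff hu ν').1 hν' v hv').trans
    ((hF.isEnergyMeasure_iff hu ν).1 hν v hv').symm

theorem energyMeasure_eq [T2Space K] [SecondCountableTopology K] [CompactSpace K]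
    [HasOuterApproxClosed K] [IsFiniteMeasure μ] [μ.IsOpenPosMeasure] {f : K →ₘ[μ] ℝ}
    (hf : f ∈ F.domain) {ν : FiniteMeasure K} (hν : F.IsEnergyMeasure f ν) :
    F.energyMeasure f = ν := by
  have hex : ∃ ν, F.IsEnergyMeasure f ν := ⟨ν, hν⟩
  rw [FormData.energyMeasure, dif_pos hex]
  exact (hF.existsUnique_energyMeasure hf).unique hex.choose_spec hν

/-- The measurable section identifies `Λ` with its image on `K`, so gradients become functions on
`K`; the factor `√(2 * a)` makes the energy densities exact squares. -/
theorem hasIndex_one [T2Space K] [SecondCountableTopology K] [CompactSpace K]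
    [HasOuterApproxClosed K] [IsFiniteMeasure μ] [μ.IsOpenPosMeasure] : F.HasIndex 1 := by
  obtain ⟨s, hs, hsπ⟩ := X.exists_section
  have hπ := X.L.continuous_π.measurable
  have hmap : (X.Λ.map X.L.π).map s = X.Λ := by
    rw [Measure.map_map hs hπ]
    exact (Measure.map_congr hsπ).trans Measure.map_id
  have hae : ∀ p : (ℕ → Fin 2) → Prop, (∀ᵐ ω ∂X.Λ, p ω) → ∀ᵐ x ∂(X.Λ.map X.L.π), p (s x) := by
    intro p hp
    rw [← hmap] at hp
    exact ae_of_ae_map hs.aemeasurable hp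
  have hσ : SigmaFinite (X.Λ.map X.L.π) :=
    SigmaFinite.of_map _ hs.aemeasurable (by rw [hmap]; infer_instance)
  -- A gradient is fixed once for each class; linearity then holds only almost everywhere, as
  -- gradients are unique up to null sets.
  have hγ : ∀ f : K →ₘ[μ] ℝ, ∃ g : (ℕ → Fin 2) → ℝ, f ∈ F.domain →
      ∃ u : C(K, ℝ), u.toAEEqFun μ = f ∧ X.HasGrad u g := by
    intro f
    by_cases hf : f ∈ F.domain
    · obtain ⟨u, g, hu, hg⟩ := hF.exists_rep hf
      exact ⟨g, fun _ => ⟨u, hu, hg⟩⟩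
    · exact ⟨0, fun h => absurd h hf⟩
  choose γ hγ using hγ
  have ha : √(2 * a) ≠ 0 := (Real.sqrt_pos.2 (by linarith [hF.pos])).ne'
  have hadd : ∀ f ∈ F.domain, ∀ g ∈ F.domain, f + g ∈ F.domain := by
    intro f hf g hg
    obtain ⟨u, U, rfl, hu⟩ := hF.exists_rep hf
    obtain ⟨v, V, rfl, hv⟩ := hF.exists_rep hg
    exact hF.mem_of_hasGrad (u := u + v) (hu.add hv)
  have hG : F.HasSquareDensities (X.Λ.map X.L.π) fun f x => √(2 * a) * γ f (s x) :=
    { add_mem := hadd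
      measurable := fun f hf => by
        obtain ⟨u, -, hu⟩ := hγ f hf
        exact (hu.1.comp hs).const_mul _
      memLp := fun f hf => by
        obtain ⟨u, -, hu⟩ := hγ f hf
        have h := hu.2.1
        rw [← hmap] at h
        exact (h.comp_of_map hs.aemeasurable).const_mul _
      energyMeasure_eq := fun f hf => by
        obtain ⟨u, rfl, hu⟩ := hγ f hf
        obtain ⟨ν, hν, hν'⟩ := hF.exists_energyMeasure hs hsπ hu
        rw [hF.energyMeasure_eq hf hν, hν']
      add_ae := fun f hf g hg => by
        obtain ⟨u, hu, hug⟩ := hγ f hf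
        obtain ⟨v, hv, hvg⟩ := hγ g hg
        obtain ⟨w, hw, hwg⟩ := hγ (f + g) (hadd f hf g hg)
        have e : w = u + v := ContinuousMap.toAEEqFun_injective μ (by
          change w.toAEEqFun μ = u.toAEEqFun μ + v.toAEEqFun μ
          rw [hu, hv, hw])
        rw [e] at hwg
        filter_upwards [hae _ (hwg.ae_eq (hug.add hvg))] with x hx
        rw [hx, mul_add]
      exists_ne_zero := fun B hB hB0 => by
        rw [Measure.map_apply hπ hB] at hB0
        obtain ⟨u, g, hu, hg⟩ := exists_hasGrad_ne_zero (hπ hB) hB0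
        have hf := hF.mem_of_hasGrad hu
        obtain ⟨v, hv, hvg⟩ := hγ _ hf
        rw [ContinuousMap.toAEEqFun_injective μ hv] at hvg
        refine ⟨_, hf, fun h0 => hg ?_⟩
        rw [measure_eq_zero_iff_ae_notMem] at h0 ⊢
        filter_upwards [ae_of_ae_map hπ.aemeasurable h0, hsπ, hvg.ae_eq hu] with ω h1 h2 h3
        rintro ⟨h4, h5⟩
        refine h1 ⟨mul_ne_zero ha ?_, h4⟩
        rw [h2, h3]
        exact h5 }
  -- The measure is nonzero because the arc `oe` has length one.
  refine hG.hasIndex_one (fun h0 => ?_) fun f hf => hF.existsUnique_energyMeasure hf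
  have h1 := X.skeleton.blockSet_eq
  rw [← hmap, h0, Measure.map_zero] at h1
  simp at h1

end IsEnergyForm

end EnergyMeasure

end HataNetwork

/-! ### Conclusion for Hata's tree-like set -/

theorem proposition4p6 (c : ℂ) (hc : IsHataParameter c)
    (μ : Measure (hataSet hc)) [IsProbabilityMeasure μ] [μ.IsOpenPosMeasure] :
    ((hataStructure hc).IsPostCriticallyFinite ∧
      Subtype.val '' (hataStructure hc).V₀ = ({c, 0, 1} : Set ℂ) ∧
      (∀ i, hataMap c i c ≠ c) ∧
      ¬ (hataStructure hc).FixedPointConnected) ∧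
    ∀ (D : Matrix (hataStructure hc).V₀ (hataStructure hc).V₀ ℝ) (r : Fin 2 → ℝ),
      (hataStructure hc).IsRegularHarmonicStructure D r →
        ((hataStructure hc).dirichletForm μ D r).IsRegularDirichletForm ∧
        ((hataStructure hc).dirichletForm μ D r).HasIndex 1 := by
  have T := isHataTree_hataStructure hc
  have : CompactSpace (hataSet hc) := isCompact_iff_compactSpace.1 (isCompact_hataSet hc)
  refine ⟨⟨T.isPostCriticallyFinite, ?_, hataMap_self_ne hc, fun h => ?_⟩, fun D r h => ?_⟩
  · rw [T.V₀_eq, Set.image_insert_eq, Set.image_pair, Set.pair_comm]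
  -- The boundary point `c` already violates the fixed-point half of the condition.
  · obtain ⟨⟨i, hi⟩, -⟩ := h _ T.q_mem
    exact hataMap_self_ne hc i (congrArg Subtype.val hi)
  · have hF := T.isEnergyForm (μ := μ) h
    exact ⟨hF.isRegularDirichletForm, hF.hasIndex_one⟩
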